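/- \textbf{Setting.} Let $d\ge 1$. A polytopal element is a non-empty bounded open set $T\subset\mathbb R^d$, not necessarily convex, whose boundary is the union of finitely many faces $e_1,\dots,e_{N_T}$. The faces do not overlap (their pairwise intersections have surface measure zero). Each $e_i$ is a polytope in a hyperplane $H_i$, with unit outward normal $\mathbf n$ (the element lies locally on one side of $e_i$, near a dense set of points of $e_i$). Let $\mathcal T_h$ be a finite partition of $\Omega\subset\mathbb R^d$ into polytopal elements such that any two faces of elements either coincide or do not overlap. Write $h_T$, $h_e$ for the diameters of $T$, $e$, and $\|\cdot\|_T$, $\|\cdot\|_{\partial T}$ for the $L^2$ norms on $T$ and on $\partial T$. \textbf{Shape regularity.} Let $\rho_v,\rho_e,\kappa,\sigma,\tau>0$. The partition is called shape regular with these constants if every $T\in\mathcal T_h$ satisfies, for each of its faces $e$: (i) $\rho_v h_T^d\le |T|$ and $\rho_e h_e^{d-1}\le |e|$; (ii) $\kappa h_T\le h_e$ (if $d\ge 2$); (iii) $\overline T$ contains a pyramid with base $e$, apex in $\overline T$ and height at least $\sigma h_T$; (iv) for any other face $e'$ of $T$, with hyperplane $H'$, either $e$ has a point at distance at least $\tau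 h_T$ from $H'$, or $e$ and $e'$ lie in the same hyperplane $H'$ and $e$ contains a disc $\{y\in H' : |y-x|\le \tau h_T\}$ with centre $x\in e$. \textbf{Spaces and norms.} Let $k\ge q\ge 0$ be integers. $V_h$ is the space of all $v=\{v_0,v_b\}$ with $v_0|_T\in P_k(T)$ for each element $T$ and $v_b|_e\in P_q(e)$ for each face $e$, where $v_b$ is single-valued on the faces shared by two elements. For each $T$ let $r_T$ be a non-negative integer. The discrete weak gradient $\nabla_w v|_T\in[P_{r_T}(T)]^d$ is the unique polynomial vector field with $$(\nabla_w v,\boldsymbol\varphi)_T=-(v_0,\nabla\cdot\boldsymbol\varphi)_T+\langle v_b,\boldsymbol\varphi\cdot\mathbf n\rangle_{\partial T}\qquad\forall \boldsymbol\varphi\in[P_{r_T}(T)]^d .$$ Put $$|||v|||=\Big(\sum_{T}\|\nabla_w v\|_T^2\Big)^{1/2},\qquad \|v\|_{1,h}=\Big(\sum_{T}\|\nabla v_0\|_T^2+h_T^{-1}\|v_0-v_b\|_{\partial T}^2\Big)^{1/2}.$$ \textbf{Statement.} Given $d,k,q,\rho_v,\rho_e,\kappa,\sigma,\tau$, there is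 a function $s:\mathbb N\to\mathbb N$, and for each $R\in\mathbb N$ there are constants $C,C_1,C_2>0$, depending only on $d,k,q,\rho_v,\rho_e,\kappa,\sigma,\tau$ and (for $C, C_1,C_2$) on $R$, such that the following holds. Let $\mathcal T_h$ be any partition (of any $\Omega$) that is shape regular with these constants, and let the degrees satisfy $2N_T+k-1\le r_T\le R$ for every $T$, and in addition $r_T\ge s(N_T)$ for every $T$ that has two distinct faces in a common hyperplane. Then for all $v\in V_h$, $$\|\nabla v_0\|_T\le C\|\nabla_w v\|_T\quad\text{for all } T\in\mathcal T_h,\qquad\text{and}\qquad C_1\|v\|_{1,h}\le |||v|||\le C_2\|v\|_{1,h}.$$ In particular the constants do not depend on $v$ or on the mesh size. -/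

import Mathlib

open Set MeasureTheory
open scoped RealInnerProductSpace

noncomputable section

namespace WG

/-- The space `ℝ^d` with its Euclidean norm. -/
abbrev E (d : ℕ) : Type := EuclideanSpace ℝ (Fin d)

/-- The value at the point `x` of a polynomial in `d` real variables. -/
def peval {d : ℕ} (p : MvPolynomial (Fin d) ℝ) (x : E d) : ℝ :=
  MvPolynomial.eval (fun i => x i) p

/-- `f ∈ P_m(s)`: on the set `s` the function `f` agrees with a polynomial of total degree
at most `m`. -/
def IsPolyOn {d : ℕ} (m : ℕ) (s : Set (E d)) (f : E d → ℝ) : Prop :=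
  ∃ p : MvPolynomial (Fin d) ℝ, p.totalDegree ≤ m ∧ ∀ x ∈ s, f x = peval p x

/-- The space `[P_r]^d` of vector fields whose components are polynomials of total degree
at most `r`. -/
abbrev PolyVec (d r : ℕ) : Type :=
  Fin d → MvPolynomial.restrictTotalDegree (Fin d) ℝ r

/-- The value at `x` of a polynomial vector field. -/
def PolyVec.eval {d r : ℕ} (g : PolyVec d r) (x : E d) : E d :=
  WithLp.toLp 2 fun i => peval (g i : MvPolynomial (Fin d) ℝ) x

/-- The divergence at `x` of a polynomial vector field. -/
def PolyVec.div {d r : ℕ} (g : PolyVec d r) (x : E d) : ℝ :=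
  ∑ i, peval (MvPolynomial.pderiv i (g i : MvPolynomial (Fin d) ℝ)) x

/-- The `(d-1)`-dimensional surface measure on `ℝ^d` (the Hausdorff measure, normalised so that
it is Lebesgue measure on every hyperplane). -/
def surf (d : ℕ) : Measure (E d) := Measure.euclideanHausdorffMeasure (d - 1)

/-- A (possibly non-convex) polytopal element in `ℝ^d`: a non-empty bounded open set whose boundary
is the union of finitely many non-overlapping flat faces. A face is a polytope (a finite union of
convex hulls of finite sets) in a hyperplane `{x | ⟪normal, x⟫ = offset}`, and `normal` is its unit
outward normal: near a dense set of points of the face, the element is exactly the half ball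
on the inner side of the hyperplane.
Neither convexity, nor connectedness, nor a Lipschitz boundary is required. -/
structure Element (d : ℕ) where
  carrier : Set (E d)
  isOpen : IsOpen carrier
  nonempty : carrier.Nonempty
  bounded : Bornology.IsBounded carrier
  /-- the number `N` of edges/faces -/
  numFaces : ℕ
  face : Fin numFaces → Set (E d)
  normal : Fin numFaces → E d
  offset : Fin numFaces → ℝ
  norm_normal : ∀ i, ‖normal i‖ = 1
  face_flat : ∀ i, ∀ x ∈ face i, ⟪normal i, x⟫ = offset i
  face_polytope : ∀ i, ∃ P : Finset (Finset (E d)),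
    face i = ⋃ s ∈ P, convexHull ℝ (s : Set (E d))
  frontier_eq : frontier carrier = ⋃ i, face i
  face_overlap : ∀ i j, i ≠ j → surf d (face i ∩ face j) = 0
  outward : ∀ i, face i ⊆ closure {x | x ∈ face i ∧ ∃ ε > 0,
    Metric.ball x ε ∩ carrier = Metric.ball x ε ∩ {y | ⟪normal i, y⟫ < offset i}}

namespace Element

variable {d : ℕ} (T : Element d)

/-- The diameter `h_T`. -/
def diam : ℝ := Metric.diam T.carrier

/-- The hyperplane that contains the face `i`. -/
def plane (i : Fin T.numFaces) : Set (E d) := {x | ⟪T.normal i, x⟫ = T.offset i}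

/-- The squared `L²(T)` norm of a vector field. -/
def normSq (F : E d → E d) : ℝ := ∫ x in T.carrier, ‖F x‖ ^ 2

/-- `g ∈ [P_r(T)]^d` is a discrete weak gradient of the weak function `{v₀, v_b}` on `T`:
`(g, φ)_T = -(v₀, ∇·φ)_T + ⟨v_b, φ·n⟩_{∂T}` for all `φ ∈ [P_r(T)]^d`. The boundary component `v_b`
is given face by face. -/
def IsWeakGrad (r : ℕ) (v0 : E d → ℝ) (vb : Fin T.numFaces → E d → ℝ) (g : PolyVec d r) : Prop :=
  ∀ φ : PolyVec d r,
    ∫ x in T.carrier, ⟪g.eval x, φ.eval x⟫ =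
      -(∫ x in T.carrier, v0 x * φ.div x)
        + ∑ i, ∫ x in T.face i, vb i x * ⟪φ.eval x, T.normal i⟫ ∂(surf d)

/-- A polynomial that vanishes on an element is zero. -/
lemma eq_zero_of_peval (p : MvPolynomial (Fin d) ℝ)
    (h : ∀ x ∈ T.carrier, peval p x = 0) : p = 0 := by
  obtain ⟨a, ha⟩ := T.nonempty
  have ho : IsOpen ((WithLp.toLp 2 : (Fin d → ℝ) → E d) ⁻¹' T.carrier) :=
    T.isOpen.preimage (PiLp.continuous_toLp 2 _)
  have ha' : (WithLp.ofLp a) ∈ ((WithLp.toLp 2 : (Fin d → ℝ) → E d) ⁻¹' T.carrier) := ha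
  obtain ⟨ε, hε, hb⟩ := Metric.isOpen_iff.1 ho _ ha'
  refine MvPolynomial.funext_set (fun i => Metric.ball (a i) ε) (fun i => ?_) fun x hx => ?_
  · rw [Real.ball_eq_Ioo]
    exact Set.Ioo_infinite (by linarith)
  · have hx' : x ∈ Metric.ball (WithLp.ofLp a) ε := by
      rw [ball_pi _ hε]; exact hx
    have := h _ (hb hx')
    simpa [peval] using this

lemma continuous_peval (p : MvPolynomial (Fin d) ℝ) : Continuous (peval p) :=
  (MvPolynomial.continuous_eval p).comp (PiLp.continuous_ofLp 2 _)

lemma continuous_polyVec {r : ℕ} (g : PolyVec d r) : Continuous g.eval :=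
  (PiLp.continuous_toLp 2 _).comp (continuous_pi fun _ => continuous_peval _)

lemma continuous_div {r : ℕ} (g : PolyVec d r) : Continuous g.div :=
  continuous_finsetSum _ fun _ _ => continuous_peval _

lemma isCompact_closure : IsCompact (closure T.carrier) := T.bounded.isCompact_closure

lemma face_subset (i : Fin T.numFaces) : T.face i ⊆ closure T.carrier := fun _ hx =>
  frontier_subset_closure (T.frontier_eq ▸ Set.mem_iUnion_of_mem i hx)

lemma isCompact_face (i : Fin T.numFaces) : IsCompact (T.face i) := by
  obtain ⟨P, hP⟩ := T.face_polytope i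
  rw [hP]
  exact P.isCompact_biUnion fun s _ => s.finite_toSet.isCompact_convexHull (𝕜 := ℝ)

lemma integrableOn_of_continuous {f : E d → ℝ} (hf : Continuous f) :
    IntegrableOn f T.carrier :=
  (hf.continuousOn.integrableOn_compact T.isCompact_closure).mono_set subset_closure

lemma polyVec_add {r : ℕ} (g g' : PolyVec d r) (x : E d) :
    PolyVec.eval (g + g') x = g.eval x + g'.eval x := by
  ext i; simp [PolyVec.eval, peval]

lemma polyVec_smul {r : ℕ} (c : ℝ) (g : PolyVec d r) (x : E d) :
    PolyVec.eval (c • g) x = c • g.eval x := by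
  ext i; simp [PolyVec.eval, peval]

lemma div_add {r : ℕ} (g g' : PolyVec d r) (x : E d) :
    PolyVec.div (g + g') x = g.div x + g'.div x := by
  simp [PolyVec.div, peval, Finset.sum_add_distrib]

lemma div_smul {r : ℕ} (c : ℝ) (g : PolyVec d r) (x : E d) :
    PolyVec.div (c • g) x = c * g.div x := by
  simp [PolyVec.div, peval, Finset.mul_sum]

/-- The `L²(T)` inner product on `[P_r(T)]^d`, as a linear map into the dual. -/
def gram (r : ℕ) : PolyVec d r →ₗ[ℝ] Module.Dual ℝ (PolyVec d r) :=
  LinearMap.mk₂ ℝ (fun g φ => ∫ x in T.carrier, ⟪g.eval x, φ.eval x⟫)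
    (fun g g' φ => by
      simp only [polyVec_add, inner_add_left]
      exact integral_add
        (T.integrableOn_of_continuous ((continuous_polyVec g).inner (continuous_polyVec φ)))
        (T.integrableOn_of_continuous ((continuous_polyVec g').inner (continuous_polyVec φ))))
    (fun c g φ => by
      simp only [polyVec_smul, real_inner_smul_left]
      exact integral_const_mul _ _)
    (fun g φ φ' => by
      simp only [polyVec_add, inner_add_right]
      exact integral_add
        (T.integrableOn_of_continuous ((continuous_polyVec g).inner (continuous_polyVec φ)))
        (T.integrableOn_of_continuous ((continuous_polyVec g).inner (continuous_polyVec φ'))))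
    (fun c g φ => by
      simp only [polyVec_smul, real_inner_smul_right]
      exact integral_const_mul _ _)

lemma gram_bijective (r : ℕ) : Function.Bijective (T.gram r) := by
  have hinj : Function.Injective (T.gram r) := by
    rw [injective_iff_map_eq_zero]
    intro g hg
    have h0 : ∫ x in T.carrier, ⟪g.eval x, g.eval x⟫ = 0 := LinearMap.congr_fun hg g
    have hc : Continuous fun x => ⟪g.eval x, g.eval x⟫ :=
      (continuous_polyVec g).inner (continuous_polyVec g)
    have hae := (integral_eq_zero_iff_of_nonneg (fun x => real_inner_self_nonneg)
      (T.integrableOn_of_continuous hc)).1 h0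
    have hz := Measure.eqOn_open_of_ae_eq hae T.isOpen hc.continuousOn continuousOn_const
    funext i
    apply Subtype.ext
    refine T.eq_zero_of_peval _ fun x hx => ?_
    have hx0 : g.eval x = 0 := inner_self_eq_zero.1 (hz hx)
    exact congrArg (fun y : E d => y i) hx0
  exact ⟨hinj, (LinearMap.injective_iff_surjective_of_finrank_eq_finrank
    Subspace.dual_finrank_eq.symm).1 hinj⟩

/-- The discrete weak gradient exists and is unique. -/
theorem existsUnique_isWeakGrad (r : ℕ) (v0 : E d → ℝ) (vb : Fin T.numFaces → E d → ℝ)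
    (h0 : IntegrableOn v0 T.carrier) (hb : ∀ i, IntegrableOn (vb i) (T.face i) (surf d)) :
    ∃! g : PolyVec d r, T.IsWeakGrad r v0 vb g := by
  have i0 : ∀ φ : PolyVec d r, IntegrableOn (fun x => v0 x * φ.div x) T.carrier := fun φ =>
    h0.mul_continuousOn_of_subset (continuous_div φ).continuousOn T.isOpen.measurableSet
      T.isCompact_closure subset_closure
  have ib : ∀ (φ : PolyVec d r) i,
      IntegrableOn (fun x => vb i x * ⟪φ.eval x, T.normal i⟫) (T.face i) (surf d) := fun φ i =>
    (hb i).mul_continuousOn ((continuous_polyVec φ).inner continuous_const).continuousOn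
      (T.isCompact_face i)
  let L : Module.Dual ℝ (PolyVec d r) :=
    { toFun := fun φ => -(∫ x in T.carrier, v0 x * φ.div x)
        + ∑ i, ∫ x in T.face i, vb i x * ⟪φ.eval x, T.normal i⟫ ∂(surf d)
      map_add' := fun φ φ' => by
        have e1 := integral_add (i0 φ) (i0 φ')
        have e2 := fun i => integral_add (ib φ i) (ib φ' i)
        simp only [div_add, polyVec_add, inner_add_left, mul_add, e1, e2, Finset.sum_add_distrib]
        ring
      map_smul' := fun c φ => by
        simp only [div_smul, polyVec_smul, real_inner_smul_left, mul_left_comm _ c,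
          integral_const_mul, ← Finset.mul_sum, smul_eq_mul, RingHom.id_apply]
        ring }
  obtain ⟨g, hg, hu⟩ := (T.gram_bijective r).existsUnique L
  refine ⟨g, fun φ => LinearMap.congr_fun hg φ, fun g' hg' => hu g' ?_⟩
  exact LinearMap.ext hg'

open Classical in
/-- The discrete weak gradient `∇_{w,r,T} v` of the weak function `v = {v₀, v_b}` on `T`. By
`existsUnique_isWeakGrad` it is the unique `g` with `T.IsWeakGrad r v₀ v_b g`
whenever `v₀` and `v_b` are integrable; the other branch is then irrelevant. -/
def weakGrad (r : ℕ) (v0 : E d → ℝ) (vb : Fin T.numFaces → E d → ℝ) : PolyVec d r :=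
  if h : ∃ g, T.IsWeakGrad r v0 vb g then h.choose else 0

theorem isWeakGrad_weakGrad (r : ℕ) (v0 : E d → ℝ) (vb : Fin T.numFaces → E d → ℝ)
    (h0 : IntegrableOn v0 T.carrier) (hb : ∀ i, IntegrableOn (vb i) (T.face i) (surf d)) :
    T.IsWeakGrad r v0 vb (T.weakGrad r v0 vb) := by
  have h := (T.existsUnique_isWeakGrad r v0 vb h0 hb).exists
  rw [weakGrad, dif_pos h]
  exact h.choose_spec

/-- Two distinct faces of `T` lie in a common hyperplane. -/
def HasCoplanarFaces : Prop := ∃ i j, i ≠ j ∧ T.plane i = T.plane j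

/-- Shape regularity of one element, with constants `ρv ρe κ σ τ`. -/
structure ShapeRegular (ρv ρe κ σ τ : ℝ) : Prop where
  /-- the volume of `T` is comparable to `h_T ^ d` -/
  volume_ge : ρv * T.diam ^ d ≤ (volume T.carrier).toReal
  /-- the area of a face `e` is comparable to `h_e ^ (d - 1)` -/
  area_ge : ∀ i, ρe * Metric.diam (T.face i) ^ (d - 1) ≤ (surf d (T.face i)).toReal
  /-- the diameter of a face is comparable to that of `T` (void for `d = 1`: faces are points) -/
  face_diam_ge : 2 ≤ d → ∀ i, κ * T.diam ≤ Metric.diam (T.face i)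
  /-- `T` contains a pyramid with base `e` whose height is at least `σ * h_T` -/
  pyramid : ∀ i, ∃ A ∈ closure T.carrier,
    (∀ x ∈ T.face i, segment ℝ A x ⊆ closure T.carrier) ∧
    σ * T.diam ≤ |⟪T.normal i, A⟫ - T.offset i|
  /-- A face `i` and the hyperplane of another face `j` are not almost coplanar: either some point
  of face `i` has distance at least `τ * h_T` from the hyperplane of face `j`; or
  both hyperplanes are the same, and face `i` contains a disc of radius `τ * h_T`. -/
  separated : ∀ i j, i ≠ j →
    (∃ x ∈ T.face i, τ * T.diam ≤ |⟪T.normal j, x⟫ - T.offset j|) ∨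
    (T.plane i = T.plane j ∧
      ∃ x ∈ T.face i, Metric.closedBall x (τ * T.diam) ∩ T.plane i ⊆ T.face i)

end Element

/-- A finite element partition `𝒯_h` of `Ω ⊆ ℝ^d` into polytopal elements. Faces of elements
either coincide or do not overlap, so an interior face is shared by the elements on its sides. -/
structure Partition {d : ℕ} (Ω : Set (E d)) where
  numElems : ℕ
  elem : Fin numElems → Element d
  subset : ∀ T, (elem T).carrier ⊆ Ω
  disjoint : ∀ T T', T ≠ T' → Disjoint (elem T).carrier (elem T').carrier
  cover : closure Ω = ⋃ T, closure (elem T).carrier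
  conforming : ∀ T T' i j, (elem T).face i = (elem T').face j ∨
    surf d ((elem T).face i ∩ (elem T').face j) = 0

/-- A weak function `v = {v₀, v_b}` on a partition: `v0 T` is its first component on the element
`T`, and `vb e` is its second component on the face `e`. As `vb e` depends only on the face `e`, and
not on the element, `v_b` has a single value on the faces shared by two elements. -/
structure WeakFunction {d : ℕ} {Ω : Set (E d)} (𝒯 : Partition Ω) where
  v0 : Fin 𝒯.numElems → E d → ℝ
  vb : Set (E d) → E d → ℝ

namespace WeakFunction

variable {d : ℕ} {Ω : Set (E d)} {𝒯 : Partition Ω}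

/-- `v ∈ V_h`: `v₀ ∈ P_k(T)` on each element (up to the boundary, so that the values of `v₀` on
`∂T` are its trace) and `v_b ∈ P_q(e)` on each face. -/
def MemVh (k q : ℕ) (v : WeakFunction 𝒯) : Prop :=
  (∀ T, IsPolyOn k (closure (𝒯.elem T).carrier) (v.v0 T)) ∧
  ∀ T i, IsPolyOn q ((𝒯.elem T).face i) (v.vb ((𝒯.elem T).face i))

/-- The discrete weak gradient of `v` on the element `T`, computed with polynomials of
degree `r T`. -/
def weakGrad (r : Fin 𝒯.numElems → ℕ) (v : WeakFunction 𝒯) (T : Fin 𝒯.numElems) :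
    PolyVec d (r T) :=
  (𝒯.elem T).weakGrad (r T) (v.v0 T) fun i => v.vb ((𝒯.elem T).face i)

/-- `‖∇_w v‖_T ^ 2` -/
def weakGradSq (r : Fin 𝒯.numElems → ℕ) (v : WeakFunction 𝒯) (T : Fin 𝒯.numElems) : ℝ :=
  (𝒯.elem T).normSq (v.weakGrad r T).eval

/-- `‖∇ v₀‖_T ^ 2` -/
def gradSq (v : WeakFunction 𝒯) (T : Fin 𝒯.numElems) : ℝ :=
  (𝒯.elem T).normSq (gradient (v.v0 T))

/-- `‖v₀ - v_b‖_{∂T} ^ 2` -/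
def jumpSq (v : WeakFunction 𝒯) (T : Fin 𝒯.numElems) : ℝ :=
  ∑ i, ∫ x in (𝒯.elem T).face i, (v.v0 T x - v.vb ((𝒯.elem T).face i) x) ^ 2 ∂(surf d)

/-- The discrete energy norm `|||v|||`. -/
def energyNorm (r : Fin 𝒯.numElems → ℕ) (v : WeakFunction 𝒯) : ℝ :=
  √(∑ T, v.weakGradSq r T)

/-- The discrete `H¹` semi-norm `‖v‖_{1,h}`. -/
def norm1h (v : WeakFunction 𝒯) : ℝ :=
  √(∑ T, (v.gradSq T + (𝒯.elem T).diam⁻¹ * v.jumpSq T))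

end WeakFunction

end WG

end

open Set MeasureTheory
open scoped RealInnerProductSpace Pointwise

noncomputable section

namespace WG

/-! The problem is local: each element satisfies three estimates with a constant that depends on the
number `N` of its faces. The degree condition bounds `N` by `R`, so finitely many constants suffice,
and the global inequalities follow by summing squares. On one element the divergence theorem
`Element.integral_fderiv` turns the definition of the weak gradient `g` into `Element.Green`: for
every polynomial field `φ` of degree at most `r`, the integral of `(g - ∇v₀)·φ` over `T` is minus
the integral of `(v₀ - v_b) φ·n` over `∂T`. Three choices of `φ` give the three estimates.

Gradient (`exists_normSq_pgrad_le`): take `φ = L ∇v₀`, where `L` is the product over all faces of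
the squared signed distances to their hyperplanes, scaled by `h_T`. The boundary term vanishes, so
the integral of `L |∇v₀|²` equals that of `g·φ`. For `k ≥ 1` the degree of `φ` is at most `2N + k -
1`.

Weak gradient (`exists_normSq_weakGrad_le`): take `φ = g` and bound its boundary values by an
inverse trace inequality.

Jumps (`exists_jump_le`): let `i` be a face with the largest maximal jump. Take `φ = w L Q n_i`,
where `w` extends the jump on face `i` constantly along the normal, `L` kills the faces outside the
hyperplane of `i`, and `Q` (`exists_cutoff`) is a high power of a quadratic bump that is relatively
tiny on the other faces in that hyperplane. The contribution of face `i` then dominates. The size of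
the power is what requires `s(N)`; without coplanar faces `Q = 1` works.

All lower bounds rest on `exists_lower_bound`. By compactness of the unit sphere of coefficients, a
polynomial of bounded degree is small relative to any of its values on a ball only on a small part
of that ball. Removing one such bad set per factor leaves half of the guaranteed volume of a subset,
where the whole product is bounded below. Only the volume of the subset matters, so neither
convexity nor a Lipschitz boundary is needed. Charts of hyperplanes carry the bound over to faces.

The divergence theorem is obtained by comparing the indicator of `T` with its translate by `t v`.
The difference lives in slabs of width proportional to `t` around the face hyperplanes. Dividing by
`t`, rescaling the normal coordinate and using dominated convergence reduces the claim to almost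
every point of each hyperplane, where `T` is locally a half space, empty or everything, up to the
hyperplane itself. -/

/-- `f` is a polynomial function of total degree at most `m`. -/
def PolyFun {n : ℕ} (m : ℕ) (f : E n → ℝ) : Prop :=
  ∃ p : MvPolynomial (Fin n) ℝ, p.totalDegree ≤ m ∧ ∀ x, f x = peval p x

/-! ### Degree calculus for polynomial functions -/

namespace PolyFun

variable {n m m' : ℕ} {f g : E n → ℝ}

lemma mono (hf : PolyFun m f) (h : m ≤ m') : PolyFun m' f := by
  obtain ⟨p, hp, hfp⟩ := hf
  exact ⟨p, hp.trans h, hfp⟩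

lemma const (c : ℝ) : PolyFun (n := n) m fun _ => c :=
  ⟨MvPolynomial.C c, by simp, by simp [peval]⟩

lemma coord (i : Fin n) : PolyFun 1 fun x : E n => x i :=
  ⟨MvPolynomial.X i, by simp, by simp [peval]⟩

lemma add (hf : PolyFun m f) (hg : PolyFun m g) : PolyFun m fun x => f x + g x := by
  obtain ⟨p, hp, hfp⟩ := hf
  obtain ⟨p', hp', hgp⟩ := hg
  exact ⟨p + p', (MvPolynomial.totalDegree_add _ _).trans (max_le hp hp'), fun x => by
    simp [hfp, hgp, peval]⟩

lemma mul (hf : PolyFun m f) (hg : PolyFun m' g) : PolyFun (m + m') fun x => f x * g x := by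
  obtain ⟨p, hp, hfp⟩ := hf
  obtain ⟨p', hp', hgp⟩ := hg
  exact ⟨p * p', (MvPolynomial.totalDegree_mul _ _).trans (add_le_add hp hp'), fun x => by
    simp [hfp, hgp, peval]⟩

lemma const_mul (c : ℝ) (hf : PolyFun m f) : PolyFun m fun x => c * f x := by
  simpa using (const (m := 0) c).mul hf

lemma sub (hf : PolyFun m f) (hg : PolyFun m g) : PolyFun m fun x => f x - g x := by
  simpa [sub_eq_add_neg] using hf.add (hg.const_mul (-1))

lemma pow (hf : PolyFun m f) (j : ℕ) : PolyFun (j * m) fun x => f x ^ j := by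
  obtain ⟨p, hp, hfp⟩ := hf
  exact ⟨p ^ j, (MvPolynomial.totalDegree_pow _ _).trans (Nat.mul_le_mul_left j hp), fun x => by
    simp [hfp, peval]⟩

lemma prod {ι : Type*} (s : Finset ι) {F : ι → E n → ℝ} (h : ∀ i ∈ s, PolyFun m (F i)) :
    PolyFun (s.card * m) fun x => ∏ i ∈ s, F i x := by
  classical
  induction s using Finset.induction_on with
  | empty => simpa using const (m := 0 * m) 1
  | insert a s ha ih =>
    simp only [Finset.prod_insert ha, Finset.card_insert_of_notMem ha]
    refine ((h a (by simp)).mul (ih fun i hi => h i (by simp [hi]))).mono ?_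
    rw [Nat.add_mul]; omega

lemma sum {ι : Type*} (s : Finset ι) {F : ι → E n → ℝ} (h : ∀ i ∈ s, PolyFun m (F i)) :
    PolyFun m fun x => ∑ i ∈ s, F i x := by
  classical
  induction s using Finset.induction_on with
  | empty => simpa using const 0
  | insert a s ha ih =>
    simp only [Finset.sum_insert ha]
    exact (h a (by simp)).add (ih fun i hi => h i (by simp [hi]))

lemma continuous (hf : PolyFun m f) : Continuous f := by
  obtain ⟨p, -, hfp⟩ := hf
  rw [funext hfp]
  exact Element.continuous_peval p

/-- Substituting affine functions into a polynomial does not raise its degree. -/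
lemma comp {l : ℕ} (hf : PolyFun m f) {A : E l → E n} (hA : ∀ i, PolyFun 1 fun x => A x i) :
    PolyFun m fun x => f (A x) := by
  obtain ⟨p, hp, hfp⟩ := hf
  have : (fun x => f (A x)) = fun x => ∑ s ∈ p.support, p.coeff s * ∏ i ∈ s.support, A x i ^ s i := by
    funext x
    rw [hfp, peval, MvPolynomial.eval_eq]
  rw [this]
  refine PolyFun.sum _ fun s hs => ?_
  refine PolyFun.const_mul _ ?_
  have key : ∀ t : Finset (Fin n), PolyFun (∑ i ∈ t, s i) fun x => ∏ i ∈ t, A x i ^ s i := by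
    intro t
    induction t using Finset.induction_on with
    | empty => simpa using const (m := 0) 1
    | insert a t ha ih =>
      simp only [Finset.prod_insert ha, Finset.sum_insert ha]
      exact ((hA a).pow (s a) |>.mono (by simp)).mul ih
  exact (key s.support).mono ((MvPolynomial.le_totalDegree hs).trans hp)

lemma inner_left (a : E n) : PolyFun 1 fun x : E n => ⟪a, x⟫ := by
  have : (fun x : E n => ⟪a, x⟫) = fun x : E n => ∑ i, a i * x i := by
    funext x
    simp [PiLp.inner_apply, mul_comm]
  rw [this]
  exact PolyFun.sum _ fun i _ => (coord i).const_mul _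

lemma dist_sq (a : E n) : PolyFun 2 fun x : E n => ‖x - a‖ ^ 2 := by
  have : (fun x : E n => ‖x - a‖ ^ 2) = fun x : E n => ∑ i, (x i - a i) ^ 2 := by
    funext x
    simp [EuclideanSpace.norm_sq_eq]
  rw [this]
  exact PolyFun.sum _ fun i _ => ((coord i).sub (const _)).pow 2

end PolyFun

/-! ### Uniform lower bounds for polynomials of bounded degree -/

/-- The zero set of a nonzero polynomial is a null set. -/
lemma volume_zeros_eq_zero : ∀ {n : ℕ} (p : MvPolynomial (Fin n) ℝ), p ≠ 0 →
    volume {x : Fin n → ℝ | MvPolynomial.eval x p = 0} = 0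
  | 0, p, hp => by
    have : {x : Fin 0 → ℝ | MvPolynomial.eval x p = 0} = ∅ := by
      rw [eq_empty_iff_forall_notMem]
      intro x hx
      apply hp
      refine MvPolynomial.funext fun y => ?_
      rw [Subsingleton.elim y x, map_zero]
      exact hx
    rw [this, measure_empty]
  | n + 1, p, hp => by
    have hmp := volume_preserving_piFinSuccAbove (fun _ : Fin (n + 1) => ℝ) 0
    set S : Set (ℝ × (Fin n → ℝ)) := {z | MvPolynomial.eval (Fin.cons z.1 z.2) p = 0} with hS
    have hcont : Continuous fun z : ℝ × (Fin n → ℝ) =>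
        MvPolynomial.eval (Fin.cons z.1 z.2 : Fin (n + 1) → ℝ) p := by
      refine (MvPolynomial.continuous_eval p).comp (continuous_pi fun i => ?_)
      refine Fin.cases ?_ (fun j => ?_) i
      · simpa using continuous_fst
      · exact (continuous_apply j).comp continuous_snd
    have hSm : MeasurableSet S := (isClosed_singleton.preimage hcont).measurableSet
    have hpre : {x : Fin (n + 1) → ℝ | MvPolynomial.eval x p = 0} =
        (MeasurableEquiv.piFinSuccAbove (fun _ : Fin (n + 1) => ℝ) 0) ⁻¹' S := by
      ext x
      simp [hS, MeasurableEquiv.piFinSuccAbove, Fin.consEquiv]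
    rw [hpre, hmp.measure_preimage hSm.nullMeasurableSet, Measure.volume_eq_prod,
      Measure.prod_apply_symm hSm]
    have hq : MvPolynomial.finSuccEquiv ℝ n p ≠ 0 := by
      simpa using hp
    -- By induction the leading coefficient in the first variable is nonzero at almost every `y`.
    -- The slice over such a `y` is the root set of a nonzero univariate polynomial, hence finite.
    have hae : ∀ᵐ y : Fin n → ℝ,
        MvPolynomial.eval y (MvPolynomial.finSuccEquiv ℝ n p).leadingCoeff ≠ 0 := by
      rw [ae_iff]
      simpa using volume_zeros_eq_zero _ (Polynomial.leadingCoeff_ne_zero.2 hq)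
    refine (lintegral_congr_ae ?_).trans lintegral_zero
    filter_upwards [hae] with y hy
    refine Set.Finite.measure_zero ?_ _
    have hne : Polynomial.map (MvPolynomial.eval y) (MvPolynomial.finSuccEquiv ℝ n p) ≠ 0 := by
      intro h0
      apply hy
      have := congrArg (fun r => r.coeff (MvPolynomial.finSuccEquiv ℝ n p).natDegree) h0
      simpa [Polynomial.coeff_map] using this
    refine (Polynomial.finite_setOfPred_isRoot hne).subset fun x hx => ?_
    have hx' : MvPolynomial.eval (Fin.cons x y) p = 0 := hx
    rw [MvPolynomial.eval_eq_eval_mv_eval'] at hx'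
    exact hx'

lemma volume_setOf_peval_eq_zero {n : ℕ} {p : MvPolynomial (Fin n) ℝ} (hp : p ≠ 0) :
    volume {x : E n | peval p x = 0} = 0 := by
  have hm : MeasurableSet {x : Fin n → ℝ | MvPolynomial.eval x p = 0} :=
    (isClosed_singleton.preimage (MvPolynomial.continuous_eval p)).measurableSet
  exact ((PiLp.volume_preserving_ofLp (Fin n)).measure_preimage hm.nullMeasurableSet).trans
    (volume_zeros_eq_zero p hp)

/-- Polynomials of bounded degree with normalised coefficients are uniformly not small on the
unit ball, off a set of small measure. -/
lemma exists_measure_small_le_unit (n m : ℕ) {η : ℝ} (hη : 0 < η) :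
    ∃ ε > 0, ∀ (f : E n → ℝ), PolyFun m f → ∀ x₀ ∈ Metric.closedBall (0 : E n) 1,
      volume {x ∈ Metric.closedBall (0 : E n) 1 | |f x| < ε * |f x₀|} ≤ ENNReal.ofReal η := by
  classical
  set V := MvPolynomial.restrictTotalDegree (Fin n) ℝ m with hV
  set b := Module.finBasis ℝ V with hb
  set D := Module.finrank ℝ V with hD
  set B : Set (E n) := Metric.closedBall (0 : E n) 1 with hB
  have hBc : IsCompact B := isCompact_closedBall 0 1
  let F : (Fin D → ℝ) → E n → ℝ := fun c x => ∑ k, c k * peval (b k : MvPolynomial (Fin n) ℝ) x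
  have hFc : ∀ c, Continuous (F c) := fun c =>
    continuous_finsetSum _ fun k _ => continuous_const.mul (Element.continuous_peval _)
  have hFe : ∀ c x, F c x = peval ((∑ k, c k • b k : V) : MvPolynomial (Fin n) ℝ) x := by
    intro c x
    simp [F, peval, MvPolynomial.smul_eval]
  obtain ⟨A, hA⟩ : ∃ A : ℝ, ∀ k, ∀ x ∈ B, |peval (b k : MvPolynomial (Fin n) ℝ) x| ≤ A := by
    have : ∀ k, ∃ A : ℝ, ∀ x ∈ B, |peval (b k : MvPolynomial (Fin n) ℝ) x| ≤ A := fun k => by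
      simpa using hBc.exists_bound_of_continuousOn
        (Element.continuous_peval (b k : MvPolynomial (Fin n) ℝ)).continuousOn
    choose A hA using this
    refine ⟨∑ k, |A k|, fun k x hx => (hA k x hx).trans ((le_abs_self _).trans ?_)⟩
    exact Finset.single_le_sum (f := fun k => |A k|) (fun _ _ => abs_nonneg _) (Finset.mem_univ k)
  -- Bounds evaluation on the unit ball by the sup norm of the coefficient vector; the summand `1`
  -- keeps `K` positive.
  set K : ℝ := D * |A| + 1 with hK
  have hK0 : 0 < K := by positivity
  have hFb : ∀ c, ∀ x ∈ B, |F c x| ≤ K * ‖c‖ := by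
    intro c x hx
    calc |F c x| ≤ ∑ k, |c k * peval (b k : MvPolynomial (Fin n) ℝ) x| :=
          Finset.abs_sum_le_sum_abs _ _
      _ ≤ ∑ _k : Fin D, ‖c‖ * |A| := by
          refine Finset.sum_le_sum fun k _ => ?_
          rw [abs_mul]
          exact mul_le_mul (norm_le_pi_norm c k) ((hA k x hx).trans (le_abs_self _))
            (abs_nonneg _) (norm_nonneg _)
      _ = D * |A| * ‖c‖ := by simp; ring
      _ ≤ K * ‖c‖ := by
          rw [hK, add_mul]
          linarith [norm_nonneg c]
  have hFsub : ∀ c c' x, F c x - F c' x = F (c - c') x := by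
    intro c c' x
    simp [F, sub_mul]
  have hFsmul : ∀ (s : ℝ) c x, F (s • c) x = s * F c x := by
    intro s c x
    simp [F, Finset.mul_sum, mul_assoc]
  -- For one fixed polynomial the sublevel sets decrease to a subset of its zero set, which is null,
  -- so their measures tend to zero.
  have hloc : ∀ c : Fin D → ℝ, c ≠ 0 →
      ∃ ε > 0, volume {x ∈ B | |F c x| < ε} ≤ ENNReal.ofReal η := by
    intro c hc
    have hp : ((∑ k, c k • b k : V) : MvPolynomial (Fin n) ℝ) ≠ 0 := by
      intro h0
      apply hc
      have h1 : (∑ k, c k • b k : V) = 0 := Subtype.ext h0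
      funext k
      exact Fintype.linearIndependent_iff.1 b.linearIndependent c h1 k
    have h0 : volume (⋂ j : ℕ, {x ∈ B | |F c x| < 1 / ((j : ℝ) + 1)}) = 0 := by
      refine measure_mono_null (fun x hx => ?_) (volume_setOf_peval_eq_zero hp)
      simp only [mem_iInter, mem_ofPred_eq] at hx ⊢
      rw [← hFe]
      by_contra hne
      obtain ⟨j, hj⟩ := exists_nat_one_div_lt (abs_pos.2 hne)
      exact absurd (hx j).2 (not_lt.2 hj.le)
    have hlim := tendsto_measure_iInter_atTop (μ := (volume : Measure (E n)))
      (s := fun j : ℕ => {x ∈ B | |F c x| < 1 / ((j : ℝ) + 1)})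
      (fun j => (hBc.measurableSet.inter
        (isOpen_Iio.preimage (hFc c).abs).measurableSet).nullMeasurableSet)
      (fun i j hij x hx => ⟨hx.1, hx.2.trans_le (by
        have : (i : ℝ) ≤ j := by exact_mod_cast hij
        gcongr)⟩)
      ⟨0, ((measure_mono fun x hx => hx.1).trans_lt hBc.measure_lt_top).ne⟩
    rw [h0] at hlim
    obtain ⟨j, hj⟩ := (hlim.eventually (gt_mem_nhds (ENNReal.ofReal_pos.2 hη))).exists
    exact ⟨1 / ((j : ℝ) + 1), by positivity, hj.le⟩
  -- Compactness of the coefficient sphere makes the threshold uniform.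
  obtain ⟨ε, hε, hεs⟩ : ∃ ε > 0, ∀ c ∈ Metric.sphere (0 : Fin D → ℝ) 1,
      volume {x ∈ B | |F c x| < ε} ≤ ENNReal.ofReal η := by
    refine (isCompact_sphere (0 : Fin D → ℝ) 1).induction_on
      (p := fun s => ∃ ε > 0, ∀ c ∈ s, volume {x ∈ B | |F c x| < ε} ≤ ENNReal.ofReal η)
      ⟨1, one_pos, by simp⟩ ?_ ?_ ?_
    · rintro s t hst ⟨ε, hε, h⟩
      exact ⟨ε, hε, fun c hc => h c (hst hc)⟩
    · rintro s t ⟨ε, hε, h⟩ ⟨ε', hε', h'⟩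
      refine ⟨min ε ε', lt_min hε hε', fun c hc => ?_⟩
      rcases hc with hc | hc
      · refine le_trans (measure_mono ?_) (h c hc)
        exact fun x hx => ⟨hx.1, hx.2.trans_le (min_le_left _ _)⟩
      · refine le_trans (measure_mono ?_) (h' c hc)
        exact fun x hx => ⟨hx.1, hx.2.trans_le (min_le_right _ _)⟩
    · intro c hc
      have hc0 : c ≠ 0 := by
        rintro rfl
        simp at hc
      obtain ⟨ε, hε, h⟩ := hloc c hc0
      -- Within this radius the values on the unit ball move by at most `ε / 2`, so the `ε / 2`
      -- sublevel set of a neighbour lies in the `ε` sublevel set of `c`.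
      refine ⟨Metric.ball c (ε / (2 * K)), mem_nhdsWithin_of_mem_nhds
        (Metric.ball_mem_nhds c (by positivity)), ε / 2, by positivity, fun c' hc' => ?_⟩
      refine le_trans (measure_mono fun x hx => ?_) h
      refine ⟨hx.1, ?_⟩
      have h1 : |F c x - F c' x| ≤ ε / 2 := by
        rw [hFsub]
        refine (hFb _ x hx.1).trans ?_
        rw [Metric.mem_ball, dist_comm, dist_eq_norm] at hc'
        calc K * ‖c - c'‖ ≤ K * (ε / (2 * K)) := by gcongr
          _ = ε / 2 := by field_simp
      have h2 : |F c' x| < ε / 2 := hx.2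
      have h3 : |F c x| ≤ |F c x - F c' x| + |F c' x| := by
        simpa using abs_add_le (F c x - F c' x) (F c' x)
      change |F c x| < ε
      linarith
  -- The coefficients are rescaled to norm one; since `|f x₀| ≤ K ‖c‖`, dividing by `K` compares `f`
  -- with its own value at `x₀`.
  refine ⟨ε / K, by positivity, fun f hf x₀ hx₀ => ?_⟩
  obtain ⟨p, hp, hfp⟩ := hf
  set c : Fin D → ℝ := fun k => b.repr ⟨p, (MvPolynomial.mem_restrictTotalDegree _ _ _).2 hp⟩ k
    with hc
  have hfF : ∀ x, f x = F c x := by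
    intro x
    rw [hfp, hFe, hc, b.sum_repr]
  by_cases hc0 : c = 0
  · have : {x ∈ B | |f x| < ε / K * |f x₀|} = ∅ := by
      rw [eq_empty_iff_forall_notMem]
      rintro x ⟨-, hx⟩
      simp [hfF, hc0, F] at hx
    rw [this, measure_empty]
    exact zero_le
  · have hcn : 0 < ‖c‖ := norm_pos_iff.2 hc0
    refine le_trans (measure_mono fun x hx => ?_) (hεs (‖c‖⁻¹ • c) ?_)
    · refine ⟨hx.1, ?_⟩
      have h1 := hx.2
      have h2 := hFb c x₀ hx₀
      rw [hfF, hfF] at h1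
      change |F _ x| < ε
      rw [hFsmul, abs_mul, abs_of_pos (inv_pos.2 hcn), inv_mul_lt_iff₀ hcn]
      calc |F c x| < ε / K * |F c x₀| := h1
        _ ≤ ε / K * (K * ‖c‖) := by gcongr
        _ = ‖c‖ * ε := by field_simp
    · simp [norm_smul, hcn.ne']

/-- The scaled form of `exists_measure_small_le_unit`. -/
lemma exists_measure_small_le (n m : ℕ) {η : ℝ} (hη : 0 < η) :
    ∃ ε > 0, ∀ (f : E n → ℝ), PolyFun m f → ∀ (a : E n) (h : ℝ), 0 < h →
      ∀ x₀ ∈ Metric.closedBall a h,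
      volume {x ∈ Metric.closedBall a h | |f x| < ε * |f x₀|} ≤ ENNReal.ofReal (η * h ^ n) := by
  obtain ⟨ε, hε, H⟩ := exists_measure_small_le_unit n m hη
  refine ⟨ε, hε, fun f hf a h hh x₀ hx₀ => ?_⟩
  have hg : PolyFun m fun y : E n => f (a + h • y) := by
    refine hf.comp fun i => ?_
    simpa using ((PolyFun.const (a i)).add ((PolyFun.coord i).const_mul h))
  have hmem : ∀ x ∈ Metric.closedBall a h, h⁻¹ • (x - a) ∈ Metric.closedBall (0 : E n) 1 := by
    intro x hx
    rw [mem_closedBall_iff_norm] at hx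
    rw [mem_closedBall_zero_iff, norm_smul, norm_inv, Real.norm_of_nonneg hh.le,
      inv_mul_le_iff₀ hh, mul_one]
    exact hx
  have hback : ∀ x : E n, a + h • (h⁻¹ • (x - a)) = x := by
    intro x
    rw [smul_inv_smul₀ hh.ne']
    abel
  have key := H _ hg _ (hmem x₀ hx₀)
  rw [hback] at key
  set S' : Set (E n) := {y ∈ Metric.closedBall (0 : E n) 1 | |f (a + h • y)| < ε * |f x₀|} with hS'
  have hsub : {x ∈ Metric.closedBall a h | |f x| < ε * |f x₀|} ⊆ (fun y => a + y) '' (h • S') := by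
    intro x hx
    refine ⟨x - a, ⟨h⁻¹ • (x - a), ⟨hmem x hx.1, ?_⟩, smul_inv_smul₀ hh.ne' _⟩, by simp⟩
    rw [hback]
    exact hx.2
  calc _ ≤ volume ((fun y => a + y) '' (h • S')) := measure_mono hsub
    _ = volume (h • S') := by rw [image_add_left, measure_preimage_add]
    _ = ENNReal.ofReal (h ^ n) * volume S' := by
        rw [Measure.addHaar_smul, finrank_euclideanSpace_fin, abs_of_pos (pow_pos hh n)]
    _ ≤ ENNReal.ofReal (h ^ n) * ENNReal.ofReal η := by gcongr
    _ = ENNReal.ofReal (η * h ^ n) := by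
        rw [← ENNReal.ofReal_mul (by positivity), mul_comm]

/-- A lower bound for the integral of a product of squares of polynomials over a subset of a ball
that has a fixed portion of its volume. -/
lemma exists_lower_bound (n m N : ℕ) {ρ : ℝ} (hρ : 0 < ρ) :
    ∃ c > 0, ∀ (a : E n) (h : ℝ), 0 < h → ∀ S ⊆ Metric.closedBall a h, MeasurableSet S →
      ENNReal.ofReal (ρ * h ^ n) ≤ volume S →
      ∀ {ι : Type} (J : Finset ι), J.card ≤ N → ∀ f : ι → E n → ℝ, (∀ j ∈ J, PolyFun m (f j)) →
      ∀ y : ι → E n, (∀ j ∈ J, y j ∈ Metric.closedBall a h) →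
      c * h ^ n * ∏ j ∈ J, (f j (y j)) ^ 2 ≤ ∫ x in S, ∏ j ∈ J, (f j x) ^ 2 := by
  -- At most `N` bad sets, each with this share, remove at most half of the volume guaranteed to
  -- `S`; `N + 1` avoids division by zero.
  obtain ⟨ε₀, hε₀, H⟩ := exists_measure_small_le n m (η := ρ / (2 * (N + 1))) (by positivity)
  -- With `ε ≤ 1`, the exponent `2 * N` serves every family of at most `N` factors.
  set ε := min ε₀ 1 with hεd
  have hε : 0 < ε := lt_min hε₀ one_pos
  refine ⟨ρ / 2 * ε ^ (2 * N), by positivity, ?_⟩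
  intro a h hh S hSB hS hvol ι J hJ f hf y hy
  set bad : Set (E n) := ⋃ j ∈ J, {x ∈ Metric.closedBall a h | |f j x| < ε * |f j (y j)|} with hbad
  have hcont : ∀ j ∈ J, Continuous (f j) := fun j hj => (hf j hj).continuous
  have hbm : MeasurableSet bad := by
    refine J.measurableSet_biUnion fun j hj => ?_
    exact measurableSet_closedBall.inter
      (isOpen_Iio.preimage (hcont j hj).abs).measurableSet
  have hbv : volume bad ≤ ENNReal.ofReal (ρ / 2 * h ^ n) := by
    calc volume bad ≤ ∑ j ∈ J, ENNReal.ofReal (ρ / (2 * (N + 1)) * h ^ n) := by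
          refine (measure_biUnion_finset_le J _).trans (Finset.sum_le_sum fun j hj => ?_)
          refine le_trans (measure_mono fun x hx => ?_) (H (f j) (hf j hj) a h hh (y j) (hy j hj))
          refine ⟨hx.1, hx.2.trans_le ?_⟩
          gcongr
          exact min_le_left _ _
      _ = ENNReal.ofReal (J.card * (ρ / (2 * (N + 1)) * h ^ n)) := by
          rw [Finset.sum_const, nsmul_eq_mul,
            ENNReal.ofReal_mul (p := (J.card : ℝ)) (by positivity), ENNReal.ofReal_natCast]
      _ ≤ ENNReal.ofReal (ρ / 2 * h ^ n) := by
          apply ENNReal.ofReal_le_ofReal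
          have : (J.card : ℝ) ≤ N + 1 := by
            have : (J.card : ℝ) ≤ N := by exact_mod_cast hJ
            linarith
          calc J.card * (ρ / (2 * (N + 1)) * h ^ n) ≤ (N + 1) * (ρ / (2 * (N + 1)) * h ^ n) := by
                gcongr
            _ = ρ / 2 * h ^ n := by field_simp
  have hgv : ENNReal.ofReal (ρ / 2 * h ^ n) ≤ volume (S \ bad) := by
    have h1 : volume S ≤ volume (S \ bad) + volume bad := by
      calc volume S ≤ volume ((S \ bad) ∪ bad) := measure_mono (by simp)
        _ ≤ _ := measure_union_le _ _
    have h2 : ENNReal.ofReal (ρ * h ^ n) =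
        ENNReal.ofReal (ρ / 2 * h ^ n) + ENNReal.ofReal (ρ / 2 * h ^ n) := by
      rw [← ENNReal.ofReal_add (by positivity) (by positivity)]
      congr 1
      ring
    have h3 := hvol.trans (h1.trans (add_le_add le_rfl hbv))
    rw [h2] at h3
    exact (ENNReal.add_le_add_iff_right ENNReal.ofReal_ne_top).1 h3
  have hpc : Continuous fun x => ∏ j ∈ J, (f j x) ^ 2 :=
    continuous_finsetProd _ fun j hj => (hcont j hj).pow 2
  have hint : IntegrableOn (fun x => ∏ j ∈ J, (f j x) ^ 2) S :=
    (hpc.continuousOn.integrableOn_compact (isCompact_closedBall a h)).mono_set hSB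
  have hfin : volume (S \ bad) ≠ ⊤ :=
    ((measure_mono (sdiff_subset.trans hSB)).trans_lt
      (isCompact_closedBall a h).measure_lt_top).ne
  set P := ∏ j ∈ J, (f j (y j)) ^ 2 with hP
  have hP0 : 0 ≤ P := Finset.prod_nonneg fun _ _ => sq_nonneg _
  have hpt : ∀ x ∈ S \ bad, ε ^ (2 * N) * P ≤ ∏ j ∈ J, (f j x) ^ 2 := by
    intro x hx
    calc ε ^ (2 * N) * P ≤ ε ^ (2 * J.card) * P := by
          gcongr ?_ * _
          exact pow_le_pow_of_le_one hε.le (min_le_right _ _) (by omega)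
      _ = ∏ j ∈ J, (ε * |f j (y j)|) ^ 2 := by
          simp only [mul_pow, sq_abs]
          rw [Finset.prod_mul_distrib, Finset.prod_const, ← pow_mul]
      _ ≤ ∏ j ∈ J, (f j x) ^ 2 := by
          refine Finset.prod_le_prod (fun _ _ => sq_nonneg _) fun j hj => ?_
          rw [← sq_abs (f j x)]
          have : ε * |f j (y j)| ≤ |f j x| := by
            by_contra hlt
            exact hx.2 (mem_biUnion hj ⟨hSB hx.1, not_le.1 hlt⟩)
          gcongr
  calc ρ / 2 * ε ^ (2 * N) * h ^ n * P = (ρ / 2 * h ^ n) * (ε ^ (2 * N) * P) := by ring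
    _ ≤ (volume (S \ bad)).toReal * (ε ^ (2 * N) * P) := by
        gcongr
        exact (ENNReal.ofReal_le_iff_le_toReal hfin).1 hgv
    _ = ∫ _x in S \ bad, ε ^ (2 * N) * P := by
        rw [setIntegral_const, smul_eq_mul, Measure.real]
    _ ≤ ∫ x in S \ bad, ∏ j ∈ J, (f j x) ^ 2 :=
        setIntegral_mono_on (integrableOn_const hfin)
          (hint.mono_set sdiff_subset) (hS.diff hbm) hpt
    _ ≤ ∫ x in S, ∏ j ∈ J, (f j x) ^ 2 :=
        setIntegral_mono_set hint
          (Filter.Eventually.of_forall fun x => Finset.prod_nonneg fun _ _ => sq_nonneg _)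
          (Filter.Eventually.of_forall sdiff_subset)

/-! ### Isometric charts of hyperplanes -/

/-- An isometric parametrisation of the hyperplanes with unit normal `n`. -/
structure PlaneChart {m : ℕ} (n : E (m + 1)) where
  toLin : E m →ₗᵢ[ℝ] E (m + 1)
  inner_toLin : ∀ z, ⟪n, toLin z⟫ = 0
  exists_eq : ∀ x, ⟪n, x⟫ = 0 → ∃ z, toLin z = x
  measurePreserving' : MeasurePreserving (fun p : E m × ℝ => toLin p.1 + p.2 • n)

/-- Extend `n` to an orthonormal basis with `n` in position `0`. The other coordinates parametrise
the orthogonal complement, and splitting off coordinate `0` preserves volume. -/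
lemma nonempty_planeChart {m : ℕ} {n : E (m + 1)} (hn : ‖n‖ = 1) : Nonempty (PlaneChart n) := by
  have ho : Orthonormal ℝ (({0} : Set (Fin (m + 1))).domRestrict fun _ => n) :=
    ⟨fun _ => hn, fun i j hij => (hij (Subsingleton.elim i j)).elim⟩
  obtain ⟨b, hb⟩ := ho.exists_orthonormalBasis_extension_of_card_eq (by simp)
  have hb0 : b 0 = n := hb 0 (by simp)
  let L : E m →ₗ[ℝ] E (m + 1) :=
    { toFun := fun z => WithLp.toLp 2 (Fin.cons 0 z : Fin (m + 1) → ℝ)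
      map_add' := fun z w => by
        ext i
        refine Fin.cases ?_ (fun j => ?_) i <;> simp
      map_smul' := fun c z => by
        ext i
        refine Fin.cases ?_ (fun j => ?_) i <;> simp }
  have hL : ∀ z, ‖L z‖ = ‖z‖ := fun z => by
    rw [← sq_eq_sq₀ (norm_nonneg _) (norm_nonneg _), EuclideanSpace.norm_sq_eq,
      EuclideanSpace.norm_sq_eq, Fin.sum_univ_succ]
    simp [L]
  let A : E m →ₗᵢ[ℝ] E (m + 1) := b.repr.symm.toLinearIsometry.comp ⟨L, hL⟩
  have hA : ∀ z, b.repr (A z) = L z := fun z => b.repr.apply_symm_apply _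
  have hrn : b.repr n = EuclideanSpace.single 0 1 := by
    rw [← hb0, b.repr_self]
  refine ⟨⟨A, fun z => ?_, fun x hx => ?_, ?_⟩⟩
  · rw [← b.repr.inner_map_map, hA, hrn]
    simp [L, EuclideanSpace.inner_single_left]
  · refine ⟨WithLp.toLp 2 fun j => b.repr x j.succ, b.repr.injective ?_⟩
    rw [hA]
    rw [← b.repr.inner_map_map, hrn] at hx
    ext i
    refine Fin.cases ?_ (fun j => ?_) i
    · rw [EuclideanSpace.inner_single_left] at hx
      simp at hx
      simp [L, hx]
    · simp [L]
  · have h1 : MeasurePreserving (fun p : E m × ℝ => (p.2, WithLp.ofLp p.1))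
        (volume.prod volume) (volume.prod volume) :=
      Measure.measurePreserving_swap.comp
        ((PiLp.volume_preserving_ofLp (Fin m)).prod (MeasurePreserving.id (volume : Measure ℝ)))
    have h2 := (volume_preserving_piFinSuccAbove (fun _ : Fin (m + 1) => ℝ) 0).symm
    have h3 := (b.repr.symm.measurePreserving).comp
      ((PiLp.volume_preserving_toLp (Fin (m + 1))).comp (h2.comp h1))
    refine (congrArg (fun f => MeasurePreserving f (volume.prod volume) volume) ?_).mpr h3
    funext p
    apply b.repr.injective
    simp only [map_add, map_smul, hA, hrn, Function.comp_apply, LinearIsometryEquiv.apply_symm_apply]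
    ext i
    refine Fin.cases ?_ (fun j => ?_) i
    · simp [L, MeasurableEquiv.piFinSuccAbove, Fin.insertNthEquiv]
    · simp [L, MeasurableEquiv.piFinSuccAbove, Fin.insertNthEquiv]

namespace PlaneChart

variable {m : ℕ} {n : E (m + 1)} (χ : PlaneChart n) (o : ℝ)

/-- The point with coordinate `z` in the hyperplane at offset `o`. -/
def pt (z : E m) : E (m + 1) := o • n + χ.toLin z

lemma isometry_pt : Isometry (χ.pt o) :=
  (IsometryEquiv.addLeft (o • n)).isometry.comp χ.toLin.isometry

lemma continuous_pt : Continuous (χ.pt o) := (χ.isometry_pt o).continuous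

lemma measurableEmbedding_pt : MeasurableEmbedding (χ.pt o) :=
  (χ.isometry_pt o).isClosedEmbedding.measurableEmbedding

lemma inner_pt (hn : ‖n‖ = 1) (z : E m) : ⟪n, χ.pt o z⟫ = o := by
  rw [pt, inner_add_right, χ.inner_toLin, real_inner_smul_right, real_inner_self_eq_norm_sq, hn]
  ring

lemma range_pt (hn : ‖n‖ = 1) : range (χ.pt o) = {x | ⟪n, x⟫ = o} := by
  ext x
  constructor
  · rintro ⟨z, rfl⟩
    exact χ.inner_pt o hn z
  · intro hx
    have hx' : ⟪n, x⟫ = o := hx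
    obtain ⟨z, hz⟩ := χ.exists_eq (x - o • n) (by
      rw [inner_sub_right, hx', real_inner_smul_right, real_inner_self_eq_norm_sq, hn]
      ring)
    exact ⟨z, by rw [pt, hz]; abel⟩

/-- Isometries preserve Hausdorff measure, which in the chart, of full dimension `m`, is Lebesgue
measure. Surface integrals thereby become Lebesgue integrals. -/
lemma map_volume (hn : ‖n‖ = 1) :
    Measure.map (χ.pt o) volume = (surf (m + 1)).restrict {x | ⟪n, x⟫ = o} := by
  rw [← EuclideanSpace.euclideanHausdorffMeasure_eq_volume,
    (χ.isometry_pt o).map_euclideanHausdorffMeasure, χ.range_pt o hn]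
  rfl

lemma map_restrict (hn : ‖n‖ = 1) {e : Set (E (m + 1))} (he : ∀ x ∈ e, ⟪n, x⟫ = o)
    (hm : MeasurableSet e) :
    Measure.map (χ.pt o) (volume.restrict (χ.pt o ⁻¹' e)) = (surf (m + 1)).restrict e := by
  rw [← Measure.restrict_map (χ.continuous_pt o).measurable hm, χ.map_volume o hn,
    Measure.restrict_restrict hm, inter_eq_left.2]
  exact fun x hx => he x hx

lemma surf_eq (hn : ‖n‖ = 1) {e : Set (E (m + 1))} (he : ∀ x ∈ e, ⟪n, x⟫ = o)
    (hm : MeasurableSet e) : surf (m + 1) e = volume (χ.pt o ⁻¹' e) := by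
  have h := congrArg (fun μ => μ univ) (χ.map_restrict o hn he hm)
  simp only [Measure.restrict_apply_univ, Measure.map_apply (χ.continuous_pt o).measurable
    MeasurableSet.univ, preimage_univ] at h
  exact h.symm

lemma setIntegral_surf (hn : ‖n‖ = 1) {e : Set (E (m + 1))} (he : ∀ x ∈ e, ⟪n, x⟫ = o)
    (hm : MeasurableSet e) (f : E (m + 1) → ℝ) :
    ∫ x in e, f x ∂(surf (m + 1)) = ∫ z in χ.pt o ⁻¹' e, f (χ.pt o z) := by
  rw [← χ.map_restrict o hn he hm, (χ.measurableEmbedding_pt o).integral_map]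

lemma measurePreserving :
    MeasurePreserving (fun p : E m × ℝ => χ.pt o p.1 + p.2 • n) := by
  have h := (measurePreserving_add_left (volume : Measure (E (m + 1))) (o • n)).comp
    χ.measurePreserving'
  refine (congrArg (fun f => MeasurePreserving f volume volume) ?_).mpr h
  funext p
  simp [pt, add_assoc]

lemma polyFun_comp_pt {l : ℕ} {f : E (m + 1) → ℝ} (hf : PolyFun l f) :
    PolyFun l fun z => f (χ.pt o z) := by
  refine hf.comp fun i => ?_
  have : ∀ z : E m, (χ.pt o z) i = o * n i + ⟪χ.toLin.toContinuousLinearMap.adjoint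
      (EuclideanSpace.single i 1), z⟫ := by
    intro z
    rw [ContinuousLinearMap.adjoint_inner_left]
    simp [pt, EuclideanSpace.inner_single_left]
  simp only [this]
  exact (PolyFun.const _).add (PolyFun.inner_left _)

end PlaneChart

/-! ### Local geometry of an element near its faces -/

/-- Away from the frontier, `s` is covered by the disjoint open sets `T` and the complement of its
closure, and a preconnected set cannot meet both. -/
lemma isOpen_dichotomy {α : Type*} [TopologicalSpace α] {T s : Set α} (hT : IsOpen T)
    (hs : IsPreconnected s) (hd : ∀ x ∈ s, x ∉ frontier T) : s ⊆ T ∨ Disjoint s T := by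
  have hsub : s ⊆ T ∪ (closure T)ᶜ := by
    intro x hx
    by_cases hxT : x ∈ T
    · exact Or.inl hxT
    · refine Or.inr fun hc => hd x hx ?_
      rw [hT.frontier_eq]
      exact ⟨hc, hxT⟩
  by_cases hne : (s ∩ T).Nonempty
  · exact Or.inl (hs.subset_left_of_subset_union hT isClosed_closure.isOpen_compl
      (disjoint_compl_right.mono_left subset_closure) hsub hne)
  · exact Or.inr (disjoint_iff_inter_eq_empty.2 (not_nonempty_iff_eq_empty.1 hne))

/-- If one hyperplane is contained in another one, then their unit normals agree up to sign. -/
lemma normal_eq_of_subset {m : ℕ} {n n' : E (m + 1)} {o o' : ℝ} (hn : ‖n‖ = 1) (hn' : ‖n'‖ = 1)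
    (h : {x | ⟪n, x⟫ = o} ⊆ {x | ⟪n', x⟫ = o'}) :
    n' = ⟪n', n⟫ • n ∧ o' = ⟪n', n⟫ * o ∧ ⟪n', n⟫ ^ 2 = 1 := by
  have hnn : ⟪n, n⟫ = 1 := by rw [real_inner_self_eq_norm_sq, hn]; norm_num
  have h1 : ⟪n', o • n⟫ = o' := h (show ⟪n, o • n⟫ = o by rw [real_inner_smul_right, hnn, mul_one])
  set w := n' - ⟪n', n⟫ • n with hw
  have hwn : ⟪n, w⟫ = 0 := by
    rw [hw, inner_sub_right, real_inner_smul_right, hnn, real_inner_comm]; ring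
  have h2 : ⟪n', o • n + w⟫ = o' := h (show ⟪n, o • n + w⟫ = o by
    rw [inner_add_right, real_inner_smul_right, hnn, hwn]; ring)
  have h3 : ⟪n', w⟫ = 0 := by rw [inner_add_right, h1] at h2; linarith
  have h4 : w = 0 := by
    rw [← inner_self_eq_zero (𝕜 := ℝ)]
    nth_rewrite 1 [hw]
    rw [inner_sub_left, h3, real_inner_smul_left, hwn]; ring
  have h5 : n' = ⟪n', n⟫ • n := sub_eq_zero.1 h4
  refine ⟨h5, by rw [← h1, real_inner_smul_right, mul_comm], ?_⟩
  have h6 := congrArg norm h5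
  rw [norm_smul, hn, hn', mul_one, Real.norm_eq_abs] at h6
  rw [← sq_abs, ← h6, one_pow]

namespace Element

/-- The signed distance to the hyperplane of the face `i`. -/
def lev {d : ℕ} (T : Element d) (i : Fin T.numFaces) (x : E d) : ℝ := ⟪T.normal i, x⟫ - T.offset i

/-- The faces in the hyperplane of the face `i`. -/
def coplanar {d : ℕ} (T : Element d) (i : Fin T.numFaces) : Finset (Fin T.numFaces) := by
  classical exact Finset.univ.filter fun j => T.plane i = T.plane j

lemma mem_coplanar {d : ℕ} {T : Element d} {i j : Fin T.numFaces} :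
    j ∈ T.coplanar i ↔ T.plane i = T.plane j := by
  simp [coplanar]

lemma self_mem_coplanar {d : ℕ} {T : Element d} {i : Fin T.numFaces} : i ∈ T.coplanar i :=
  mem_coplanar.2 rfl

lemma coplanar_eq {d : ℕ} {T : Element d} {i j : Fin T.numFaces} (h : j ∈ T.coplanar i) :
    T.coplanar i = T.coplanar j := by
  ext k
  rw [mem_coplanar, mem_coplanar, mem_coplanar.1 h]

section
variable {d : ℕ} (T : Element d)

lemma lev_eq_zero {i : Fin T.numFaces} {x : E d} (hx : x ∈ T.face i) : T.lev i x = 0 :=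
  sub_eq_zero.2 (T.face_flat i x hx)

lemma mem_plane_iff {i : Fin T.numFaces} {x : E d} : x ∈ T.plane i ↔ T.lev i x = 0 :=
  sub_eq_zero.symm

lemma face_subset_plane (i : Fin T.numFaces) : T.face i ⊆ T.plane i := T.face_flat i

lemma continuous_lev (i : Fin T.numFaces) : Continuous (T.lev i) :=
  (continuous_const.inner continuous_id).sub continuous_const

lemma measurableSet_face (i : Fin T.numFaces) : MeasurableSet (T.face i) :=
  (T.isCompact_face i).measurableSet

lemma lev_add_smul (i : Fin T.numFaces) (x w : E d) (t : ℝ) :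
    T.lev i (x + t • w) = T.lev i x + t * ⟪T.normal i, w⟫ := by
  rw [lev, lev, inner_add_right, real_inner_smul_right]; ring

/-- Near a point that lies on exactly one face, the element is a half space. -/
lemma exists_ball_half {y : E d} {j : Fin T.numFaces} (hy : y ∈ T.face j)
    (hu : ∀ k, k ≠ j → y ∉ T.face k) :
    ∃ δ > 0, ∀ x ∈ Metric.ball y δ, T.lev j x ≠ 0 → (x ∈ T.carrier ↔ T.lev j x < 0) := by
  have hopen : IsOpen (⋃ k ∈ {k | k ≠ j}, T.face k)ᶜ :=
    ((toFinite {k | k ≠ j}).isClosed_biUnion fun k _ => (T.isCompact_face k).isClosed).isOpen_compl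
  obtain ⟨δ, hδ, hb⟩ := Metric.isOpen_iff.1 hopen y (by simpa using hu)
  refine ⟨δ, hδ, ?_⟩
  have hfr : ∀ x ∈ Metric.ball y δ, T.lev j x ≠ 0 → x ∉ frontier T.carrier := by
    intro x hx hne hf
    rw [T.frontier_eq] at hf
    obtain ⟨k, hk⟩ := mem_iUnion.1 hf
    by_cases hkj : k = j
    · subst hkj
      exact hne (T.lev_eq_zero hk)
    · exact hb hx (mem_biUnion (show k ∈ {k | k ≠ j} from hkj) hk)
  -- The half-ball condition may fail at `y` itself, but it holds at some nearby `y'`. Each open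
  -- half ball around `y` is inside or outside the element as a whole, and a normal displacement of
  -- `y'` by `∓s` decides which.
  obtain ⟨y', ⟨hy', ε, hε, hball⟩, hyy'⟩ := Metric.mem_closure_iff.1 (T.outward j hy) δ hδ
  have hnn : ⟪T.normal j, T.normal j⟫ = 1 := by
    rw [real_inner_self_eq_norm_sq, T.norm_normal]; norm_num
  obtain ⟨s, hs, hsε, hsδ⟩ : ∃ s > 0, s < ε ∧ s < δ - dist y y' := by
    have : 0 < min ε (δ - dist y y') := lt_min hε (sub_pos.2 hyy')
    obtain ⟨s, hs, hs'⟩ := exists_between this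
    exact ⟨s, hs, hs'.trans_le (min_le_left _ _), hs'.trans_le (min_le_right _ _)⟩
  have hlev : ∀ t : ℝ, T.lev j (y' + t • T.normal j) = t := fun t => by
    rw [T.lev_add_smul, hnn, T.lev_eq_zero hy']; ring
  have hd : ∀ t : ℝ, |t| = s → y' + t • T.normal j ∈ Metric.ball y δ ∧
      y' + t • T.normal j ∈ Metric.ball y' ε := fun t ht => by
    have h1 : dist (y' + t • T.normal j) y' = s := by
      rw [dist_eq_norm, add_sub_cancel_left, norm_smul, T.norm_normal, mul_one, Real.norm_eq_abs, ht]
    refine ⟨?_, by rw [Metric.mem_ball, h1]; exact hsε⟩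
    rw [Metric.mem_ball]
    have := dist_triangle (y' + t • T.normal j) y' y
    rw [dist_comm y' y] at this
    linarith
  have hmem : ∀ x ∈ Metric.ball y' ε, (x ∈ T.carrier ↔ T.lev j x < 0) := by
    intro x hx
    have := Set.ext_iff.1 hball x
    simp only [mem_inter_iff, hx, true_and, mem_ofPred_eq] at this
    rw [this, lev, sub_neg]
  have hconv : Convex ℝ (Metric.ball y δ ∩ {x | T.lev j x < 0}) ∧
      Convex ℝ (Metric.ball y δ ∩ {x | 0 < T.lev j x}) := by
    have e1 : {x | T.lev j x < 0} = {x | (innerSL ℝ (T.normal j)) x < T.offset j} := by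
      ext x; simp [lev]
    have e2 : {x | 0 < T.lev j x} = {x | T.offset j < (innerSL ℝ (T.normal j)) x} := by
      ext x; simp [lev]
    rw [e1, e2]
    exact ⟨(convex_ball _ _).inter (convex_halfSpace_lt
        (innerSL ℝ (T.normal j)).toLinearMap.isLinear _),
      (convex_ball _ _).inter (convex_halfSpace_gt
        (innerSL ℝ (T.normal j)).toLinearMap.isLinear _)⟩
  have hneg := isOpen_dichotomy T.isOpen hconv.1.isPreconnected
    (fun x hx => hfr x hx.1 (ne_of_lt hx.2))
  have hpos := isOpen_dichotomy T.isOpen hconv.2.isPreconnected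
    (fun x hx => hfr x hx.1 (ne_of_gt hx.2))
  intro x hx hne
  have hm := hd (-s) (by rw [abs_neg, abs_of_pos hs])
  have hp := hd s (abs_of_pos hs)
  constructor
  · intro hxT
    by_contra hnot
    have hx0 : 0 < T.lev j x := lt_of_le_of_ne (not_lt.1 hnot) hne.symm
    rcases hpos with h | h
    · have h1 : y' + s • T.normal j ∈ T.carrier := h ⟨hp.1, by
        change 0 < T.lev j _
        rw [hlev]; exact hs⟩
      rw [hmem _ hp.2, hlev] at h1
      linarith
    · exact disjoint_left.1 h ⟨hx, hx0⟩ hxT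
  · intro hx0
    rcases hneg with h | h
    · exact h ⟨hx, hx0⟩
    · have h1 : y' + (-s) • T.normal j ∈ T.carrier := by
        rw [hmem _ hm.2, hlev]; linarith
      exact (disjoint_left.1 h ⟨hm.1, by
        change T.lev j _ < 0
        rw [hlev]; linarith⟩ h1).elim

/-- Near a point off the boundary, membership in the element is constant. -/
lemma exists_ball_const {y : E d} (hy : ∀ j, y ∉ T.face j) :
    ∃ δ > 0, ∀ x ∈ Metric.ball y δ, ∀ x' ∈ Metric.ball y δ, x ∈ T.carrier → x' ∈ T.carrier := by
  have hopen : IsOpen (frontier T.carrier)ᶜ := isClosed_frontier.isOpen_compl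
  obtain ⟨δ, hδ, hb⟩ := Metric.isOpen_iff.1 hopen y (by rw [T.frontier_eq]; simpa using hy)
  refine ⟨δ, hδ, fun x hx x' hx' hxT => ?_⟩
  rcases isOpen_dichotomy T.isOpen (convex_ball y δ).isPreconnected (fun z hz => hb hz) with h | h
  · exact h hx'
  · exact (disjoint_left.1 h hx hxT).elim

/-- A segment that joins a point of the element with a point outside meets a face hyperplane. -/
lemma exists_lev_le {x v : E d} {t : ℝ} (ht : 0 ≤ t)
    (h : ¬(x - t • v ∈ T.carrier ↔ x ∈ T.carrier)) : ∃ j, |T.lev j x| ≤ t * ‖v‖ := by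
  by_contra! hcon
  have hseg : ∀ z ∈ segment ℝ (x - t • v) x, z ∉ frontier T.carrier := by
    intro z hz hzf
    rw [T.frontier_eq] at hzf
    obtain ⟨j, hj⟩ := mem_iUnion.1 hzf
    rw [segment_symm, segment_eq_image'] at hz
    obtain ⟨θ, hθ, rfl⟩ := hz
    have h0 := T.lev_eq_zero hj
    rw [T.lev_add_smul, sub_sub_cancel_left, inner_neg_right, real_inner_smul_right] at h0
    have h1 : T.lev j x = θ * (t * ⟪T.normal j, v⟫) := by linarith
    have h2 := abs_real_inner_le_norm (T.normal j) v
    rw [T.norm_normal, one_mul] at h2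
    have h3 := hcon j
    rw [h1, abs_mul, abs_mul, abs_of_nonneg hθ.1, abs_of_nonneg ht] at h3
    have h4 : θ * (t * |⟪T.normal j, v⟫|) ≤ 1 * (t * ‖v‖) := by
      gcongr
      exact hθ.2
    linarith
  rcases isOpen_dichotomy T.isOpen (convex_segment (x - t • v) x).isPreconnected hseg with h' | h'
  · exact h ⟨fun _ => h' (right_mem_segment ℝ _ _), fun _ => h' (left_mem_segment ℝ _ _)⟩
  · exact h ⟨fun hh => (disjoint_left.1 h' (left_mem_segment ℝ _ _) hh).elim,
      fun hh => (disjoint_left.1 h' (right_mem_segment ℝ _ _) hh).elim⟩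

end

section
variable {m : ℕ} (T : Element (m + 1))

lemma lev_eq_of_coplanar {i j : Fin T.numFaces} (h : j ∈ T.coplanar i) (x : E (m + 1)) :
    T.lev j x = ⟪T.normal j, T.normal i⟫ * T.lev i x := by
  obtain ⟨h1, h2, -⟩ := normal_eq_of_subset (T.norm_normal i) (T.norm_normal j)
    (mem_coplanar.1 h).subset
  rw [lev, lev, h2]
  nth_rewrite 1 [h1]
  rw [real_inner_smul_left]; ring

lemma inner_normal_sq {i j : Fin T.numFaces} (h : j ∈ T.coplanar i) :
    ⟪T.normal j, T.normal i⟫ ^ 2 = 1 :=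
  (normal_eq_of_subset (T.norm_normal i) (T.norm_normal j) (mem_coplanar.1 h).subset).2.2

lemma inner_normal_of_coplanar {i j : Fin T.numFaces} (h : j ∈ T.coplanar i) (v : E (m + 1)) :
    ⟪T.normal j, v⟫ = ⟪T.normal j, T.normal i⟫ * ⟪T.normal i, v⟫ := by
  obtain ⟨h1, -⟩ := normal_eq_of_subset (T.norm_normal i) (T.norm_normal j)
    (mem_coplanar.1 h).subset
  nth_rewrite 1 [h1]
  rw [real_inner_smul_left]

/-- Containment forces the two equations to be equal up to sign, so it is already equality. Hence a
non-coplanar hyperplane does not contain that of `i`. -/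
lemma mem_coplanar_of_subset {i j : Fin T.numFaces} (h : T.plane i ⊆ T.plane j) :
    j ∈ T.coplanar i := by
  obtain ⟨h1, h2, h3⟩ := normal_eq_of_subset (T.norm_normal i) (T.norm_normal j) h
  refine mem_coplanar.2 (h.antisymm fun x hx => ?_)
  have hx' : ⟪T.normal j, x⟫ = T.offset j := hx
  rw [h2, h1, real_inner_smul_left] at hx'
  rw [← h1] at hx'
  have hne : ⟪T.normal j, T.normal i⟫ ≠ 0 := by
    intro h0
    rw [h0] at h3
    norm_num at h3
  exact mul_left_cancel₀ hne hx'

/-- Almost every point of a face hyperplane lies on no other face hyperplane, and on at most one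
face. -/
lemma ae_good (i : Fin T.numFaces) (χ : PlaneChart (T.normal i)) :
    ∀ᵐ z : E m, (∀ j, j ∉ T.coplanar i → T.lev j (χ.pt (T.offset i) z) ≠ 0) ∧
      ∀ j k, j ≠ k → χ.pt (T.offset i) z ∈ T.face j → χ.pt (T.offset i) z ∉ T.face k := by
  have hpl : ∀ z, χ.pt (T.offset i) z ∈ T.plane i := χ.inner_pt _ (T.norm_normal i)
  rw [Filter.eventually_and, ae_all_iff, ae_all_iff]
  refine ⟨fun j => ?_, fun j => ?_⟩
  · by_cases hj : j ∈ T.coplanar i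
    · exact Filter.Eventually.of_forall fun z h => (h hj).elim
    · have hpoly : PolyFun 1 fun z => T.lev j (χ.pt (T.offset i) z) :=
        χ.polyFun_comp_pt _ ((PolyFun.inner_left _).sub (PolyFun.const _))
      obtain ⟨p, -, hp⟩ := hpoly
      replace hp : ∀ z, T.lev j (χ.pt (T.offset i) z) = peval p z := hp
      have hp0 : p ≠ 0 := by
        -- If the affine function vanished identically, plane `i` would lie in plane `j`, making the
        -- faces coplanar.
        rintro rfl
        apply hj
        refine T.mem_coplanar_of_subset fun x hx => ?_
        have hx' : x ∈ range (χ.pt (T.offset i)) := by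
          rw [χ.range_pt _ (T.norm_normal i)]; exact hx
        obtain ⟨z, rfl⟩ := hx'
        rw [mem_plane_iff, hp]
        simp [peval]
      have := volume_setOf_peval_eq_zero hp0
      rw [← compl_mem_ae_iff] at this
      filter_upwards [this] with z hz _ h0
      exact hz (show peval p z = 0 by rw [← hp, h0])
  · rw [ae_all_iff]
    intro k
    by_cases hjk : j = k
    · exact Filter.Eventually.of_forall fun z h => (h hjk).elim
    · have hm : MeasurableSet (T.face j ∩ T.face k ∩ T.plane i) :=
        ((T.measurableSet_face j).inter (T.measurableSet_face k)).inter
          (isClosed_eq (continuous_const.inner continuous_id) continuous_const).measurableSet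
      have h0 : surf (m + 1) (T.face j ∩ T.face k ∩ T.plane i) = 0 :=
        measure_mono_null inter_subset_left (T.face_overlap j k hjk)
      rw [χ.surf_eq (T.offset i) (T.norm_normal i) (fun x hx => hx.2) hm,
        ← compl_mem_ae_iff] at h0
      filter_upwards [h0] with z hz _ h1 h2
      exact hz ⟨⟨h1, h2⟩, hpl z⟩

end

end Element

/-! ### The divergence theorem on a polytopal element -/

/-- The flux through a hyperplane in the rescaled normal coordinate: `b` is the normal component of
the shift and `s = ±1` the orientation of the face. Each half line meets the window in length `c + s
* a`, with `a = b` or `a = 0`. -/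
lemma integral_jump {s b c : ℝ} (hs : s ^ 2 = 1) (hb : |b| ≤ c) :
    IntegrableOn (fun σ : ℝ => (if s * (σ - b) < 0 then (1 : ℝ) else 0) -
      (if s * σ < 0 then 1 else 0)) (Icc (-c) c) ∧
    ∫ σ in Icc (-c) c, ((if s * (σ - b) < 0 then (1 : ℝ) else 0) - (if s * σ < 0 then 1 else 0)) =
      s * b := by
  have hc : 0 ≤ c := (abs_nonneg b).trans hb
  obtain ⟨hb1, hb2⟩ := abs_le.1 hb
  have hm : ∀ a : ℝ, MeasurableSet {σ : ℝ | s * (σ - a) < 0} := fun a =>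
    measurableSet_lt (by fun_prop) measurable_const
  have hrw : ∀ a : ℝ, (fun σ : ℝ => if s * (σ - a) < 0 then (1 : ℝ) else 0) =
      {σ : ℝ | s * (σ - a) < 0}.indicator fun _ => 1 := fun a => by
    funext σ
    simp [indicator_apply]
  have hint : ∀ a : ℝ, IntegrableOn (fun σ : ℝ => if s * (σ - a) < 0 then (1 : ℝ) else 0)
      (Icc (-c) c) := fun a => by
    rw [hrw]
    exact (integrableOn_const (by simp)).indicator (hm a)
  have hval : ∀ a : ℝ, |a| ≤ c →
      ∫ σ in Icc (-c) c, (if s * (σ - a) < 0 then (1 : ℝ) else 0) = c + s * a := by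
    intro a ha
    obtain ⟨ha1, ha2⟩ := abs_le.1 ha
    rw [hrw, setIntegral_indicator (hm a), setIntegral_const, smul_eq_mul, mul_one]
    rcases (mul_self_eq_one_iff.1 ((pow_two s).symm.trans hs)) with h | h
    · have : Icc (-c) c ∩ {σ : ℝ | s * (σ - a) < 0} = Ico (-c) a := by
        ext σ
        simp only [mem_inter_iff, mem_Icc, mem_ofPred_eq, mem_Ico, h]
        constructor
        · rintro ⟨⟨h1, h2⟩, h3⟩
          exact ⟨h1, by linarith⟩
        · rintro ⟨h1, h2⟩
          exact ⟨⟨h1, by linarith⟩, by linarith⟩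
      rw [this, Real.volume_real_Ico_of_le ha1, h]
      ring
    · have : Icc (-c) c ∩ {σ : ℝ | s * (σ - a) < 0} = Ioc a c := by
        ext σ
        simp only [mem_inter_iff, mem_Icc, mem_ofPred_eq, mem_Ioc, h]
        constructor
        · rintro ⟨⟨h1, h2⟩, h3⟩
          exact ⟨by linarith, h2⟩
        · rintro ⟨h1, h2⟩
          exact ⟨⟨by linarith, h2⟩, by linarith⟩
      rw [this, Real.volume_real_Ioc_of_le ha2, h]
      ring
  have h0 : (fun σ : ℝ => if s * σ < 0 then (1 : ℝ) else 0) =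
      fun σ : ℝ => if s * (σ - 0) < 0 then (1 : ℝ) else 0 := by simp
  refine ⟨?_, ?_⟩
  · have := (hint b).sub (hint 0)
    simpa [Pi.sub_def] using this
  · have := integral_sub (hint b) (hint 0)
    rw [hval b hb, hval 0 (by simpa using hc)] at this
    simpa using this

/-- Integration in the coordinates of a hyperplane, with the normal coordinate scaled by `t`. -/
lemma PlaneChart.integral_scaled {m : ℕ} {n : E (m + 1)} (χ : PlaneChart n) (o : ℝ)
    {t : ℝ} (ht : 0 < t) {G : E (m + 1) → ℝ} (hG : Measurable G) :
    t⁻¹ * ∫ x, G x = ∫ p : E m × ℝ, G (χ.pt o p.1 + (t * p.2) • n) := by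
  set Φ : E m × ℝ → E (m + 1) := fun p => χ.pt o p.1 + p.2 • n with hΦ
  have hmp : MeasurePreserving Φ := χ.measurePreserving o
  have h1 : ∫ x, G x = ∫ p, G (Φ p) := by
    rw [← hmp.map_eq, integral_map hmp.measurable.aemeasurable hG.aestronglyMeasurable]
  have hmul : Measurable fun σ : ℝ => t * σ := measurable_const_mul t
  have h2 : Measure.map (Prod.map id fun σ : ℝ => t * σ) (volume : Measure (E m × ℝ)) =
      ENNReal.ofReal |t⁻¹| • (volume : Measure (E m × ℝ)) := by
    rw [Measure.volume_eq_prod, ← Measure.map_prod_map _ _ measurable_id hmul, Measure.map_id,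
      Real.map_volume_mul_left ht.ne', Measure.prod_smul_right]
  have h3 : ∫ p : E m × ℝ, G (χ.pt o p.1 + (t * p.2) • n) =
      ∫ p, G (Φ p) ∂(Measure.map (Prod.map id fun σ : ℝ => t * σ) (volume : Measure (E m × ℝ))) := by
    exact (integral_map (measurable_id.prodMap hmul).aemeasurable
      (hG.comp hmp.measurable).aestronglyMeasurable).symm
  rw [h3, h2, integral_smul_measure, h1, ENNReal.toReal_ofReal (abs_nonneg _),
    abs_of_pos (inv_pos.2 ht), smul_eq_mul]

namespace Element

section
variable {d : ℕ} (T : Element d) (v : E d)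

/-- The change of the indicator function of the element under translation by `t • v`. -/
def shiftDiff (t : ℝ) (x : E d) : ℝ :=
  T.carrier.indicator 1 (x - t • v) - T.carrier.indicator 1 x

/-- The indicator function of a slab around the hyperplane of the face `i`. -/
def slab (t : ℝ) (i : Fin T.numFaces) (x : E d) : ℝ := {x | |T.lev i x| ≤ t * ‖v‖}.indicator 1 x

/-- The partition of the union of the slabs. -/
def slabWeight (t : ℝ) (i : Fin T.numFaces) (x : E d) : ℝ :=
  T.slab v t i x / ∑ j, T.slab v t j x

lemma slab_nonneg (t : ℝ) (i : Fin T.numFaces) (x : E d) : 0 ≤ T.slab v t i x :=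
  indicator_nonneg (fun _ _ => zero_le_one) _

/-- Where the shift changes membership, the segment from `x - t • v` to `x` crosses a face, so `x`
lies in some slab and the weights sum to one. Elsewhere both sides vanish, which covers the points
where the weights are `0 / 0`. -/
lemma sum_slabWeight_mul {t : ℝ} (ht : 0 ≤ t) (x : E d) :
    ∑ i, T.slabWeight v t i x * T.shiftDiff v t x = T.shiftDiff v t x := by
  by_cases h : x - t • v ∈ T.carrier ↔ x ∈ T.carrier
  · have : T.shiftDiff v t x = 0 := by
      by_cases hx : x ∈ T.carrier <;> simp [shiftDiff, h, hx]
    simp [this]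
  · obtain ⟨j, hj⟩ := T.exists_lev_le ht h
    have h1 : T.slab v t j x = 1 := by simp [slab, hj]
    have hpos : 0 < ∑ j, T.slab v t j x :=
      Finset.sum_pos' (fun i _ => T.slab_nonneg v t i x) ⟨j, Finset.mem_univ j, by rw [h1]; exact one_pos⟩
    rw [← Finset.sum_mul]
    simp only [slabWeight]
    rw [← Finset.sum_div, div_self hpos.ne', one_mul]

lemma measurable_slab (t : ℝ) (i : Fin T.numFaces) : Measurable (T.slab v t i) :=
  measurable_one.indicator (measurableSet_le (T.continuous_lev i).abs.measurable measurable_const)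

lemma measurable_slabWeight (t : ℝ) (i : Fin T.numFaces) : Measurable (T.slabWeight v t i) :=
  (T.measurable_slab v t i).div (Finset.measurable_fun_sum _ fun j _ => T.measurable_slab v t j)

lemma measurable_shiftDiff (t : ℝ) : Measurable (T.shiftDiff v t) := by
  have h : Measurable (T.carrier.indicator (1 : E d → ℝ)) :=
    measurable_one.indicator T.isOpen.measurableSet
  exact (h.comp (measurable_id.sub_const _)).sub h

lemma slabWeight_mem (t : ℝ) (i : Fin T.numFaces) (x : E d) : |T.slabWeight v t i x| ≤ 1 := by
  have h1 := T.slab_nonneg v t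
  rw [slabWeight, abs_of_nonneg (div_nonneg (h1 i x) (Finset.sum_nonneg fun j _ => h1 j x))]
  exact div_le_one_of_le₀ (Finset.single_le_sum (f := fun j => T.slab v t j x)
    (fun j _ => h1 j x) (Finset.mem_univ i)) (Finset.sum_nonneg fun j _ => h1 j x)

lemma abs_shiftDiff_le (t : ℝ) (x : E d) : |T.shiftDiff v t x| ≤ 1 := by
  by_cases h : x - t • v ∈ T.carrier <;> by_cases hx : x ∈ T.carrier <;> simp [shiftDiff, h, hx]

lemma exists_radius : ∃ R : ℝ, 0 ≤ R ∧ ∀ t ∈ Icc (0 : ℝ) 1, ∀ x, R < ‖x‖ → T.shiftDiff v t x = 0 := by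
  obtain ⟨R, hR⟩ := T.bounded.subset_closedBall 0
  refine ⟨|R| + ‖v‖, by positivity, fun t ht x hx => ?_⟩
  have h1 : x ∉ T.carrier := fun h => by
    have := hR h
    rw [mem_closedBall_zero_iff] at this
    linarith [le_abs_self R, norm_nonneg v]
  have h2 : x - t • v ∉ T.carrier := fun h => by
    have h3 := hR h
    rw [mem_closedBall_zero_iff] at h3
    have h4 : ‖x‖ ≤ ‖x - t • v‖ + ‖t • v‖ := by simpa using norm_add_le (x - t • v) (t • v)
    rw [norm_smul, Real.norm_of_nonneg ht.1] at h4
    have h5 : t * ‖v‖ ≤ 1 * ‖v‖ := by gcongr; exact ht.2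
    linarith [le_abs_self R]
  simp [shiftDiff, h1, h2]

/-- Integrals of difference quotients over the element converge. -/
lemma tendsto_shift {f : E d → ℝ} (hf : ContDiff ℝ 1 f) :
    Filter.Tendsto (fun t : ℝ => t⁻¹ * ∫ x, f x * T.shiftDiff v t x) (nhdsWithin 0 (Ioi 0))
      (nhds (∫ x in T.carrier, fderiv ℝ f x v)) := by
  obtain ⟨R, hR⟩ := T.bounded.subset_closedBall 0
  have hcf := hf.continuous
  have heq : ∀ t : ℝ, t⁻¹ * ∫ x, f x * T.shiftDiff v t x =
      ∫ x in T.carrier, t⁻¹ * (f (x + t • v) - f x) := by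
    intro t
    rw [integral_const_mul]
    congr 1
    have e1 : ∫ x, f x * T.carrier.indicator (1 : E d → ℝ) (x - t • v) =
        ∫ x in T.carrier, f (x + t • v) := by
      rw [← integral_add_right_eq_self _ (t • v), ← integral_indicator T.isOpen.measurableSet]
      congr 1
      funext x
      by_cases hx : x ∈ T.carrier <;> simp [hx]
    have e2 : ∫ x, f x * T.carrier.indicator (1 : E d → ℝ) x = ∫ x in T.carrier, f x := by
      rw [← integral_indicator T.isOpen.measurableSet]
      congr 1
      funext x
      by_cases hx : x ∈ T.carrier <;> simp [hx]
    have i0 : IntegrableOn f T.carrier := T.integrableOn_of_continuous hcf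
    have i1 : IntegrableOn (fun x => f (x + t • v)) T.carrier :=
      T.integrableOn_of_continuous (hcf.comp (continuous_id.add continuous_const))
    have j2 : Integrable fun x => f x * T.carrier.indicator (1 : E d → ℝ) x := by
      refine ((integrable_indicator_iff T.isOpen.measurableSet).2 i0).congr
        (Filter.Eventually.of_forall fun x => ?_)
      by_cases hx : x ∈ T.carrier <;> simp [hx]
    have j1 : Integrable fun x => f x * T.carrier.indicator (1 : E d → ℝ) (x - t • v) := by
      have := ((integrable_indicator_iff T.isOpen.measurableSet).2 i1).comp_sub_right (t • v)
      refine this.congr (Filter.Eventually.of_forall fun x => ?_)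
      by_cases hx : x - t • v ∈ T.carrier <;> simp [hx]
    simp only [shiftDiff, mul_sub]
    rw [integral_sub j1 j2, e1, e2, integral_sub i1 i0]
  simp only [heq]
  obtain ⟨C, hC⟩ := (isCompact_closedBall (0 : E d) (R + ‖v‖)).exists_bound_of_continuousOn
    (hf.continuous_fderiv one_ne_zero).continuousOn
  have hfin : volume T.carrier ≠ ⊤ := T.bounded.measure_lt_top.ne
  refine tendsto_integral_filter_of_dominated_convergence (fun _ => C * ‖v‖) ?_ ?_
    (integrableOn_const hfin) ?_
  · refine Filter.Eventually.of_forall fun t => Continuous.aestronglyMeasurable ?_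
    fun_prop
  · filter_upwards [Ioc_mem_nhdsGT (zero_lt_one' ℝ)] with t ht
    filter_upwards [ae_restrict_mem T.isOpen.measurableSet] with x hx
    have hxR := hR hx
    rw [mem_closedBall_zero_iff] at hxR
    have h1 := (convex_closedBall (0 : E d) (R + ‖v‖)).norm_image_sub_le_of_norm_fderiv_le (𝕜 := ℝ)
      (f := f) (fun y _ => hf.differentiable one_ne_zero y) hC
      (x := x) (y := x + t • v) (by
        rw [mem_closedBall_zero_iff]; linarith [norm_nonneg v]) (by
        rw [mem_closedBall_zero_iff]
        refine (norm_add_le _ _).trans ?_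
        rw [norm_smul, Real.norm_of_nonneg ht.1.le]
        have : t * ‖v‖ ≤ 1 * ‖v‖ := by gcongr; exact ht.2
        linarith)
    rw [add_sub_cancel_left, norm_smul, Real.norm_of_nonneg ht.1.le] at h1
    rw [norm_mul, norm_inv, Real.norm_of_nonneg ht.1.le, inv_mul_le_iff₀ ht.1]
    linarith
  · refine Filter.Eventually.of_forall fun x => ?_
    exact ((hf.differentiable one_ne_zero x).hasFDerivAt.hasLineDerivAt v).tendsto_slope_zero_right

end

variable {m : ℕ} (T : Element (m + 1)) (v : E (m + 1))

/-- The contribution of one face hyperplane to the limit of the difference quotients. -/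
lemma tendsto_slab {f : E (m + 1) → ℝ} (hf : Continuous f) (i : Fin T.numFaces) :
    Filter.Tendsto (fun t : ℝ => t⁻¹ * ∫ x, f x * (T.slabWeight v t i x * T.shiftDiff v t x))
      (nhdsWithin 0 (Ioi 0))
      (nhds (∑ j ∈ T.coplanar i, ((T.coplanar i).card : ℝ)⁻¹ *
        (⟪v, T.normal j⟫ * ∫ x in T.face j, f x ∂(surf (m + 1))))) := by
  classical
  obtain ⟨χ⟩ := nonempty_planeChart (T.norm_normal i)
  set n := T.normal i with hn
  set o := T.offset i with ho
  set K := T.coplanar i with hK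
  set b := ⟪n, v⟫ with hb
  have hbv : |b| ≤ ‖v‖ := by
    have := abs_real_inner_le_norm n v
    rwa [T.norm_normal, one_mul] at this
  have hnn : ⟪n, n⟫ = 1 := by rw [real_inner_self_eq_norm_sq, T.norm_normal]; norm_num
  let s : Fin T.numFaces → ℝ := fun j => ⟪T.normal j, n⟫
  -- At `y + t σ n` the limit integrand is a sum of products: `A` restricts `f` to a face and `B`
  -- records the jump in `σ`. The translation by `t • v` replaces `σ` by `σ - b`.
  let jmp : Fin T.numFaces → ℝ → ℝ := fun j σ =>
    (if s j * (σ - b) < 0 then (1 : ℝ) else 0) - (if s j * σ < 0 then 1 else 0)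
  let A : Fin T.numFaces → E m → ℝ := fun j z =>
    (χ.pt o ⁻¹' T.face j).indicator (fun z => f (χ.pt o z)) z
  let B : Fin T.numFaces → ℝ → ℝ := fun j σ => (Icc (-‖v‖) ‖v‖).indicator (jmp j) σ
  have hjmp : ∀ j ∈ K, Integrable (B j) ∧ ∫ σ, B j σ = ⟪v, T.normal j⟫ := by
    intro j hj
    have h := integral_jump (T.inner_normal_sq hj) hbv
    refine ⟨(integrable_indicator_iff measurableSet_Icc).2 h.1, ?_⟩
    rw [integral_indicator measurableSet_Icc, h.2, real_inner_comm (T.normal j) v,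
      T.inner_normal_of_coplanar hj v]
  have hAm : ∀ j, MeasurableSet (χ.pt o ⁻¹' T.face j) := fun j =>
    (χ.continuous_pt o).measurable (T.measurableSet_face j)
  have hA : ∀ j ∈ K, Integrable (A j) ∧ ∫ z, A j z = ∫ x in T.face j, f x ∂(surf (m + 1)) := by
    intro j hj
    have hcomp : IsCompact (χ.pt o ⁻¹' T.face j) :=
      (χ.isometry_pt o).isClosedEmbedding.isCompact_preimage (T.isCompact_face j)
    refine ⟨(integrable_indicator_iff (hAm j)).2
      ((hf.comp (χ.continuous_pt o)).continuousOn.integrableOn_compact hcomp), ?_⟩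
    rw [integral_indicator (hAm j), χ.setIntegral_surf o (T.norm_normal i) _ (T.measurableSet_face j)]
    intro x hx
    have : x ∈ T.plane i := mem_coplanar.1 hj ▸ T.face_subset_plane j hx
    exact this
  have hlim : ∑ j ∈ K, (K.card : ℝ)⁻¹ * (⟪v, T.normal j⟫ * ∫ x in T.face j, f x ∂(surf (m + 1))) =
      ∫ p : E m × ℝ, ∑ j ∈ K, (K.card : ℝ)⁻¹ * (A j p.1 * B j p.2) := by
    rw [integral_finsetSum]
    · refine Finset.sum_congr rfl fun j hj => ?_
      rw [integral_const_mul, Measure.volume_eq_prod, integral_prod_mul, (hjmp j hj).2, (hA j hj).2]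
      ring
    · intro j hj
      exact ((hA j hj).1.mul_prod (hjmp j hj).1).const_mul _
  rw [hlim]
  obtain ⟨R, hR0, hR⟩ := T.exists_radius v
  obtain ⟨C, hC⟩ := (isCompact_closedBall (0 : E (m + 1)) R).exists_bound_of_continuousOn
    hf.continuousOn
  have hC0 : 0 ≤ C := (norm_nonneg _).trans (hC 0 (by simpa using hR0))
  let G : ℝ → E (m + 1) → ℝ := fun t x => f x * (T.slabWeight v t i x * T.shiftDiff v t x)
  have hGm : ∀ t, Measurable (G t) := fun t =>
    hf.measurable.mul ((T.measurable_slabWeight v t i).mul (T.measurable_shiftDiff v t))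
  -- Rescaling absorbs the factor `t⁻¹` and turns the slab into `|σ| ≤ ‖v‖`, independent of `t`.
  -- This is what permits dominated convergence.
  have hev : (fun t : ℝ => t⁻¹ * ∫ x, G t x) =ᶠ[nhdsWithin 0 (Ioi 0)]
      fun t => ∫ p : E m × ℝ, G t (χ.pt o p.1 + (t * p.2) • n) := by
    filter_upwards [self_mem_nhdsWithin] with t ht
    exact χ.integral_scaled o ht (hGm t)
  have hlev : ∀ (j) (z : E m) (τ : ℝ), j ∈ K → T.lev j (χ.pt o z + τ • n) = s j * τ := by
    intro j z τ hj
    rw [T.lev_eq_of_coplanar hj, T.lev_add_smul, hnn]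
    have : T.lev i (χ.pt o z) = 0 := by
      rw [lev, χ.inner_pt o (T.norm_normal i)]; ring
    rw [this]
    ring
  have habs : ∀ j ∈ K, |s j| = 1 := fun j hj => by
    have := T.inner_normal_sq hj
    rw [← sq_abs] at this
    exact (pow_eq_one_iff_of_nonneg (abs_nonneg _) two_ne_zero).1 this
  have hslabK : ∀ t > 0, ∀ (z : E m) (σ : ℝ), ∀ j ∈ K,
      T.slab v t j (χ.pt o z + (t * σ) • n) = (Icc (-‖v‖) ‖v‖).indicator 1 σ := by
    intro t ht z σ j hj
    have : |T.lev j (χ.pt o z + (t * σ) • n)| ≤ t * ‖v‖ ↔ σ ∈ Icc (-‖v‖) ‖v‖ := by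
      rw [hlev j z _ hj, abs_mul, habs j hj, one_mul, abs_mul, abs_of_pos ht,
        mul_le_mul_iff_right₀ ht, abs_le, mem_Icc]
    by_cases h : σ ∈ Icc (-‖v‖) ‖v‖
    · simp only [slab, indicator, mem_ofPred_eq, this, h, if_true, Pi.one_apply]
    · simp only [slab, indicator, mem_ofPred_eq, this, h, if_false]
  refine Filter.Tendsto.congr' hev.symm ?_
  refine tendsto_integral_filter_of_dominated_convergence
    ((Metric.closedBall (0 : E m) (R + |o| + ‖v‖) ×ˢ Icc (-‖v‖) ‖v‖).indicator fun _ => C) ?_ ?_ ?_ ?_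
  · refine Filter.Eventually.of_forall fun t => ?_
    refine ((hGm t).comp ?_).aestronglyMeasurable
    have : Continuous fun p : E m × ℝ => χ.pt o p.1 + (t * p.2) • n := by
      have := χ.continuous_pt o
      fun_prop
    exact this.measurable
  · filter_upwards [Ioc_mem_nhdsGT (zero_lt_one' ℝ)] with t ht
    refine Filter.Eventually.of_forall fun p => ?_
    set x := χ.pt o p.1 + (t * p.2) • n with hx
    by_cases hxR : R < ‖x‖
    · simp only [G, hR t ⟨ht.1.le, ht.2⟩ x hxR, mul_zero, norm_zero]
      exact indicator_nonneg (fun _ _ => hC0) _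
    by_cases hσ : p.2 ∈ Icc (-‖v‖) ‖v‖
    · have hz : p.1 ∈ Metric.closedBall (0 : E m) (R + |o| + ‖v‖) := by
        rw [mem_closedBall_zero_iff, ← χ.toLin.norm_map]
        have e : χ.toLin p.1 = x - o • n - (t * p.2) • n := by
          rw [hx, PlaneChart.pt]; abel
        rw [e]
        refine (norm_sub_le _ _).trans (add_le_add ((norm_sub_le _ _).trans
          (add_le_add (not_lt.1 hxR) ?_)) ?_)
        · rw [norm_smul, T.norm_normal, mul_one, Real.norm_eq_abs]
        · rw [norm_smul, T.norm_normal, mul_one, Real.norm_eq_abs, abs_mul, abs_of_pos ht.1]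
          have : |p.2| ≤ ‖v‖ := abs_le.2 hσ
          nlinarith [ht.2, abs_nonneg p.2]
      rw [indicator_of_mem (show p ∈ _ ×ˢ _ from ⟨hz, hσ⟩)]
      have h1 := hC x (mem_closedBall_zero_iff.2 (not_lt.1 hxR))
      simp only [G, norm_mul]
      calc ‖f x‖ * (‖T.slabWeight v t i x‖ * ‖T.shiftDiff v t x‖) ≤ C * (1 * 1) := by
            gcongr
            · exact T.slabWeight_mem v t i x
            · exact T.abs_shiftDiff_le v t x
        _ = C := by ring
    · have h0 : T.slab v t i x = 0 := by
        rw [hx, hslabK t ht.1 _ _ i self_mem_coplanar, indicator_of_notMem hσ]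
      simp only [G, slabWeight, h0, zero_div, zero_mul, mul_zero, norm_zero]
      exact indicator_nonneg (fun _ _ => hC0) _
  · refine (integrable_indicator_iff ?_).2 (integrableOn_const ?_)
    · exact measurableSet_closedBall.prod measurableSet_Icc
    · exact ((isCompact_closedBall _ _).prod isCompact_Icc).measure_lt_top.ne
  · have hgood := T.ae_good i χ
    -- These two values put one of the compared points on the hyperplane, where the local half-space
    -- description says nothing.
    have hσ : ∀ᵐ σ : ℝ, σ ≠ 0 ∧ σ ≠ b := by
      filter_upwards [(Set.toFinite {0, b}).measure_zero volume |> compl_mem_ae_iff.2] with σ h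
      simpa [not_or] using h
    have hprod : ∀ᵐ p : E m × ℝ, ((∀ j, j ∉ K → T.lev j (χ.pt o p.1) ≠ 0) ∧
        ∀ j k, j ≠ k → χ.pt o p.1 ∈ T.face j → χ.pt o p.1 ∉ T.face k) ∧ (p.2 ≠ 0 ∧ p.2 ≠ b) := by
      rw [Filter.eventually_and]
      exact ⟨Measure.quasiMeasurePreserving_fst.ae hgood, Measure.quasiMeasurePreserving_snd.ae hσ⟩
    filter_upwards [hprod] with p hp
    obtain ⟨⟨hnc, hun⟩, hp0, hpb⟩ := hp
    set y := χ.pt o p.1 with hy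
    set σ := p.2 with hσd
    have hx1 : Filter.Tendsto (fun t : ℝ => y + (t * σ) • n) (nhdsWithin 0 (Ioi 0)) (nhds y) := by
      have : Continuous fun t : ℝ => y + (t * σ) • n := by fun_prop
      have := (this.tendsto 0).mono_left (nhdsWithin_le_nhds (s := Ioi 0))
      simpa using this
    have hx2 : Filter.Tendsto (fun t : ℝ => y + (t * σ) • n - t • v) (nhdsWithin 0 (Ioi 0))
        (nhds y) := by
      have : Continuous fun t : ℝ => y + (t * σ) • n - t • v := by fun_prop
      have := (this.tendsto 0).mono_left (nhdsWithin_le_nhds (s := Ioi 0))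
      simpa using this
    -- The slabs of other hyperplanes recede from `y`, and those of `K` coincide, so each member of
    -- `K` gets the same share.
    have hw : ∀ᶠ t in nhdsWithin (0 : ℝ) (Ioi 0), T.slabWeight v t i (y + (t * σ) • n) =
        (K.card : ℝ)⁻¹ * (Icc (-‖v‖) ‖v‖).indicator 1 σ := by
      have hfar : ∀ᶠ t in nhdsWithin (0 : ℝ) (Ioi 0), ∀ j, j ∉ K →
          T.slab v t j (y + (t * σ) • n) = 0 := by
        rw [Filter.eventually_all]
        intro j
        by_cases hj : j ∈ K
        · exact Filter.Eventually.of_forall fun t h => (h hj).elim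
        have h1 : Filter.Tendsto (fun t : ℝ => |T.lev j (y + (t * σ) • n)|)
            (nhdsWithin 0 (Ioi 0)) (nhds |T.lev j y|) :=
          ((T.continuous_lev j).abs.tendsto y).comp hx1
        have h2 : Filter.Tendsto (fun t : ℝ => t * ‖v‖) (nhdsWithin 0 (Ioi 0)) (nhds 0) := by
          have : Continuous fun t : ℝ => t * ‖v‖ := by fun_prop
          have := (this.tendsto 0).mono_left (nhdsWithin_le_nhds (s := Ioi 0))
          simpa using this
        filter_upwards [h2.eventually_lt h1 (abs_pos.2 (hnc j hj))] with t ht _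
        rw [slab, indicator_of_notMem]
        exact not_le.2 ht
      filter_upwards [hfar, self_mem_nhdsWithin] with t ht ht0
      have hsum : ∑ j, T.slab v t j (y + (t * σ) • n) =
          K.card * (Icc (-‖v‖) ‖v‖).indicator (1 : ℝ → ℝ) σ := by
        rw [← Finset.sum_subset (Finset.subset_univ K) (fun j _ hj => ht j hj),
          Finset.sum_congr rfl (fun j hj => hslabK t ht0 p.1 σ j hj), Finset.sum_const,
          nsmul_eq_mul]
      rw [slabWeight, hsum, hslabK t ht0 p.1 σ i self_mem_coplanar]
      have hc : (K.card : ℝ) ≠ 0 := by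
        exact_mod_cast (Finset.card_pos.2 ⟨i, self_mem_coplanar⟩).ne'
      by_cases h : σ ∈ Icc (-‖v‖) ‖v‖
      · simp [h]
      · simp [h]
    have hJ : ∀ᶠ t in nhdsWithin (0 : ℝ) (Ioi 0), T.shiftDiff v t (y + (t * σ) • n) =
        ∑ j ∈ K, (T.face j).indicator 1 y * jmp j σ := by
      have hneg : ∀ t > (0 : ℝ), ∀ a, t * a < 0 ↔ a < 0 := fun t ht a =>
        ⟨fun h => by by_contra h'; exact not_le.2 h (mul_nonneg ht.le (not_lt.1 h')),
          fun h => mul_neg_of_pos_of_neg ht h⟩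
      by_cases hface : ∃ j ∈ K, y ∈ T.face j
      · obtain ⟨j, hj, hyj⟩ := hface
        obtain ⟨δ, hδ, hball⟩ := T.exists_ball_half hyj fun k hk => hun j k hk.symm hyj
        filter_upwards [hx1.eventually (Metric.ball_mem_nhds y hδ),
          hx2.eventually (Metric.ball_mem_nhds y hδ), self_mem_nhdsWithin] with t h1 h2 ht
        have ht' : (0 : ℝ) < t := ht
        have hs0 : s j ≠ 0 := fun h => by
          have := habs j hj
          rw [h] at this
          norm_num at this
        have l1 : T.lev j (y + (t * σ) • n) = t * (s j * σ) := by
          rw [hlev j p.1 _ hj]; ring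
        have l2 : T.lev j (y + (t * σ) • n - t • v) = t * (s j * (σ - b)) := by
          rw [sub_eq_add_neg, ← smul_neg, T.lev_add_smul, l1, inner_neg_right,
            T.inner_normal_of_coplanar hj v]
          ring
        have m1 := hball _ h1 (by rw [l1]; exact mul_ne_zero ht'.ne' (mul_ne_zero hs0 hp0))
        have m2 := hball _ h2 (by
          rw [l2]; exact mul_ne_zero ht'.ne' (mul_ne_zero hs0 (sub_ne_zero.2 hpb)))
        rw [l1, hneg t ht'] at m1
        rw [l2, hneg t ht'] at m2
        rw [Finset.sum_eq_single_of_mem j hj (fun k _ hk => by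
          rw [indicator_of_notMem (hun j k hk.symm hyj), zero_mul])]
        simp only [shiftDiff, indicator_apply, m1, m2, hyj, jmp, Pi.one_apply, if_true, one_mul]
      · push Not at hface
        have hno : ∀ j, y ∉ T.face j := by
          intro j hj
          by_cases hjK : j ∈ K
          · exact hface j hjK hj
          · exact hnc j hjK (T.lev_eq_zero hj)
        obtain ⟨δ, hδ, hball⟩ := T.exists_ball_const hno
        filter_upwards [hx1.eventually (Metric.ball_mem_nhds y hδ),
          hx2.eventually (Metric.ball_mem_nhds y hδ)] with t h1 h2
        rw [Finset.sum_eq_zero fun j _ => by rw [indicator_of_notMem (hno j), zero_mul]]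
        have : y + (t * σ) • n - t • v ∈ T.carrier ↔ y + (t * σ) • n ∈ T.carrier :=
          ⟨hball _ h2 _ h1, hball _ h1 _ h2⟩
        simp only [shiftDiff, indicator_apply, this, Pi.one_apply, sub_self]
    have hlimf : Filter.Tendsto (fun t : ℝ => f (y + (t * σ) • n) *
        (((K.card : ℝ)⁻¹ * (Icc (-‖v‖) ‖v‖).indicator 1 σ) *
          ∑ j ∈ K, (T.face j).indicator 1 y * jmp j σ)) (nhdsWithin 0 (Ioi 0))
        (nhds (∑ j ∈ K, (K.card : ℝ)⁻¹ * (A j p.1 * B j σ))) := by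
      have h1 := ((hf.tendsto y).comp hx1).mul_const
        (((K.card : ℝ)⁻¹ * (Icc (-‖v‖) ‖v‖).indicator 1 σ) *
          ∑ j ∈ K, (T.face j).indicator 1 y * jmp j σ)
      refine (congrArg (fun c => Filter.Tendsto _ _ (nhds c)) ?_).mpr h1
      rw [Finset.mul_sum, Finset.mul_sum]
      refine Finset.sum_congr rfl fun j _ => ?_
      have eA : A j p.1 = f y * (T.face j).indicator 1 y := by
        by_cases h : y ∈ T.face j
        · simp only [A, indicator_apply, mem_preimage, ← hy, h, if_true, Pi.one_apply, mul_one]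
        · simp only [A, indicator_apply, mem_preimage, ← hy, h, if_false, mul_zero]
      have eB : B j σ = (Icc (-‖v‖) ‖v‖).indicator 1 σ * jmp j σ := by
        by_cases h : σ ∈ Icc (-‖v‖) ‖v‖
        · simp only [B, indicator_of_mem h, Pi.one_apply, one_mul]
        · simp only [B, indicator_of_notMem h, zero_mul]
      rw [eA, eB]
      ring
    refine hlimf.congr' ?_
    filter_upwards [hw, hJ] with t h1 h2
    simp only [G, h1, h2]

/-- The divergence theorem on a polytopal element, for one component. -/
theorem integral_fderiv {f : E (m + 1) → ℝ} (hf : ContDiff ℝ 1 f) :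
    ∫ x in T.carrier, fderiv ℝ f x v =
      ∑ i, ∫ x in T.face i, f x * ⟪v, T.normal i⟫ ∂(surf (m + 1)) := by
  have hcf := hf.continuous
  refine tendsto_nhds_unique (T.tendsto_shift v hf) ?_
  have hsum := tendsto_finsetSum Finset.univ fun i _ => T.tendsto_slab v hcf i
  -- Each face receives an equal fraction of its flux from every member of its coplanar class;
  -- exchanging the sums adds these fractions up to one.
  have hval : ∑ i, ∑ j ∈ T.coplanar i, ((T.coplanar i).card : ℝ)⁻¹ *
        (⟪v, T.normal j⟫ * ∫ x in T.face j, f x ∂(surf (m + 1))) =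
      ∑ i, ∫ x in T.face i, f x * ⟪v, T.normal i⟫ ∂(surf (m + 1)) := by
    have h1 : ∀ i j, j ∈ T.coplanar i ↔ i ∈ T.coplanar j := fun i j => by
      rw [mem_coplanar, mem_coplanar, eq_comm]
    rw [Finset.sum_comm' (t' := Finset.univ) (s' := T.coplanar) (by simp [h1])]
    refine Finset.sum_congr rfl fun j _ => ?_
    rw [Finset.sum_congr rfl fun i hi => by rw [← coplanar_eq hi], Finset.sum_const, nsmul_eq_mul,
      integral_mul_const, mul_inv_cancel_left₀, mul_comm]
    exact_mod_cast (Finset.card_pos.2 ⟨j, self_mem_coplanar⟩).ne'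
  rw [hval] at hsum
  refine hsum.congr' ?_
  obtain ⟨R, hR0, hR⟩ := T.exists_radius v
  obtain ⟨C, hC⟩ := (isCompact_closedBall (0 : E (m + 1)) R).exists_bound_of_continuousOn
    hcf.continuousOn
  filter_upwards [Ioc_mem_nhdsGT (zero_lt_one' ℝ)] with t ht
  rw [← Finset.mul_sum, ← integral_finsetSum]
  · congr 1
    refine integral_congr_ae (Filter.Eventually.of_forall fun x => ?_)
    simp only
    rw [← Finset.mul_sum, T.sum_slabWeight_mul v ht.1.le]
  · intro i _
    have hb : Integrable ((Metric.closedBall (0 : E (m + 1)) R).indicator fun _ => C) :=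
      (integrable_indicator_iff measurableSet_closedBall).2
        (integrableOn_const (isCompact_closedBall _ _).measure_lt_top.ne)
    refine hb.mono' (hcf.measurable.mul ((T.measurable_slabWeight v t i).mul
      (T.measurable_shiftDiff v t))).aestronglyMeasurable (Filter.Eventually.of_forall fun x => ?_)
    by_cases hxR : R < ‖x‖
    · rw [hR t ⟨ht.1.le, ht.2⟩ x hxR, mul_zero, mul_zero, norm_zero,
        indicator_of_notMem (by rw [mem_closedBall_zero_iff]; exact not_le.2 hxR)]
    · have hx : x ∈ Metric.closedBall (0 : E (m + 1)) R := mem_closedBall_zero_iff.2 (not_lt.1 hxR)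
      have h1 := hC x hx
      rw [indicator_of_mem hx, norm_mul, norm_mul]
      have hC0 : 0 ≤ C := (norm_nonneg _).trans h1
      calc ‖f x‖ * (‖T.slabWeight v t i x‖ * ‖T.shiftDiff v t x‖) ≤ C * (1 * 1) := by
            gcongr
            · exact T.slabWeight_mem v t i x
            · exact T.abs_shiftDiff_le v t x
        _ = C := by ring

end Element

/-! ### Polynomial gradients and Green's formula -/

/-- The gradient of a polynomial. -/
def pgrad {d : ℕ} (p : MvPolynomial (Fin d) ℝ) (x : E d) : E d :=
  WithLp.toLp 2 fun i => peval (MvPolynomial.pderiv i p) x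

lemma hasGradientAt_peval {d : ℕ} (p : MvPolynomial (Fin d) ℝ) (x : E d) :
    HasGradientAt (peval p) (pgrad p x) x := by
  rw [hasGradientAt_iff_hasFDerivAt]
  induction p using MvPolynomial.induction_on with
  | C a =>
    have h1 : peval (MvPolynomial.C a : MvPolynomial (Fin d) ℝ) = fun _ => a := by
      funext x; simp [peval]
    have h2 : pgrad (MvPolynomial.C a : MvPolynomial (Fin d) ℝ) x = 0 := by
      ext i; simp [pgrad, peval]
    rw [h1, h2, map_zero]
    exact hasFDerivAt_const a x
  | add p q hp hq =>
    have h1 : peval (p + q) = fun x => peval p x + peval q x := by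
      funext x; simp [peval]
    have h2 : pgrad (p + q) x = pgrad p x + pgrad q x := by
      ext i; simp [pgrad, peval]
    rw [h1, h2, map_add]
    exact hp.add hq
  | mul_X p i hp =>
    have h1 : peval (p * MvPolynomial.X i) = fun x => peval p x * x i := by
      funext x; simp [peval]
    have hX : HasFDerivAt (fun x : E d => x i) (EuclideanSpace.proj i : E d →L[ℝ] ℝ) x :=
      (EuclideanSpace.proj i : E d →L[ℝ] ℝ).hasFDerivAt
    rw [h1]
    refine (hp.mul hX).congr_fderiv ?_
    ext y
    have h2 : pgrad (p * MvPolynomial.X i) x =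
        (x i) • pgrad p x + peval p x • EuclideanSpace.single i 1 := by
      ext j
      by_cases hij : i = j
      · subst hij
        simp [pgrad, peval]
        ring
      · simp [pgrad, peval, Ne.symm hij]
    rw [h2]
    simp [EuclideanSpace.inner_single_left]
    ring

lemma contDiff_peval {d : ℕ} (p : MvPolynomial (Fin d) ℝ) : ContDiff ℝ 1 (peval p) := by
  induction p using MvPolynomial.induction_on with
  | C a =>
    have h1 : peval (MvPolynomial.C a : MvPolynomial (Fin d) ℝ) = fun _ => a := by
      funext x; simp [peval]
    rw [h1]
    exact contDiff_const
  | add p q hp hq =>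
    have h1 : peval (p + q) = fun x => peval p x + peval q x := by
      funext x; simp [peval]
    rw [h1]
    exact hp.add hq
  | mul_X p i hp =>
    have h1 : peval (p * MvPolynomial.X i) = fun x => peval p x * x i := by
      funext x; simp [peval]
    rw [h1]
    exact hp.mul (EuclideanSpace.proj i : E d →L[ℝ] ℝ).contDiff

lemma fderiv_peval_single {d : ℕ} (p : MvPolynomial (Fin d) ℝ) (x : E d) (i : Fin d) :
    fderiv ℝ (peval p) x (EuclideanSpace.single i 1) = peval (MvPolynomial.pderiv i p) x := by
  rw [(hasGradientAt_iff_hasFDerivAt.1 (hasGradientAt_peval p x)).fderiv]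
  simp [EuclideanSpace.inner_single_right, pgrad]

lemma continuous_pgrad {d : ℕ} (p : MvPolynomial (Fin d) ℝ) : Continuous (pgrad p) :=
  (PiLp.continuous_toLp 2 _).comp (continuous_pi fun _ => Element.continuous_peval _)

lemma totalDegree_pderiv_le {σ : Type*} (i : σ) (p : MvPolynomial σ ℝ) :
    (MvPolynomial.pderiv i p).totalDegree ≤ p.totalDegree - 1 := by
  classical
  nth_rewrite 1 [p.as_sum]
  rw [map_sum]
  refine MvPolynomial.totalDegree_finsetSum_le fun s hs => ?_
  rw [MvPolynomial.pderiv_monomial]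
  by_cases h0 : s i = 0
  · simp [h0]
  refine (MvPolynomial.totalDegree_monomial_le _ _).trans ?_
  have h1 := MvPolynomial.le_totalDegree hs
  have h2 : s - Finsupp.single i 1 + Finsupp.single i 1 = s :=
    tsub_add_cancel_of_le (Finsupp.single_le_iff.2 (Nat.one_le_iff_ne_zero.2 h0))
  have h3 : s.sum (fun _ e => e) =
      (s - Finsupp.single i 1).sum (fun _ e => e) + 1 := by
    conv_lhs => rw [← h2]
    rw [Finsupp.sum_add_index' (by simp) (by simp)]
    simp
  change (s - Finsupp.single i 1).sum (fun _ e => e) ≤ _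
  omega

lemma exists_polyVec {d r : ℕ} {F : Fin d → E d → ℝ} (hF : ∀ i, PolyFun r (F i)) :
    ∃ φ : PolyVec d r, ∀ x, φ.eval x = WithLp.toLp 2 fun i => F i x := by
  choose p hp hFp using hF
  refine ⟨fun i => ⟨p i, (MvPolynomial.mem_restrictTotalDegree _ _ _).2 (hp i)⟩, fun x => ?_⟩
  simp [PolyVec.eval, hFp]

lemma PolyVec.polyFun {d r : ℕ} (g : PolyVec d r) (i : Fin d) : PolyFun r fun x => g.eval x i :=
  ⟨g i, (MvPolynomial.mem_restrictTotalDegree _ _ _).1 (g i).2, fun _ => rfl⟩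

namespace Element

variable {m : ℕ} (T : Element (m + 1))

lemma integrableOn_face {f : E (m + 1) → ℝ} (hf : Continuous f) (i : Fin T.numFaces) :
    IntegrableOn f (T.face i) (surf (m + 1)) := by
  obtain ⟨χ⟩ := nonempty_planeChart (T.norm_normal i)
  rw [IntegrableOn, ← χ.map_restrict (T.offset i) (T.norm_normal i) (T.face_flat i)
    (T.measurableSet_face i), (χ.measurableEmbedding_pt _).integrable_map_iff]
  exact (hf.comp (χ.continuous_pt _)).continuousOn.integrableOn_compact
    ((χ.isometry_pt _).isClosedEmbedding.isCompact_preimage (T.isCompact_face i))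

/-- `g` is the discrete weak gradient of the weak function with components `p` and `pb`, in the form
obtained from the divergence theorem. -/
def Green {r : ℕ} (p : MvPolynomial (Fin (m + 1)) ℝ)
    (pb : Fin T.numFaces → MvPolynomial (Fin (m + 1)) ℝ) (g : PolyVec (m + 1) r) : Prop :=
  ∀ φ : PolyVec (m + 1) r, ∫ x in T.carrier, ⟪g.eval x - pgrad p x, φ.eval x⟫ =
    -∑ i, ∫ x in T.face i, (peval p x - peval (pb i) x) * ⟪φ.eval x, T.normal i⟫ ∂(surf (m + 1))

/-- The one-component divergence theorem is applied to `p φ_l` in each coordinate direction; the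
product rule and summation over `l` give the formula. -/
lemma integral_div {r : ℕ} (p : MvPolynomial (Fin (m + 1)) ℝ) (φ : PolyVec (m + 1) r) :
    (∫ x in T.carrier, peval p x * φ.div x) + ∫ x in T.carrier, ⟪pgrad p x, φ.eval x⟫ =
      ∑ i, ∫ x in T.face i, peval p x * ⟪φ.eval x, T.normal i⟫ ∂(surf (m + 1)) := by
  have hcp := continuous_peval p
  have h1 : ∀ l : Fin (m + 1), ∫ x in T.carrier, peval (MvPolynomial.pderiv l
      (p * (φ l : MvPolynomial (Fin (m + 1)) ℝ))) x =
      ∑ i, ∫ x in T.face i, peval p x * φ.eval x l * T.normal i l ∂(surf (m + 1)) := by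
    intro l
    have := T.integral_fderiv (EuclideanSpace.single l 1)
      (contDiff_peval (p * (φ l : MvPolynomial (Fin (m + 1)) ℝ)))
    simp only [fderiv_peval_single] at this
    rw [this]
    simp [EuclideanSpace.inner_single_left, peval, PolyVec.eval]
  rw [← integral_add]
  · have h2 : ∀ x, peval p x * φ.div x + ⟪pgrad p x, φ.eval x⟫ = ∑ l, peval (MvPolynomial.pderiv l
        (p * (φ l : MvPolynomial (Fin (m + 1)) ℝ))) x := by
      intro x
      simp only [PolyVec.div, PiLp.inner_apply, pgrad, PolyVec.eval, Finset.mul_sum,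
        ← Finset.sum_add_distrib, MvPolynomial.pderiv_mul]
      refine Finset.sum_congr rfl fun l _ => ?_
      simp [peval]
      ring
    simp only [h2]
    rw [integral_finsetSum _ fun l _ => T.integrableOn_of_continuous (continuous_peval _),
      Finset.sum_congr rfl fun l _ => h1 l, Finset.sum_comm]
    refine Finset.sum_congr rfl fun i _ => ?_
    rw [← integral_finsetSum]
    · refine integral_congr_ae (Filter.Eventually.of_forall fun x => ?_)
      simp only [PiLp.inner_apply, Finset.mul_sum]
      refine Finset.sum_congr rfl fun l _ => ?_
      simp
      ring
    · intro l _
      exact T.integrableOn_face ((hcp.mul (φ.polyFun l).continuous).mul continuous_const) i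
  · exact T.integrableOn_of_continuous (hcp.mul (continuous_div φ))
  · exact T.integrableOn_of_continuous ((continuous_pgrad p).inner (continuous_polyVec φ))

lemma green_of_isWeakGrad {r : ℕ} {p : MvPolynomial (Fin (m + 1)) ℝ}
    {pb : Fin T.numFaces → MvPolynomial (Fin (m + 1)) ℝ} {g : PolyVec (m + 1) r}
    {v0 : E (m + 1) → ℝ} {vb : Fin T.numFaces → E (m + 1) → ℝ}
    (h0 : ∀ x ∈ closure T.carrier, v0 x = peval p x)
    (hb : ∀ i, ∀ x ∈ T.face i, vb i x = peval (pb i) x) (hg : T.IsWeakGrad r v0 vb g) :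
    T.Green p pb g := by
  intro φ
  have h1 := hg φ
  rw [setIntegral_congr_fun (f := fun x => v0 x * φ.div x) (g := fun x => peval p x * φ.div x) T.isOpen.measurableSet
      (fun x hx => by simp only [h0 x (subset_closure hx)]),
    Finset.sum_congr rfl fun i _ => setIntegral_congr_fun
      (f := fun x => vb i x * ⟪φ.eval x, T.normal i⟫)
      (g := fun x => peval (pb i) x * ⟪φ.eval x, T.normal i⟫) (T.measurableSet_face i)
      (fun x hx => by simp only [hb i x hx])] at h1
  have h2 := T.integral_div p φ
  have hn : ∀ i, Continuous fun x => ⟪φ.eval x, T.normal i⟫ := fun i =>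
    (continuous_polyVec φ).inner continuous_const
  simp only [inner_sub_left, sub_mul]
  rw [integral_sub
    (T.integrableOn_of_continuous ((continuous_polyVec g).inner (continuous_polyVec φ)))
    (T.integrableOn_of_continuous ((continuous_pgrad p).inner (continuous_polyVec φ))), h1,
    Finset.sum_congr rfl fun i _ => integral_sub
      (f := fun x => peval p x * ⟪φ.eval x, T.normal i⟫)
      (g := fun x => peval (pb i) x * ⟪φ.eval x, T.normal i⟫)
      (T.integrableOn_face ((continuous_peval p).mul (hn i)) i)
      (T.integrableOn_face ((continuous_peval (pb i)).mul (hn i)) i), Finset.sum_sub_distrib]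
  linarith

lemma gradient_eq {v0 : E (m + 1) → ℝ} {p : MvPolynomial (Fin (m + 1)) ℝ}
    (h0 : ∀ x ∈ closure T.carrier, v0 x = peval p x) {x : E (m + 1)} (hx : x ∈ T.carrier) :
    gradient v0 x = pgrad p x := by
  have : v0 =ᶠ[nhds x] peval p := by
    filter_upwards [T.isOpen.mem_nhds hx] with y hy
    exact h0 y (subset_closure hy)
  rw [gradient, this.fderiv_eq]
  exact (hasGradientAt_peval p x).gradient

/-! ### Scaling of distances, volumes and areas -/

lemma diam_pos : 0 < T.diam := by
  obtain ⟨a, ha⟩ := T.nonempty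
  obtain ⟨ε, hε, hb⟩ := Metric.isOpen_iff.1 T.isOpen a ha
  obtain ⟨b, hb1, hb2⟩ : ∃ b ∈ Metric.ball a ε, b ≠ a := by
    refine ⟨a + EuclideanSpace.single 0 (ε / 2), ?_, ?_⟩
    · rw [mem_ball_iff_norm, add_sub_cancel_left, PiLp.norm_single, Real.norm_eq_abs,
        abs_of_pos (by linarith)]
      linarith
    · intro h
      have := congrArg (fun x : E (m + 1) => x 0) h
      simp at this
      linarith
  exact (dist_pos.2 hb2).trans_le (Metric.dist_le_diam_of_mem T.bounded (hb hb1) ha)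

lemma dist_le {x y : E (m + 1)} (hx : x ∈ closure T.carrier) (hy : y ∈ closure T.carrier) :
    dist x y ≤ T.diam := by
  rw [diam, ← Metric.diam_closure]
  exact Metric.dist_le_diam_of_mem T.bounded.closure hx hy

lemma abs_lev_sub_le (i : Fin T.numFaces) (x y : E (m + 1)) :
    |T.lev i x - T.lev i y| ≤ dist x y := by
  have := abs_real_inner_le_norm (T.normal i) (x - y)
  rw [T.norm_normal, one_mul, ← dist_eq_norm, inner_sub_right] at this
  simpa [lev] using this

/-- The signed distance is 1-Lipschitz and vanishes on the face, which lies in the closure of the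
element. Hence the scaled distances in the cut-off products are at most one. -/
lemma abs_lev_le {i : Fin T.numFaces} (hne : (T.face i).Nonempty) {x : E (m + 1)}
    (hx : x ∈ closure T.carrier) : |T.lev i x| ≤ T.diam := by
  obtain ⟨y, hy⟩ := hne
  have := T.abs_lev_sub_le i x y
  rw [T.lev_eq_zero hy, sub_zero] at this
  exact this.trans (T.dist_le hx (T.face_subset i hy))

/-- The volume of the unit ball. -/
def ballVol (n : ℕ) : ℝ := (volume (Metric.closedBall (0 : E n) 1)).toReal

lemma ballVol_pos (n : ℕ) : 0 < ballVol n :=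
  ENNReal.toReal_pos (Metric.measure_closedBall_pos _ _ one_pos).ne'
    (isCompact_closedBall _ _).measure_lt_top.ne

lemma volume_closedBall {n : ℕ} (a : E n) {r : ℝ} (hr : 0 ≤ r) :
    volume (Metric.closedBall a r) = ENNReal.ofReal (ballVol n * r ^ n) := by
  rw [Measure.addHaar_closedBall' _ _ hr, finrank_euclideanSpace_fin, mul_comm (ballVol n),
    ENNReal.ofReal_mul (by positivity), ballVol,
    ENNReal.ofReal_toReal (isCompact_closedBall _ _).measure_lt_top.ne]

lemma volume_carrier_le : (volume T.carrier).toReal ≤ ballVol (m + 1) * T.diam ^ (m + 1) := by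
  obtain ⟨a, ha⟩ := T.nonempty
  refine ENNReal.toReal_le_of_le_ofReal
    (mul_nonneg (ballVol_pos _).le (pow_nonneg T.diam_pos.le _)) ?_
  rw [← volume_closedBall a T.diam_pos.le]
  exact measure_mono fun x hx => T.dist_le (subset_closure hx) (subset_closure ha)

lemma surf_face_le (i : Fin T.numFaces) :
    surf (m + 1) (T.face i) ≤ ENNReal.ofReal (ballVol m * T.diam ^ m) := by
  obtain ⟨χ⟩ := nonempty_planeChart (T.norm_normal i)
  rw [χ.surf_eq (T.offset i) (T.norm_normal i) (T.face_flat i) (T.measurableSet_face i)]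
  rcases (χ.pt (T.offset i) ⁻¹' T.face i).eq_empty_or_nonempty with h | ⟨z, hz⟩
  · rw [h, measure_empty]
    exact zero_le
  · rw [← volume_closedBall z T.diam_pos.le]
    refine measure_mono fun z' hz' => ?_
    rw [Metric.mem_closedBall, ← (χ.isometry_pt (T.offset i)).dist_eq]
    exact T.dist_le (T.face_subset i hz') (T.face_subset i hz)

lemma surf_face_lt_top (i : Fin T.numFaces) : surf (m + 1) (T.face i) < ⊤ :=
  (T.surf_face_le i).trans_lt ENNReal.ofReal_lt_top

/-- Integrals over a face of functions that are bounded almost everywhere. -/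
lemma abs_integral_face_le (i : Fin T.numFaces) {f : E (m + 1) → ℝ} {B : ℝ} (hB : 0 ≤ B)
    (hf : ∀ᵐ x ∂(surf (m + 1)).restrict (T.face i), |f x| ≤ B) :
    |∫ x in T.face i, f x ∂(surf (m + 1))| ≤ B * (ballVol m * T.diam ^ m) := by
  refine (norm_setIntegral_le_of_norm_le_const_ae (f := f) (C := B) (T.surf_face_lt_top i)
    ?_).trans ?_
  · exact hf
  · refine mul_le_mul_of_nonneg_left ?_ hB
    exact ENNReal.toReal_le_of_le_ofReal
      (mul_nonneg (ballVol_pos _).le (pow_nonneg T.diam_pos.le _)) (T.surf_face_le i)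

lemma integral_carrier_le {f : E (m + 1) → ℝ} {B : ℝ} (hB : 0 ≤ B)
    (hf : ∀ x ∈ T.carrier, |f x| ≤ B) :
    ∫ x in T.carrier, f x ≤ B * (ballVol (m + 1) * T.diam ^ (m + 1)) := by
  refine (le_abs_self _).trans ((norm_setIntegral_le_of_norm_le_const (f := f) (C := B)
    T.bounded.measure_lt_top hf).trans ?_)
  exact mul_le_mul_of_nonneg_left T.volume_carrier_le hB

namespace ShapeRegular

variable {T} {ρv ρe κ σ τ : ℝ} (hS : T.ShapeRegular ρv ρe κ σ τ)

include hS

lemma le_volume : ENNReal.ofReal (ρv * T.diam ^ (m + 1)) ≤ volume T.carrier :=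
  ENNReal.ofReal_le_of_le_toReal hS.volume_ge

lemma le_surf (hρe : 0 < ρe) (hκ : 0 < κ) (i : Fin T.numFaces) :
    ENNReal.ofReal (ρe * κ ^ m * T.diam ^ m) ≤ surf (m + 1) (T.face i) := by
  refine ENNReal.ofReal_le_of_le_toReal (le_trans ?_ (hS.area_ge i))
  rw [mul_assoc, ← mul_pow, Nat.add_sub_cancel]
  -- For `d = 1` the exponent is zero, so no lower bound on the face diameter is required.
  rcases m with _ | m
  · simp
  · have h1 := hS.face_diam_ge (by omega) i
    have h2 : 0 ≤ κ * T.diam := mul_nonneg hκ.le T.diam_pos.le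
    gcongr

lemma face_nonempty (hρe : 0 < ρe) (hκ : 0 < κ) (i : Fin T.numFaces) : (T.face i).Nonempty := by
  rw [nonempty_iff_ne_empty]
  intro h
  have h1 := hS.le_surf hρe hκ i
  rw [h, measure_empty, nonpos_iff_eq_zero, ENNReal.ofReal_eq_zero] at h1
  have : 0 < ρe * κ ^ m * T.diam ^ m := by
    have := T.diam_pos
    positivity
  linarith

end ShapeRegular

end Element

/-! ### Control of the gradient by the weak gradient -/

lemma mul_le_young {a b δ : ℝ} (hδ : 0 < δ) : a * b ≤ δ / 2 * a ^ 2 + 1 / (2 * δ) * b ^ 2 := by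
  have h : δ / 2 * a ^ 2 + 1 / (2 * δ) * b ^ 2 - a * b = (δ * a - b) ^ 2 / (2 * δ) := by
    field_simp
    ring
  have : 0 ≤ (δ * a - b) ^ 2 / (2 * δ) := by positivity
  linarith

lemma norm_sq_eq_sum {d : ℕ} (x : E d) : ‖x‖ ^ 2 = ∑ i, x i ^ 2 := by
  simp [EuclideanSpace.norm_sq_eq]

lemma exists_abs_max {n : ℕ} {f : E n → ℝ} (hf : Continuous f) (a : E n) {h : ℝ} (hh : 0 ≤ h) :
    ∃ x ∈ Metric.closedBall a h, ∀ y ∈ Metric.closedBall a h, |f y| ≤ |f x| :=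
  (isCompact_closedBall a h).exists_isMaxOn ⟨a, Metric.mem_closedBall_self hh⟩ hf.abs.continuousOn

namespace Element

variable {m : ℕ} (T : Element (m + 1))

lemma abs_integral_inner_le {F G : E (m + 1) → E (m + 1)} (hF : Continuous F) (hG : Continuous G)
    {δ : ℝ} (hδ : 0 < δ) :
    |∫ x in T.carrier, ⟪F x, G x⟫| ≤ δ / 2 * T.normSq F + 1 / (2 * δ) * T.normSq G := by
  have i1 := (T.integrableOn_of_continuous (hF.norm.pow 2)).const_mul (δ / 2)
  have i2 := (T.integrableOn_of_continuous (hG.norm.pow 2)).const_mul (1 / (2 * δ))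
  have h := norm_integral_le_of_norm_le (f := fun x => ⟪F x, G x⟫) (i1.add i2)
    (Filter.Eventually.of_forall fun x =>
      (abs_real_inner_le_norm (F x) (G x)).trans (mul_le_young hδ))
  refine h.trans_eq ?_
  simp only [Pi.add_apply]
  rw [integral_add i1 i2, integral_const_mul, integral_const_mul]
  rfl

lemma normSq_nonneg (F : E (m + 1) → E (m + 1)) : 0 ≤ T.normSq F :=
  integral_nonneg fun _ => by positivity

/-- The `L²` norm of the gradient of a polynomial is bounded by that of the weak gradient. -/
theorem exists_normSq_pgrad_le (m k N : ℕ) {ρv ρe κ σ τ : ℝ} (hρv : 0 < ρv) (hρe : 0 < ρe)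
    (hκ : 0 < κ) :
    ∃ C > 0, ∀ T : Element (m + 1), T.ShapeRegular ρv ρe κ σ τ → T.numFaces = N →
      ∀ r, 2 * N + k - 1 ≤ r → ∀ (p : MvPolynomial (Fin (m + 1)) ℝ)
        (pb : Fin T.numFaces → MvPolynomial (Fin (m + 1)) ℝ) (g : PolyVec (m + 1) r),
        p.totalDegree ≤ k → T.Green p pb g → T.normSq (pgrad p) ≤ C * T.normSq g.eval := by
  obtain ⟨c, hc, H⟩ := exists_lower_bound (m + 1) (max k 1) (N + 1) hρv
  set V := ballVol (m + 1) with hV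
  have hV0 : 0 < V := ballVol_pos _
  refine ⟨V ^ 2 / c ^ 2, by positivity, ?_⟩
  rintro T hS rfl r hr p pb g hp hg
  set h := T.diam with hh
  have hh0 : 0 < h := T.diam_pos
  obtain ⟨a, ha⟩ := T.nonempty
  have hTa : T.carrier ⊆ Metric.closedBall a h := fun x hx =>
    T.dist_le (subset_closure hx) (subset_closure ha)
  let D : Fin (m + 1) → E (m + 1) → ℝ := fun l => peval (MvPolynomial.pderiv l p)
  have hD : ∀ l, PolyFun (k - 1) (D l) := fun l =>
    ⟨_, (totalDegree_pderiv_le l p).trans (Nat.sub_le_sub_right hp 1), fun _ => rfl⟩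
  have hlp : ∀ j, PolyFun 1 fun x => T.lev j x / h := fun j => by
    simpa [lev, div_eq_inv_mul] using
      ((PolyFun.inner_left (T.normal j)).sub (PolyFun.const (T.offset j))).const_mul h⁻¹
  let L : E (m + 1) → ℝ := fun x => ∏ j, (T.lev j x / h) ^ 2
  have hL : PolyFun (2 * T.numFaces) L := by
    have := PolyFun.prod Finset.univ (F := fun j x => (T.lev j x / h) ^ 2)
      (m := 2 * 1) (fun j _ => (hlp j).pow 2)
    exact this.mono (by simp [mul_comm])
  have hL01 : ∀ x ∈ T.carrier, 0 ≤ L x ∧ L x ≤ 1 := fun x hx => by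
    refine ⟨Finset.prod_nonneg fun _ _ => sq_nonneg _, Finset.prod_le_one (fun _ _ => sq_nonneg _)
      fun j _ => ?_⟩
    rw [sq_le_one_iff_abs_le_one, abs_div, abs_of_pos hh0, div_le_one hh0]
    exact T.abs_lev_le (hS.face_nonempty hρe hκ j) (subset_closure hx)
  have hφp : ∀ l, PolyFun r fun x => L x * D l x := fun l => by
    -- For `k = 0` the allowed degree `2N - 1` may be below that of `L`, but then `p` is constant
    -- and the test field vanishes.
    rcases Nat.eq_zero_or_pos k with hk | hk
    · have h0 : MvPolynomial.pderiv l p = 0 := by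
        have h1 : p.totalDegree = 0 := by omega
        rw [MvPolynomial.totalDegree_eq_zero_iff_eq_C.1 h1]
        simp
      have : (fun x => L x * D l x) = fun _ => 0 := by
        funext x
        simp [D, h0, peval]
      rw [this]
      exact PolyFun.const 0
    · exact (hL.mul (hD l)).mono (by omega)
  obtain ⟨φ, hφ⟩ := exists_polyVec hφp
  have hφ' : ∀ x, φ.eval x = L x • pgrad p x := fun x => by
    rw [hφ]
    ext l
    simp [pgrad, D]
  have hid : ∫ x in T.carrier, ⟪pgrad p x, φ.eval x⟫ = ∫ x in T.carrier, ⟪g.eval x, φ.eval x⟫ := by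
    have h1 := hg φ
    have h2 : ∀ i, ∫ x in T.face i,
        (peval p x - peval (pb i) x) * ⟪φ.eval x, T.normal i⟫ ∂(surf (m + 1)) = 0 := fun i => by
      refine setIntegral_eq_zero_of_forall_eq_zero fun x hx => ?_
      have : L x = 0 := Finset.prod_eq_zero (Finset.mem_univ i) (by
        rw [T.lev_eq_zero hx]; simp)
      rw [hφ', this]
      simp
    simp only [inner_sub_left] at h1
    rw [integral_sub
      (T.integrableOn_of_continuous ((continuous_polyVec g).inner (continuous_polyVec φ)))
      (T.integrableOn_of_continuous ((continuous_pgrad p).inner (continuous_polyVec φ))),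
      Finset.sum_eq_zero fun i _ => h2 i] at h1
    linarith
  -- Moving from `a` by `h` along the normal, away from the hyperplane, gives a point of the ball
  -- where the scaled distance is at least one. The lower bound permits comparison points outside
  -- the element.
  have hfar : ∀ j, ∃ y ∈ Metric.closedBall a h, 1 ≤ (T.lev j y / h) ^ 2 := fun j => by
    have hnn : ⟪T.normal j, T.normal j⟫ = 1 := by
      rw [real_inner_self_eq_norm_sq, T.norm_normal]; norm_num
    have hb : ∀ t : ℝ, |t| = h → a + t • T.normal j ∈ Metric.closedBall a h := fun t ht => by
      rw [mem_closedBall_iff_norm, add_sub_cancel_left, norm_smul, T.norm_normal, mul_one,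
        Real.norm_eq_abs, ht]
    have hl : ∀ t : ℝ, T.lev j (a + t • T.normal j) = T.lev j a + t := fun t => by
      rw [T.lev_add_smul, hnn, mul_one]
    rcases le_total 0 (T.lev j a) with h0 | h0
    · refine ⟨_, hb h (abs_of_pos hh0), ?_⟩
      rw [hl, div_pow, one_le_div (by positivity)]
      nlinarith
    · refine ⟨_, hb (-h) (by rw [abs_neg, abs_of_pos hh0]), ?_⟩
      rw [hl, div_pow, one_le_div (by positivity)]
      nlinarith
  choose y hy hy1 using hfar
  choose z hz hzmax using fun l => exists_abs_max (hD l).continuous a hh0.le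
  set X := h ^ (m + 1) * ∑ l, (D l (z l)) ^ 2 with hX
  have hlow : ∀ l, c * h ^ (m + 1) * (D l (z l)) ^ 2 ≤ ∫ x in T.carrier, D l x ^ 2 * L x := by
    intro l
    have h1 := H a h hh0 T.carrier hTa T.isOpen.measurableSet hS.le_volume
      (Finset.insertNone (Finset.univ : Finset (Fin T.numFaces))) (by simp)
      (fun j => Option.elim j (D l) fun j x => T.lev j x / h)
      (fun j _ => by
        cases j with
        | none => exact (hD l).mono ((Nat.sub_le k 1).trans (le_max_left _ _))
        | some j => exact (hlp j).mono (le_max_right _ _))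
      (fun j => Option.elim j (z l) y)
      (fun j _ => by
        cases j with
        | none => exact hz l
        | some j => exact hy j)
    simp only [Finset.prod_insertNone, Option.elim_none, Option.elim_some] at h1
    refine le_trans ?_ h1
    have h2 : 1 ≤ ∏ j, (T.lev j (y j) / h) ^ 2 := by
      have := Finset.prod_le_prod (s := Finset.univ) (f := fun _ : Fin T.numFaces => (1 : ℝ))
        (g := fun j => (T.lev j (y j) / h) ^ 2) (fun _ _ => zero_le_one) fun j _ => hy1 j
      simpa using this
    have h3 : 0 ≤ c * h ^ (m + 1) * D l (z l) ^ 2 := by positivity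
    calc c * h ^ (m + 1) * D l (z l) ^ 2 ≤ c * h ^ (m + 1) * D l (z l) ^ 2 *
          ∏ j, (T.lev j (y j) / h) ^ 2 := le_mul_of_one_le_right h3 h2
      _ = _ := by ring
  have hDb : ∀ x ∈ T.carrier, ‖pgrad p x‖ ^ 2 ≤ ∑ l, (D l (z l)) ^ 2 := fun x hx => by
    rw [norm_sq_eq_sum]
    exact Finset.sum_le_sum fun l _ => sq_le_sq.2 (hzmax l x (hTa hx))
  have hsum0 : 0 ≤ ∑ l, (D l (z l)) ^ 2 := Finset.sum_nonneg fun _ _ => sq_nonneg _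
  have h1 : c * X ≤ ∫ x in T.carrier, ⟪pgrad p x, φ.eval x⟫ := by
    have e : ∀ x, ⟪pgrad p x, φ.eval x⟫ = ∑ l, D l x ^ 2 * L x := fun x => by
      rw [hφ', real_inner_smul_right, real_inner_self_eq_norm_sq, norm_sq_eq_sum, ← Finset.sum_mul,
        mul_comm]
      rfl
    simp only [e]
    rw [integral_finsetSum (f := fun l x => D l x ^ 2 * L x) _ fun l _ => T.integrableOn_of_continuous
      (((hD l).continuous.pow 2).mul hL.continuous), hX, ← mul_assoc, Finset.mul_sum]
    exact Finset.sum_le_sum fun l _ => hlow l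
  have h2 : T.normSq φ.eval ≤ V * X := by
    have : T.normSq φ.eval ≤ (∑ l, (D l (z l)) ^ 2) * (V * h ^ (m + 1)) := by
      refine T.integral_carrier_le hsum0 fun x hx => ?_
      rw [abs_of_nonneg (by positivity), hφ', norm_smul, mul_pow, Real.norm_eq_abs, sq_abs]
      obtain ⟨hl0, hl1⟩ := hL01 x hx
      calc L x ^ 2 * ‖pgrad p x‖ ^ 2 ≤ 1 * ‖pgrad p x‖ ^ 2 := by
            gcongr
            exact pow_le_one₀ hl0 hl1
        _ ≤ _ := by rw [one_mul]; exact hDb x hx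
    rw [hX]
    linarith
  have h3 : T.normSq (pgrad p) ≤ V * X := by
    have : T.normSq (pgrad p) ≤ (∑ l, (D l (z l)) ^ 2) * (V * h ^ (m + 1)) := by
      refine T.integral_carrier_le hsum0 fun x hx => ?_
      rw [abs_of_nonneg (by positivity)]
      exact hDb x hx
    rw [hX]
    linarith
  -- With `δ = c / V` the `φ` term costs at most half of `c * X` and is absorbed.
  have h4 := (le_abs_self _).trans (T.abs_integral_inner_le (continuous_polyVec φ)
    (continuous_polyVec g) (δ := c / V) (by positivity))
  simp only [real_inner_comm] at h4
  rw [hid] at h1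
  have h5 : c / V / 2 * T.normSq φ.eval ≤ c * X / 2 := by
    calc c / V / 2 * T.normSq φ.eval ≤ c / V / 2 * (V * X) := by gcongr
      _ = c * X / 2 := by field_simp
  have h6 : c * X / 2 ≤ 1 / (2 * (c / V)) * T.normSq g.eval := by linarith
  calc T.normSq (pgrad p) ≤ V * X := h3
    _ = 2 * V / c * (c * X / 2) := by field_simp
    _ ≤ 2 * V / c * (1 / (2 * (c / V)) * T.normSq g.eval) := by gcongr
    _ = V ^ 2 / c ^ 2 * T.normSq g.eval := by field_simp

/-! ### Control of the weak gradient by the gradient and the jumps -/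

/-- The sum of the squared `L²` norms of the jumps over the faces. -/
def polyJumpSq (p : MvPolynomial (Fin (m + 1)) ℝ)
    (pb : Fin T.numFaces → MvPolynomial (Fin (m + 1)) ℝ) : ℝ :=
  ∑ i, ∫ x in T.face i, (peval p x - peval (pb i) x) ^ 2 ∂(surf (m + 1))

/-- The weak gradient is bounded by the gradient and the jumps. -/
theorem exists_normSq_weakGrad_le (m N R : ℕ) {ρv ρe κ σ τ : ℝ} (hρv : 0 < ρv) :
    ∃ C > 0, ∀ T : Element (m + 1), T.ShapeRegular ρv ρe κ σ τ → T.numFaces = N →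
      ∀ r, r ≤ R → ∀ (p : MvPolynomial (Fin (m + 1)) ℝ)
        (pb : Fin T.numFaces → MvPolynomial (Fin (m + 1)) ℝ) (g : PolyVec (m + 1) r),
        T.Green p pb g →
          T.normSq g.eval ≤ C * (T.normSq (pgrad p) + T.diam⁻¹ * T.polyJumpSq p pb) := by
  obtain ⟨c, hc, H⟩ := exists_lower_bound (m + 1) R 1 hρv
  set V := ballVol m with hV
  have hV0 : 0 < V := ballVol_pos _
  -- Chosen so that Young's inequality with `δ = 2 * A / h` leaves `W / (4 * (N + 1))` per face,
  -- hence at most `W / 4` in total; the volume term costs another `W / 4`.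
  set A := V * (N + 1) / c with hA
  have hA0 : 0 < A := by positivity
  refine ⟨2 + 2 * A, by positivity, ?_⟩
  rintro T hS rfl r hr p pb g hg
  set h := T.diam with hh
  have hh0 : 0 < h := T.diam_pos
  obtain ⟨a, ha⟩ := T.nonempty
  have hTa : closure T.carrier ⊆ Metric.closedBall a h := fun x hx =>
    T.dist_le hx (subset_closure ha)
  set W := T.normSq g.eval with hW
  have hW0 : 0 ≤ W := T.normSq_nonneg _
  -- An inverse inequality: the lower bound with a single factor controls point values up to the
  -- boundary. Integrating over a face gives the trace bound with its factor `h⁻¹`.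
  have hpt : ∀ x ∈ closure T.carrier, c * h ^ (m + 1) * ‖g.eval x‖ ^ 2 ≤ W := by
    intro x hx
    have e : W = ∑ l, ∫ x in T.carrier, (g.eval x l) ^ 2 := by
      rw [← integral_finsetSum (f := fun l x => (g.eval x l) ^ 2) _ fun l _ =>
        T.integrableOn_of_continuous ((g.polyFun l).continuous.pow 2), hW, normSq]
      simp only [norm_sq_eq_sum]
    rw [e, norm_sq_eq_sum, Finset.mul_sum]
    refine Finset.sum_le_sum fun l _ => ?_
    have h1 := H a h hh0 T.carrier (subset_closure.trans hTa) T.isOpen.measurableSet hS.le_volume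
      (Finset.univ : Finset Unit) (by simp) (fun _ x => g.eval x l)
      (fun _ _ => (g.polyFun l).mono hr) (fun _ => x) (fun _ _ => hTa hx)
    simpa using h1
  have hcg : ∀ i, Continuous fun x => ⟪g.eval x, T.normal i⟫ := fun i =>
    (continuous_polyVec g).inner continuous_const
  have hface : ∀ i, ∫ x in T.face i, ⟪g.eval x, T.normal i⟫ ^ 2 ∂(surf (m + 1)) ≤
      V / c * h⁻¹ * W := by
    intro i
    have h1 := T.abs_integral_face_le i (f := fun x => ⟪g.eval x, T.normal i⟫ ^ 2)
      (B := W / (c * h ^ (m + 1))) (by positivity) (by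
        refine ae_restrict_of_forall_mem (T.measurableSet_face i) fun x hx => ?_
        rw [abs_of_nonneg (sq_nonneg _), le_div_iff₀ (by positivity), mul_comm]
        refine le_trans ?_ (hpt x (T.face_subset i hx))
        have := abs_real_inner_le_norm (g.eval x) (T.normal i)
        rw [T.norm_normal, mul_one] at this
        have h2 : ⟪g.eval x, T.normal i⟫ ^ 2 ≤ ‖g.eval x‖ ^ 2 := by
          rw [← sq_abs]
          gcongr
        gcongr)
    refine (le_abs_self _).trans (h1.trans_eq ?_)
    rw [pow_succ, ← hV, ← hh]
    field_simp
  have hcu : ∀ i, Continuous fun x => peval p x - peval (pb i) x := fun i =>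
    (continuous_peval p).sub (continuous_peval (pb i))
  have hterm : ∀ i, |∫ x in T.face i,
      (peval p x - peval (pb i) x) * ⟪g.eval x, T.normal i⟫ ∂(surf (m + 1))| ≤
      A / h * (∫ x in T.face i, (peval p x - peval (pb i) x) ^ 2 ∂(surf (m + 1))) +
        1 / (4 * (T.numFaces + 1)) * W := by
    intro i
    set δ := 2 * A / h with hδ
    have hδ0 : 0 < δ := by positivity
    have i1 := (T.integrableOn_face ((hcu i).pow 2) i).const_mul (δ / 2)
    have i2 := (T.integrableOn_face ((hcg i).pow 2) i).const_mul (1 / (2 * δ))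
    have h1 := norm_integral_le_of_norm_le (μ := (surf (m + 1)).restrict (T.face i))
      (f := fun x => (peval p x - peval (pb i) x) * ⟪g.eval x, T.normal i⟫) (i1.add i2)
      (Filter.Eventually.of_forall fun x => by
        simp only [Pi.add_apply]
        rw [norm_mul, Real.norm_eq_abs, Real.norm_eq_abs]
        have := mul_le_young (a := |peval p x - peval (pb i) x|) (b := |⟪g.eval x, T.normal i⟫|) hδ0
        rwa [sq_abs, sq_abs] at this)
    simp only [Pi.add_apply] at h1
    rw [integral_add i1 i2, integral_const_mul, integral_const_mul] at h1
    simp only [Pi.pow_apply] at h1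
    refine h1.trans (add_le_add (le_of_eq ?_) ?_)
    · congr 1
      rw [hδ]; ring
    · calc _ ≤ 1 / (2 * δ) * (V / c * h⁻¹ * W) := by gcongr; exact hface i
        _ = _ := by rw [hδ, hA]; field_simp; norm_num; ring
  have hmain : W - ∫ x in T.carrier, ⟪pgrad p x, g.eval x⟫ =
      -∑ i, ∫ x in T.face i,
        (peval p x - peval (pb i) x) * ⟪g.eval x, T.normal i⟫ ∂(surf (m + 1)) := by
    rw [← hg g]
    simp only [inner_sub_left]
    rw [integral_sub
      (T.integrableOn_of_continuous ((continuous_polyVec g).inner (continuous_polyVec g)))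
      (T.integrableOn_of_continuous ((continuous_pgrad p).inner (continuous_polyVec g)))]
    simp only [real_inner_self_eq_norm_sq]
    rfl
  have hS1 := (le_abs_self _).trans (T.abs_integral_inner_le (continuous_pgrad p)
    (continuous_polyVec g) (δ := 2) (by norm_num))
  have hS2 : -∑ i, ∫ x in T.face i,
      (peval p x - peval (pb i) x) * ⟪g.eval x, T.normal i⟫ ∂(surf (m + 1)) ≤
      A / h * T.polyJumpSq p pb + 1 / 4 * W := by
    refine (neg_le_abs _).trans ((Finset.abs_sum_le_sum_abs _ _).trans
      ((Finset.sum_le_sum fun i _ => hterm i).trans ?_))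
    rw [Finset.sum_add_distrib, ← Finset.mul_sum, Finset.sum_const, Finset.card_univ,
      Fintype.card_fin, nsmul_eq_mul]
    refine add_le_add le_rfl ?_
    rw [← mul_assoc]
    refine mul_le_mul_of_nonneg_right ?_ hW0
    rw [mul_one_div, div_le_div_iff₀ (by positivity) (by norm_num)]
    linarith
  have hJ0 : 0 ≤ T.polyJumpSq p pb :=
    Finset.sum_nonneg fun i _ => integral_nonneg fun _ => sq_nonneg _
  have hG0 := T.normSq_nonneg (pgrad p)
  have hd : A / h * T.polyJumpSq p pb = A * (h⁻¹ * T.polyJumpSq p pb) := by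
    rw [div_eq_mul_inv]; ring
  have hd0 : 0 ≤ h⁻¹ * T.polyJumpSq p pb := by positivity
  rw [hd] at hS2
  nlinarith [mul_nonneg hA0.le hG0]

/-! ### Control of the jumps by the weak gradient and the gradient -/

variable {m : ℕ} (T : Element (m + 1))

/-- The part of a face on which the cut-off function is bounded below has at least this area, up to
scaling. -/
def areaConst (m : ℕ) (ρe κ τ : ℝ) : ℝ := min (ρe * κ ^ m) (ballVol m * (min τ 1 / 2) ^ m)

lemma areaConst_pos (m : ℕ) {ρe κ τ : ℝ} (hρe : 0 < ρe) (hκ : 0 < κ) (hτ : 0 < τ) :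
    0 < areaConst m ρe κ τ := by
  have h1 := ballVol_pos m
  have h2 : 0 < min τ 1 := lt_min hτ one_pos
  exact lt_min (by positivity) (by positivity)

/-- A polynomial that is bounded below on a part of the face `i` and almost vanishes on the other
faces in the same hyperplane. -/
lemma exists_cutoff (m k N : ℕ) {ρv ρe κ σ τ η : ℝ} (hρe : 0 < ρe) (hκ : 0 < κ) (hτ : 0 < τ)
    (hη : 0 < η) :
    ∃ s : ℕ, ∃ q : ℝ, 0 < q ∧ ∀ T : Element (m + 1), T.ShapeRegular ρv ρe κ σ τ →
      T.numFaces = N → ∀ r, 2 * N + k - 1 ≤ r → (T.HasCoplanarFaces → s ≤ r) →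
      ∀ i, ∃ (Q : E (m + 1) → ℝ) (S : Set (E (m + 1))), S ⊆ T.face i ∧ MeasurableSet S ∧
        (∃ l, PolyFun l Q ∧ 2 * (N - 1) + k + l ≤ r) ∧
        ENNReal.ofReal (areaConst m ρe κ τ * T.diam ^ m) ≤ surf (m + 1) S ∧
        (∀ x ∈ S, q ≤ Q x) ∧ (∀ x ∈ closure T.carrier, 0 ≤ Q x ∧ Q x ≤ 1) ∧
        ∀ j ∈ T.coplanar i, j ≠ i →
          ∀ᵐ x ∂(surf (m + 1)).restrict (T.face j), Q x ≤ η * q := by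
  set t := min τ 1 with ht
  have ht0 : 0 < t := lt_min hτ one_pos
  have ht1 : t ≤ 1 := min_le_right _ _
  set A := 1 - t ^ 2 / 4 with hA
  set B := 1 - t ^ 2 with hB
  have hA0 : 0 < A := by rw [hA]; nlinarith
  have hA1 : A ≤ 1 := by rw [hA]; nlinarith
  have hB0 : 0 ≤ B := by rw [hB]; nlinarith
  have hBA : B < A := by rw [hA, hB]; nlinarith
  -- The bump `1 - (dist x x₀ / h) ^ 2` is at least `A` within distance `t h / 2` of `x₀` and at
  -- most `B` beyond distance `t h`; a high power makes the ratio smaller than `η`.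
  obtain ⟨e, he⟩ := exists_pow_lt_of_lt_one hη ((div_lt_one hA0).2 hBA)
  have hBAe : B ^ e ≤ η * A ^ e := by
    rw [div_pow, div_lt_iff₀ (by positivity)] at he
    exact he.le
  refine ⟨2 * N + k + 2 * e, A ^ e, by positivity, ?_⟩
  rintro T hS rfl r hr hs i
  set h := T.diam with hh
  have hh0 : 0 < h := T.diam_pos
  have hi := i.pos
  by_cases hcop : ∃ j, j ∈ T.coplanar i ∧ j ≠ i
  · obtain ⟨j, hj, hji⟩ := hcop
    have hsr := hs ⟨i, j, hji.symm, mem_coplanar.1 hj⟩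
    obtain ⟨x₀, hx₀, hdisc⟩ : ∃ x ∈ T.face i,
        Metric.closedBall x (τ * T.diam) ∩ T.plane i ⊆ T.face i := by
      -- For coplanar faces the first alternative is impossible, since face `i` lies in the
      -- hyperplane of `j`. So face `i` contains a disc, which the other coplanar faces avoid up to
      -- a null set.
      rcases hS.separated i j hji.symm with ⟨x, hx, hlev⟩ | ⟨-, h⟩
      · have h1 : T.lev j x = 0 := by
          rw [← mem_plane_iff, ← mem_coplanar.1 hj]
          exact T.face_subset_plane i hx
        have h2 : τ * T.diam ≤ |T.lev j x| := hlev
        rw [h1, abs_zero] at h2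
        have := mul_pos hτ T.diam_pos
        linarith
      · exact h
    have htτ : t * h ≤ τ * h := mul_le_mul_of_nonneg_right (min_le_left _ _) hh0.le
    have hplm : MeasurableSet (T.plane i) :=
      (isClosed_eq (continuous_const.inner continuous_id) continuous_const).measurableSet
    have hQp : PolyFun 2 fun x : E (m + 1) => 1 - h⁻¹ ^ 2 * ‖x - x₀‖ ^ 2 :=
      (PolyFun.const 1).sub ((PolyFun.dist_sq x₀).const_mul _)
    have hval : ∀ x, 1 - h⁻¹ ^ 2 * ‖x - x₀‖ ^ 2 = 1 - (dist x x₀ / h) ^ 2 := fun x => by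
      rw [dist_eq_norm, div_pow, inv_pow, div_eq_inv_mul]
    refine ⟨fun x => (1 - h⁻¹ ^ 2 * ‖x - x₀‖ ^ 2) ^ e,
      Metric.closedBall x₀ (t / 2 * h) ∩ T.plane i, ?_, ?_, ⟨_, hQp.pow e, by omega⟩, ?_, ?_, ?_, ?_⟩
    · refine fun x hx => hdisc ⟨Metric.closedBall_subset_closedBall ?_ hx.1, hx.2⟩
      rw [← hh]
      nlinarith [mul_pos ht0 hh0]
    · exact measurableSet_closedBall.inter hplm
    · obtain ⟨χ⟩ := nonempty_planeChart (T.norm_normal i)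
      obtain ⟨z, rfl⟩ : x₀ ∈ range (χ.pt (T.offset i)) := by
        rw [χ.range_pt _ (T.norm_normal i)]
        exact T.face_subset_plane i hx₀
      rw [χ.surf_eq (T.offset i) (T.norm_normal i) (fun x hx => hx.2)
        (measurableSet_closedBall.inter hplm)]
      have : χ.pt (T.offset i) ⁻¹' (Metric.closedBall (χ.pt (T.offset i) z) (t / 2 * h) ∩
          T.plane i) = Metric.closedBall z (t / 2 * h) := by
        ext w
        have hw : χ.pt (T.offset i) w ∈ T.plane i := χ.inner_pt _ (T.norm_normal i) w
        simp only [mem_preimage, mem_inter_iff, hw, and_true, Metric.mem_closedBall,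
          (χ.isometry_pt (T.offset i)).dist_eq]
      rw [this, volume_closedBall z (by positivity)]
      apply ENNReal.ofReal_le_ofReal
      rw [mul_pow, ← mul_assoc]
      exact mul_le_mul_of_nonneg_right (min_le_right _ _) (by positivity)
    · intro x hx
      have h1 : dist x x₀ / h ≤ t / 2 := (div_le_iff₀ hh0).2 hx.1
      have h2 : 0 ≤ dist x x₀ / h := by positivity
      simp only [hval]
      have h3 : A ≤ 1 - (dist x x₀ / h) ^ 2 := by rw [hA]; nlinarith
      gcongr
    · intro x hx
      have h1 : dist x x₀ / h ≤ 1 := (div_le_one hh0).2 (T.dist_le hx (T.face_subset i hx₀))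
      have h2 : 0 ≤ dist x x₀ / h := by positivity
      have h3 : 0 ≤ 1 - (dist x x₀ / h) ^ 2 := by nlinarith
      simp only [hval]
      exact ⟨pow_nonneg h3 _, pow_le_one₀ h3 (by nlinarith)⟩
    · intro j hj hji
      have hov := T.face_overlap j i hji
      rw [ae_restrict_iff' (T.measurableSet_face j)]
      have hov' : ∀ᵐ x ∂(surf (m + 1)), x ∉ T.face j ∩ T.face i := measure_eq_zero_iff_ae_notMem.1 hov
      filter_upwards [hov'] with x hx hxj
      have hxp : x ∈ T.plane i := mem_coplanar.1 hj ▸ T.face_subset_plane j hxj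
      have hd : τ * h < dist x x₀ := by
        by_contra hle
        exact hx ⟨hxj, hdisc ⟨not_lt.1 hle, hxp⟩⟩
      have h1 : t ≤ dist x x₀ / h := (le_div_iff₀ hh0).2 (htτ.trans hd.le)
      have h4 : dist x x₀ / h ≤ 1 :=
        (div_le_one hh0).2 (T.dist_le (T.face_subset j hxj) (T.face_subset i hx₀))
      have h3 : 0 ≤ 1 - (dist x x₀ / h) ^ 2 := by nlinarith
      simp only [hval]
      refine le_trans ?_ hBAe
      have h5 : 1 - (dist x x₀ / h) ^ 2 ≤ B := by rw [hB]; nlinarith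
      gcongr
  · push Not at hcop
    -- Without coplanar companions no cut-off is needed, and the basic degree bound suffices.
    refine ⟨fun _ => 1, T.face i, subset_rfl, T.measurableSet_face i,
      ⟨0, PolyFun.const 1, by omega⟩, ?_, fun _ _ => pow_le_one₀ hA0.le hA1, fun _ _ => by simp,
      fun j hj hji => (hji (hcop j hj)).elim⟩
    refine le_trans (ENNReal.ofReal_le_ofReal ?_) (hS.le_surf hρe hκ i)
    exact mul_le_mul_of_nonneg_right (min_le_left _ _) (by positivity)

/-- The orthogonal projection onto the hyperplane of the face `i`. -/
def proj (i : Fin T.numFaces) (x : E (m + 1)) : E (m + 1) := x - T.lev i x • T.normal i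

lemma proj_eq {i : Fin T.numFaces} {x : E (m + 1)} (hx : T.lev i x = 0) : T.proj i x = x := by
  simp [proj, hx]

lemma lev_proj (i : Fin T.numFaces) (x : E (m + 1)) : T.lev i (T.proj i x) = 0 := by
  rw [proj, sub_eq_add_neg, ← neg_smul, T.lev_add_smul, real_inner_self_eq_norm_sq, T.norm_normal]
  ring

/-- By Pythagoras. It keeps the projection of the whole element in the disc on which the jump is
maximised. -/
lemma dist_proj_le {i : Fin T.numFaces} {a : E (m + 1)} (ha : T.lev i a = 0) (x : E (m + 1)) :
    dist (T.proj i x) a ≤ dist x a := by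
  have h1 : ⟪T.normal i, x - a⟫ = T.lev i x := by
    rw [inner_sub_right]
    simp only [lev] at ha ⊢
    linarith
  have h2 : T.proj i x - a = (x - a) - T.lev i x • T.normal i := by rw [proj]; abel
  rw [dist_eq_norm, dist_eq_norm, h2, ← sq_le_sq₀ (norm_nonneg _) (norm_nonneg _),
    norm_sub_sq_real, real_inner_smul_right, real_inner_comm, h1, norm_smul, T.norm_normal, mul_one,
    Real.norm_eq_abs, sq_abs]
  nlinarith [sq_nonneg (T.lev i x)]

lemma polyFun_lev (i : Fin T.numFaces) : PolyFun 1 (T.lev i) :=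
  (PolyFun.inner_left (T.normal i)).sub (PolyFun.const (T.offset i))

lemma polyFun_comp_proj {l : ℕ} (i : Fin T.numFaces) {f : E (m + 1) → ℝ} (hf : PolyFun l f) :
    PolyFun l fun x => f (T.proj i x) := by
  refine hf.comp fun l => ?_
  have := (PolyFun.coord l).sub ((T.polyFun_lev i).const_mul (T.normal i l))
  simpa [proj, mul_comm] using this

/-- The largest value of a polynomial on a disc around a point of a face hyperplane. -/
lemma exists_face_max {l : ℕ} {f : E (m + 1) → ℝ} (hf : PolyFun l f) {i : Fin T.numFaces}
    {a : E (m + 1)} (ha : T.lev i a = 0) {h : ℝ} (hh : 0 ≤ h) :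
    ∃ b, T.lev i b = 0 ∧ dist b a ≤ h ∧ ∀ x, T.lev i x = 0 → dist x a ≤ h → |f x| ≤ |f b| := by
  have hc : IsCompact (Metric.closedBall a h ∩ T.plane i) :=
    (isCompact_closedBall a h).inter_right
      (isClosed_eq (continuous_const.inner continuous_id) continuous_const)
  obtain ⟨b, hb, hmax⟩ := hc.exists_isMaxOn
    ⟨a, Metric.mem_closedBall_self hh, T.mem_plane_iff.2 ha⟩ hf.continuous.abs.continuousOn
  exact ⟨b, T.mem_plane_iff.1 hb.2, hb.1, fun x hx hxa => hmax ⟨hxa, T.mem_plane_iff.2 hx⟩⟩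

/-- The surface version of `exists_lower_bound`. -/
lemma exists_face_lower_bound (m l N : ℕ) {ρ : ℝ} (hρ : 0 < ρ) :
    ∃ c > 0, ∀ (T : Element (m + 1)) (i : Fin T.numFaces) (a : E (m + 1)), T.lev i a = 0 →
      ∀ h : ℝ, 0 < h → ∀ S ⊆ T.plane i, S ⊆ Metric.closedBall a h → MeasurableSet S →
      ENNReal.ofReal (ρ * h ^ m) ≤ surf (m + 1) S →
      ∀ {ι : Type} (J : Finset ι), J.card ≤ N → ∀ f : ι → E (m + 1) → ℝ,
      (∀ j ∈ J, PolyFun l (f j)) → ∀ y : ι → E (m + 1),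
      (∀ j ∈ J, T.lev i (y j) = 0 ∧ dist (y j) a ≤ h) →
      c * h ^ m * ∏ j ∈ J, (f j (y j)) ^ 2 ≤ ∫ x in S, ∏ j ∈ J, (f j x) ^ 2 ∂(surf (m + 1)) := by
  obtain ⟨c, hc, H⟩ := exists_lower_bound m l N hρ
  refine ⟨c, hc, fun T i a ha h hh S hSp hSB hSm hSv ι J hJ f hf y hy => ?_⟩
  obtain ⟨χ⟩ := nonempty_planeChart (T.norm_normal i)
  set ψ := χ.pt (T.offset i) with hψ
  have hsurj : ∀ x, T.lev i x = 0 → ψ (Function.invFun ψ x) = x := fun x hx => by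
    apply Function.invFun_eq
    have : x ∈ range ψ := by
      rw [hψ, χ.range_pt _ (T.norm_normal i)]
      exact T.mem_plane_iff.2 hx
    exact this
  rw [χ.surf_eq (T.offset i) (T.norm_normal i) hSp hSm] at hSv
  rw [χ.setIntegral_surf (T.offset i) (T.norm_normal i) hSp hSm]
  have h1 := H (Function.invFun ψ a) h hh (ψ ⁻¹' S) (fun z hz => by
      rw [Metric.mem_closedBall, ← (χ.isometry_pt (T.offset i)).dist_eq, ← hψ, hsurj a ha]
      exact hSB hz) ((χ.continuous_pt _).measurable hSm) hSv J hJ (fun j z => f j (ψ z))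
    (fun j hj => χ.polyFun_comp_pt _ (hf j hj)) (fun j => Function.invFun ψ (y j)) (fun j hj => by
      rw [Metric.mem_closedBall, ← (χ.isometry_pt (T.offset i)).dist_eq, ← hψ, hsurj a ha,
        hsurj _ (hy j hj).1]
      exact (hy j hj).2)
  refine le_trans (le_of_eq ?_) h1
  congr 1
  exact Finset.prod_congr rfl fun j hj => by rw [hsurj _ (hy j hj).1]

/-- The jumps are bounded by the weak gradient and the gradient. -/
theorem exists_jump_le (m k N : ℕ) {ρv ρe κ σ τ : ℝ} (hρe : 0 < ρe) (hκ : 0 < κ) (hτ : 0 < τ) :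
    ∃ s : ℕ, ∃ C > 0, ∀ T : Element (m + 1), T.ShapeRegular ρv ρe κ σ τ → T.numFaces = N →
      ∀ r, 2 * N + k - 1 ≤ r → (T.HasCoplanarFaces → s ≤ r) →
      ∀ (p : MvPolynomial (Fin (m + 1)) ℝ)
        (pb : Fin T.numFaces → MvPolynomial (Fin (m + 1)) ℝ) (g : PolyVec (m + 1) r),
        p.totalDegree ≤ k → (∀ i, (pb i).totalDegree ≤ k) → T.Green p pb g →
          T.diam⁻¹ * T.polyJumpSq p pb ≤ C * (T.normSq g.eval + T.normSq (pgrad p)) := by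
  obtain ⟨c, hc, H⟩ := exists_face_lower_bound m (max k 1) (N + 1) (areaConst_pos m hρe hκ hτ)
  set t := min τ 1 with ht
  have ht0 : 0 < t := lt_min hτ one_pos
  have ht1 : t ≤ 1 := min_le_right _ _
  set c' := c * t ^ (2 * N) with hc'
  have hc'0 : 0 < c' := by positivity
  set V := ballVol m with hV
  have hV0 : 0 < V := ballVol_pos _
  set V' := ballVol (m + 1) with hV'
  have hV'0 : 0 < V' := ballVol_pos _
  -- With this tolerance the other coplanar faces together cost at most half of the contribution of
  -- face `i`.
  set η := c' / (2 * (N + 1) * V) with hη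
  have hη0 : 0 < η := by positivity
  obtain ⟨s, q, hq, HQ⟩ := exists_cutoff m k N (ρv := ρv) (σ := σ) hρe hκ hτ hη0
  refine ⟨s, (N + 1) * V * (8 * V' / (q * c') ^ 2), by positivity, ?_⟩
  rintro T hS rfl r hr hs p pb g hp hpb hg
  set h := T.diam with hh
  have hh0 : 0 < h := T.diam_pos
  have hGW : 0 ≤ T.normSq g.eval + T.normSq (pgrad p) :=
    add_nonneg (T.normSq_nonneg _) (T.normSq_nonneg _)
  rcases isEmpty_or_nonempty (Fin T.numFaces) with hemp | hnon
  · have : T.polyJumpSq p pb = 0 := by simp [polyJumpSq]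
    rw [this, mul_zero]
    positivity
  choose a ha using fun i => hS.face_nonempty hρe hκ i
  let u : Fin T.numFaces → E (m + 1) → ℝ := fun i x => peval p x - peval (pb i) x
  have hu : ∀ i, PolyFun k (u i) := fun i =>
    PolyFun.sub ⟨p, hp, fun _ => rfl⟩ ⟨pb i, hpb i, fun _ => rfl⟩
  -- Maximising over a disc of radius `h` in the hyperplane, rather than over the face, also bounds
  -- the jump polynomial at projections of points of the element.
  choose b hb hba hbmax using fun i => T.exists_face_max (hu i) (T.lev_eq_zero (ha i)) hh0.le
  obtain ⟨i, hi⟩ := Finite.exists_max fun i => |u i (b i)|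
  set M := |u i (b i)| with hM
  have hM0 : 0 ≤ M := abs_nonneg _
  have huM : ∀ j, ∀ x ∈ T.face j, |u j x| ≤ M := fun j x hx =>
    (hbmax j x (T.lev_eq_zero hx) (T.dist_le (T.face_subset j hx) (T.face_subset j (ha j)))).trans
      (hi j)
  set Y := h ^ m * M ^ 2 with hY
  have hY0 : 0 ≤ Y := by positivity
  have hJ : T.polyJumpSq p pb ≤ (T.numFaces + 1) * V * Y := by
    have h1 : T.polyJumpSq p pb ≤ ∑ _i : Fin T.numFaces, M ^ 2 * (V * h ^ m) := by
      refine Finset.sum_le_sum fun j _ => (le_abs_self _).trans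
        (T.abs_integral_face_le j (by positivity) ?_)
      refine ae_restrict_of_forall_mem (T.measurableSet_face j) fun x hx => ?_
      rw [abs_of_nonneg (sq_nonneg _), ← sq_abs]
      exact pow_le_pow_left₀ (abs_nonneg _) (huM j x hx) 2
    rw [Finset.sum_const, Finset.card_univ, Fintype.card_fin, nsmul_eq_mul] at h1
    have h2 : (T.numFaces : ℝ) * (M ^ 2 * (V * h ^ m)) = T.numFaces * V * Y := by rw [hY]; ring
    rw [h2] at h1
    have : 0 ≤ V * Y := by positivity
    linarith
  obtain ⟨Q, S, hSi, hSm, ⟨l, hQl, hlr⟩, hSv, hQS, hQ01, hQcop⟩ := HQ T hS rfl r hr hs i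
  let K := T.coplanar i
  let Kc : Finset (Fin T.numFaces) := Kᶜ
  have hKc : Kc.card ≤ T.numFaces - 1 := by
    have h1 : 0 < K.card := Finset.card_pos.2 ⟨i, self_mem_coplanar⟩
    have h2 : Kc.card = T.numFaces - K.card := by
      rw [Finset.card_compl, Fintype.card_fin]
    omega
  have hlp : ∀ j, PolyFun 1 fun x => T.lev j x / h := fun j => by
    simpa [div_eq_inv_mul] using (T.polyFun_lev j).const_mul h⁻¹
  let L : E (m + 1) → ℝ := fun x => ∏ j ∈ Kc, (T.lev j x / h) ^ 2
  have hL : PolyFun (Kc.card * (2 * 1)) L := PolyFun.prod Kc fun j _ => (hlp j).pow 2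
  have hL01 : ∀ x ∈ closure T.carrier, 0 ≤ L x ∧ L x ≤ 1 := fun x hx => by
    refine ⟨Finset.prod_nonneg fun _ _ => sq_nonneg _, Finset.prod_le_one (fun _ _ => sq_nonneg _)
      fun j _ => ?_⟩
    rw [sq_le_one_iff_abs_le_one, abs_div, abs_of_pos hh0, div_le_one hh0]
    exact T.abs_lev_le (hS.face_nonempty hρe hκ j) hx
  -- Composing with the projection makes the test field depend only on the values of `pb i` in the
  -- hyperplane, keeps it bounded by `M` on the element, and does not raise the degree.
  let w : E (m + 1) → ℝ := fun x => u i (T.proj i x)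
  have hw : PolyFun k w := T.polyFun_comp_proj i (hu i)
  have hwM : ∀ x ∈ closure T.carrier, |w x| ≤ M := fun x hx =>
    hbmax i _ (T.lev_proj i x) ((T.dist_proj_le (T.lev_eq_zero (ha i)) x).trans
      (T.dist_le hx (T.face_subset i (ha i))))
  have hwu : ∀ x ∈ T.face i, w x = u i x := fun x hx => by
    simp only [w, T.proj_eq (T.lev_eq_zero hx)]
  let f : E (m + 1) → ℝ := fun x => w x * L x * Q x
  have hf : PolyFun r f := ((hw.mul hL).mul hQl).mono (by omega)
  have hfM : ∀ x ∈ closure T.carrier, |f x| ≤ M * Q x := fun x hx => by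
    obtain ⟨h1, h2⟩ := hL01 x hx
    obtain ⟨h3, h4⟩ := hQ01 x hx
    simp only [f]
    rw [abs_mul, abs_mul, abs_of_nonneg h1, abs_of_nonneg h3]
    have := mul_le_mul (hwM x hx) h2 h1 hM0
    rw [mul_one] at this
    gcongr
  obtain ⟨φ, hφ⟩ := exists_polyVec (r := r) (F := fun l x => f x * T.normal i l) fun l =>
    (hf.mul (PolyFun.const (m := 0) (T.normal i l)))
  have hφ' : ∀ x, φ.eval x = f x • T.normal i := fun x => by
    rw [hφ]
    ext l
    simp
  have hcu : ∀ j, Continuous (u j) := fun j => (hu j).continuous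
  -- the contributions of the faces
  have hoff : ∀ j ∉ K, ∫ x in T.face j, u j x * ⟪φ.eval x, T.normal j⟫ ∂(surf (m + 1)) = 0 := by
    intro j hj
    refine setIntegral_eq_zero_of_forall_eq_zero fun x hx => ?_
    have : L x = 0 := Finset.prod_eq_zero (Finset.mem_compl.2 hj) (by
      rw [T.lev_eq_zero hx]; simp)
    rw [hφ']
    simp [f, this]
  have hcop : ∀ j ∈ K.erase i,
      |∫ x in T.face j, u j x * ⟪φ.eval x, T.normal j⟫ ∂(surf (m + 1))| ≤ η * q * V * Y := by
    intro j hj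
    obtain ⟨hji, hjK⟩ := Finset.mem_erase.1 hj
    refine (T.abs_integral_face_le j (B := M * (M * (η * q))) (by positivity) ?_).trans_eq ?_
    · filter_upwards [hQcop j hjK hji, ae_restrict_mem (T.measurableSet_face j)] with x hx hxj
      have hn : |⟪T.normal i, T.normal j⟫| ≤ 1 := by
        have := abs_real_inner_le_norm (T.normal i) (T.normal j)
        rwa [T.norm_normal, T.norm_normal, mul_one] at this
      rw [hφ', real_inner_smul_left, abs_mul, abs_mul]
      have h1 := (hfM x (T.face_subset j hxj)).trans (mul_le_mul_of_nonneg_left hx hM0)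
      have h2 := mul_le_mul h1 hn (abs_nonneg _) (by positivity)
      rw [mul_one] at h2
      exact mul_le_mul (huM j x hxj) h2 (by positivity) hM0
    · rw [hY]; ring
  have hself : q * c' * Y ≤
      ∫ x in T.face i, u i x * ⟪φ.eval x, T.normal i⟫ ∂(surf (m + 1)) := by
    -- Separation supplies, for each non-coplanar face, a point of face `i` far from its hyperplane,
    -- so the factors of `L` are not uniformly small on face `i`.
    have hy : ∀ j, ∃ y, j ∈ Kc → y ∈ T.face i ∧ t ^ 2 ≤ (T.lev j y / h) ^ 2 := by
      intro j
      by_cases hj : j ∈ Kc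
      · have hjK : j ∉ K := Finset.mem_compl.1 hj
        have hij : i ≠ j := fun h => hjK (h ▸ self_mem_coplanar)
        rcases hS.separated i j hij with ⟨x, hx, hlev⟩ | ⟨hpl, -⟩
        · refine ⟨x, fun _ => ⟨hx, ?_⟩⟩
          rw [sq_le_sq, abs_of_pos ht0, abs_div, abs_of_pos hh0, le_div_iff₀ hh0]
          exact (mul_le_mul_of_nonneg_right (min_le_left _ _) hh0.le).trans hlev
        · exact (hjK (mem_coplanar.2 hpl)).elim
      · exact ⟨0, fun h => (hj h).elim⟩
    choose y hy using hy
    have h1 := H T i (a i) (T.lev_eq_zero (ha i)) h hh0 S (hSi.trans (T.face_subset_plane i))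
      (fun x hx => T.dist_le (T.face_subset i (hSi hx)) (T.face_subset i (ha i))) hSm hSv
      (Finset.insertNone Kc) (by rw [Finset.card_insertNone]; omega)
      (fun j => Option.elim j (u i) fun j x => T.lev j x / h)
      (fun j _ => by
        cases j with
        | none => exact (hu i).mono (le_max_left _ _)
        | some j => exact (hlp j).mono (le_max_right _ _))
      (fun j => Option.elim j (b i) y)
      (fun j hj => by
        cases j with
        | none => exact ⟨hb i, hba i⟩
        | some j =>
          have hyj := (hy j (by simpa using hj)).1
          exact ⟨T.lev_eq_zero hyj, T.dist_le (T.face_subset i hyj) (T.face_subset i (ha i))⟩)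
    simp only [Finset.prod_insertNone, Option.elim_none, Option.elim_some] at h1
    have h2 : t ^ (2 * T.numFaces) ≤ ∏ j ∈ Kc, (T.lev j (y j) / h) ^ 2 := by
      calc t ^ (2 * T.numFaces) ≤ t ^ (2 * Kc.card) :=
            pow_le_pow_of_le_one ht0.le ht1 (by omega)
        _ = ∏ _j ∈ Kc, t ^ 2 := by rw [Finset.prod_const, ← pow_mul]
        _ ≤ _ := Finset.prod_le_prod (fun _ _ => sq_nonneg _) fun j hj => (hy j hj).2
    have h3 : c' * Y ≤ ∫ x in S, u i x ^ 2 * L x ∂(surf (m + 1)) := by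
      refine le_trans ?_ h1
      rw [hc', hY, hM, sq_abs]
      calc c * t ^ (2 * T.numFaces) * (h ^ m * u i (b i) ^ 2)
          = c * h ^ m * (u i (b i) ^ 2 * t ^ (2 * T.numFaces)) := by ring
        _ ≤ _ := by gcongr
    have hcL : Continuous fun x => u i x ^ 2 * L x := ((hcu i).pow 2).mul hL.continuous
    have hcLQ : Continuous fun x => u i x ^ 2 * L x * Q x := hcL.mul hQl.continuous
    have e : ∫ x in T.face i, u i x * ⟪φ.eval x, T.normal i⟫ ∂(surf (m + 1)) =
        ∫ x in T.face i, u i x ^ 2 * L x * Q x ∂(surf (m + 1)) := by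
      refine setIntegral_congr_fun (T.measurableSet_face i) fun x hx => ?_
      rw [hφ', real_inner_smul_left, real_inner_self_eq_norm_sq, T.norm_normal]
      simp only [f, hwu x hx]
      ring
    rw [e]
    calc q * c' * Y ≤ q * ∫ x in S, u i x ^ 2 * L x ∂(surf (m + 1)) := by
          rw [mul_assoc]; gcongr
      _ = ∫ x in S, q * (u i x ^ 2 * L x) ∂(surf (m + 1)) := (integral_const_mul _ _).symm
      _ ≤ ∫ x in S, u i x ^ 2 * L x * Q x ∂(surf (m + 1)) := by
          refine setIntegral_mono_on (((T.integrableOn_face hcL i).mono_set hSi).const_mul q)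
            ((T.integrableOn_face hcLQ i).mono_set hSi) hSm fun x hx => ?_
          rw [mul_comm]
          refine mul_le_mul_of_nonneg_left (hQS x hx) (mul_nonneg (sq_nonneg _) ?_)
          exact (hL01 x (T.face_subset i (hSi hx))).1
      _ ≤ ∫ x in T.face i, u i x ^ 2 * L x * Q x ∂(surf (m + 1)) := by
          refine setIntegral_mono_set (T.integrableOn_face hcLQ i) ?_
            (Filter.Eventually.of_forall hSi)
          refine ae_restrict_of_forall_mem (T.measurableSet_face i) fun x hx => ?_
          have hx' := T.face_subset i hx
          exact mul_nonneg (mul_nonneg (sq_nonneg _) (hL01 x hx').1) (hQ01 x hx').1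
  have hsum : ∑ j, ∫ x in T.face j, u j x * ⟪φ.eval x, T.normal j⟫ ∂(surf (m + 1)) =
      (∑ j ∈ K.erase i, ∫ x in T.face j, u j x * ⟪φ.eval x, T.normal j⟫ ∂(surf (m + 1))) +
        ∫ x in T.face i, u i x * ⟪φ.eval x, T.normal i⟫ ∂(surf (m + 1)) := by
    rw [← Finset.sum_subset (Finset.subset_univ K) fun j _ hj => hoff j hj]
    exact (Finset.sum_erase_add _ _ self_mem_coplanar).symm
  have hcopsum : |∑ j ∈ K.erase i,
      ∫ x in T.face j, u j x * ⟪φ.eval x, T.normal j⟫ ∂(surf (m + 1))| ≤ q * c' / 2 * Y := by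
    refine (Finset.abs_sum_le_sum_abs _ _).trans ((Finset.sum_le_sum hcop).trans ?_)
    rw [Finset.sum_const, nsmul_eq_mul]
    have hcard : ((K.erase i).card : ℝ) ≤ T.numFaces + 1 := by
      have : (K.erase i).card ≤ T.numFaces := by
        simpa using Finset.card_le_univ (K.erase i)
      have : ((K.erase i).card : ℝ) ≤ T.numFaces := by exact_mod_cast this
      linarith
    calc ((K.erase i).card : ℝ) * (η * q * V * Y) ≤ (T.numFaces + 1) * (η * q * V * Y) := by gcongr
      _ = q * c' / 2 * Y := by rw [hη]; field_simp
  have hgreen := hg φ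
  change _ = -∑ j, ∫ x in T.face j, u j x * ⟪φ.eval x, T.normal j⟫ ∂(surf (m + 1)) at hgreen
  rw [hsum] at hgreen
  have hcgp : Continuous fun x => g.eval x - pgrad p x :=
    (continuous_polyVec g).sub (continuous_pgrad p)
  -- The boundary sum is at least `q * c' / 2 * Y`; this `δ` makes the `φ` term cost at most half of
  -- that.
  set δ := q * c' / (2 * V') with hδ
  have hδ0 : 0 < δ := by positivity
  have hyoung := T.abs_integral_inner_le (continuous_polyVec φ) hcgp (δ := δ / h) (by positivity)
  have hsw : ∀ x, ⟪φ.eval x, g.eval x - pgrad p x⟫ = ⟪g.eval x - pgrad p x, φ.eval x⟫ :=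
    fun x => real_inner_comm _ _
  simp only [hsw] at hyoung
  have hφn : T.normSq φ.eval ≤ V' * h * Y := by
    have h1 : T.normSq φ.eval ≤ M ^ 2 * (V' * h ^ (m + 1)) := by
      refine T.integral_carrier_le (by positivity) fun x hx => ?_
      have hx' := subset_closure hx
      rw [abs_of_nonneg (by positivity), hφ', norm_smul, T.norm_normal, mul_one, Real.norm_eq_abs]
      refine pow_le_pow_left₀ (abs_nonneg _) ((hfM x hx').trans ?_) 2
      exact mul_le_of_le_one_right hM0 (hQ01 x hx').2
    refine h1.trans_eq ?_
    rw [hY, pow_succ]; ring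
  have hdiff : T.normSq (fun x => g.eval x - pgrad p x) ≤
      2 * (T.normSq g.eval + T.normSq (pgrad p)) := by
    have i1 := T.integrableOn_of_continuous ((continuous_polyVec g).norm.pow 2)
    have i2 := T.integrableOn_of_continuous ((continuous_pgrad p).norm.pow 2)
    have h1 : T.normSq g.eval + T.normSq (pgrad p) =
        ∫ x in T.carrier, (‖g.eval x‖ ^ 2 + ‖pgrad p x‖ ^ 2) := (integral_add i1 i2).symm
    rw [h1, ← integral_const_mul]
    refine integral_mono (T.integrableOn_of_continuous (hcgp.norm.pow 2)) ((i1.add i2).const_mul 2)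
      fun x => ?_
    have h2 := norm_sub_le (g.eval x) (pgrad p x)
    have h3 : ‖g.eval x - pgrad p x‖ ^ 2 ≤ (‖g.eval x‖ + ‖pgrad p x‖) ^ 2 := by gcongr
    change ‖g.eval x - pgrad p x‖ ^ 2 ≤ 2 * (‖g.eval x‖ ^ 2 + ‖pgrad p x‖ ^ 2)
    nlinarith [sq_nonneg (‖g.eval x‖ - ‖pgrad p x‖)]
  have e1 : δ / h / 2 * T.normSq φ.eval ≤ q * c' / 4 * Y := by
    calc δ / h / 2 * T.normSq φ.eval ≤ δ / h / 2 * (V' * h * Y) := by gcongr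
      _ = q * c' / 4 * Y := by rw [hδ]; field_simp; norm_num; ring
  have e2 : 1 / (2 * (δ / h)) * T.normSq (fun x => g.eval x - pgrad p x) ≤
      2 * V' / (q * c') * h * (T.normSq g.eval + T.normSq (pgrad p)) := by
    calc _ ≤ 1 / (2 * (δ / h)) * (2 * (T.normSq g.eval + T.normSq (pgrad p))) := by gcongr
      _ = _ := by rw [hδ]; field_simp
  have hYle : q * c' / 4 * Y ≤
      2 * V' / (q * c') * h * (T.normSq g.eval + T.normSq (pgrad p)) := by
    have h1 := (abs_le.1 hyoung).1
    have h2 := (abs_le.1 hcopsum).1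
    linarith
  calc h⁻¹ * T.polyJumpSq p pb ≤ h⁻¹ * ((T.numFaces + 1) * V * Y) := by gcongr
    _ = h⁻¹ * (T.numFaces + 1) * V * (4 / (q * c')) * (q * c' / 4 * Y) := by field_simp
    _ ≤ h⁻¹ * (T.numFaces + 1) * V * (4 / (q * c')) *
        (2 * V' / (q * c') * h * (T.normSq g.eval + T.normSq (pgrad p))) := by gcongr
    _ = _ := by field_simp; norm_num; ring

/-! ### Assembly over the elements -/

/-- All estimates on one element. -/
theorem exists_element_bounds (m k N : ℕ) {ρv ρe κ σ τ : ℝ} (hρv : 0 < ρv) (hρe : 0 < ρe)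
    (hκ : 0 < κ) (hτ : 0 < τ) :
    ∃ s : ℕ, ∀ R : ℕ, ∃ C > 0, ∀ T : Element (m + 1), T.ShapeRegular ρv ρe κ σ τ →
      T.numFaces = N → ∀ r, 2 * N + k - 1 ≤ r → r ≤ R → (T.HasCoplanarFaces → s ≤ r) →
      ∀ (p : MvPolynomial (Fin (m + 1)) ℝ)
        (pb : Fin T.numFaces → MvPolynomial (Fin (m + 1)) ℝ) (g : PolyVec (m + 1) r),
        p.totalDegree ≤ k → (∀ i, (pb i).totalDegree ≤ k) → T.Green p pb g →
          T.normSq (pgrad p) ≤ C * T.normSq g.eval ∧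
          T.diam⁻¹ * T.polyJumpSq p pb ≤ C * T.normSq g.eval ∧
          T.normSq g.eval ≤ C * (T.normSq (pgrad p) + T.diam⁻¹ * T.polyJumpSq p pb) := by
  obtain ⟨C₁, hC₁, H₁⟩ := exists_normSq_pgrad_le m k N (σ := σ) (τ := τ) hρv hρe hκ
  obtain ⟨s, C₂, hC₂, H₂⟩ := exists_jump_le m k N (ρv := ρv) (σ := σ) hρe hκ hτ
  refine ⟨s, fun R => ?_⟩
  obtain ⟨C₃, hC₃, H₃⟩ := exists_normSq_weakGrad_le m N R (ρe := ρe) (κ := κ) (σ := σ) (τ := τ) hρv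
  refine ⟨C₁ + C₂ * (1 + C₁) + C₃, by positivity, ?_⟩
  intro T hS hN r hr hrR hs p pb g hp hpb hg
  have h1 := H₁ T hS hN r hr p pb g hp hg
  have h2 := H₂ T hS hN r hr hs p pb g hp hpb hg
  have h3 := H₃ T hS hN r hrR p pb g hg
  have hW := T.normSq_nonneg g.eval
  have hG := T.normSq_nonneg (pgrad p)
  have hJ : 0 ≤ T.diam⁻¹ * T.polyJumpSq p pb :=
    mul_nonneg (inv_nonneg.2 T.diam_pos.le)
      (Finset.sum_nonneg fun i _ => integral_nonneg fun _ => sq_nonneg _)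
  refine ⟨h1.trans (mul_le_mul_of_nonneg_right ?_ hW), ?_,
    h3.trans (mul_le_mul_of_nonneg_right ?_ (add_nonneg hG hJ))⟩
  · have : 0 ≤ C₂ * (1 + C₁) := by positivity
    linarith
  · calc _ ≤ C₂ * (T.normSq g.eval + T.normSq (pgrad p)) := h2
      _ ≤ C₂ * (T.normSq g.eval + C₁ * T.normSq g.eval) := by gcongr
      _ = C₂ * (1 + C₁) * T.normSq g.eval := by ring
      _ ≤ _ := mul_le_mul_of_nonneg_right (by linarith) hW
  · have : 0 ≤ C₂ * (1 + C₁) := by positivity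
    linarith

end Element

/-- Replaces a weak function on one element by global polynomials with the same weak gradient,
gradient norm and jumps. Since `q ≤ k`, the jumps have degree at most `k`. -/
lemma WeakFunction.exists_poly {m k q : ℕ} (hqk : q ≤ k) {Ω : Set (E (m + 1))} {𝒯 : Partition Ω}
    (r : Fin 𝒯.numElems → ℕ) {v : WeakFunction 𝒯} (hv : v.MemVh k q) (T : Fin 𝒯.numElems) :
    ∃ (p : MvPolynomial (Fin (m + 1)) ℝ)
      (pb : Fin (𝒯.elem T).numFaces → MvPolynomial (Fin (m + 1)) ℝ),
      p.totalDegree ≤ k ∧ (∀ i, (pb i).totalDegree ≤ k) ∧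
      (𝒯.elem T).Green p pb (v.weakGrad r T) ∧
      v.gradSq T = (𝒯.elem T).normSq (pgrad p) ∧ v.jumpSq T = (𝒯.elem T).polyJumpSq p pb := by
  obtain ⟨p, hp, hvp⟩ := hv.1 T
  choose pb hpb hvpb using hv.2 T
  refine ⟨p, pb, hp, fun i => (hpb i).trans hqk, ?_, ?_, ?_⟩
  · refine (𝒯.elem T).green_of_isWeakGrad hvp hvpb
      ((𝒯.elem T).isWeakGrad_weakGrad _ _ _ ?_ fun i => ?_)
    · exact ((𝒯.elem T).integrableOn_of_continuous (Element.continuous_peval p)).congr_fun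
        (fun x hx => (hvp x (subset_closure hx)).symm) (𝒯.elem T).isOpen.measurableSet
    · exact ((𝒯.elem T).integrableOn_face (Element.continuous_peval (pb i)) i).congr_fun
        (fun x hx => (hvpb i x hx).symm) ((𝒯.elem T).measurableSet_face i)
  · refine setIntegral_congr_fun (𝒯.elem T).isOpen.measurableSet fun x hx => ?_
    simp only [(𝒯.elem T).gradient_eq hvp hx]
  · refine Finset.sum_congr rfl fun i _ =>
      setIntegral_congr_fun ((𝒯.elem T).measurableSet_face i) fun x hx => ?_
    simp only [hvp x ((𝒯.elem T).face_subset i hx), hvpb i x hx]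

end WG

end

theorem mainTheorem3 (d k q : ℕ) (hd : 1 ≤ d) (hqk : q ≤ k) (ρv ρe κ σ τ : ℝ)
    (hρv : 0 < ρv) (hρe : 0 < ρe) (hκ : 0 < κ) (hσ : 0 < σ) (hτ : 0 < τ) :
    ∃ s : ℕ → ℕ, ∀ R : ℕ, ∃ C C₁ C₂ : ℝ, 0 < C ∧ 0 < C₁ ∧ 0 < C₂ ∧
      ∀ (Ω : Set (WG.E d)) (𝒯 : WG.Partition Ω),
        (∀ T, (𝒯.elem T).ShapeRegular ρv ρe κ σ τ) →
        ∀ r : Fin 𝒯.numElems → ℕ,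
          (∀ T, 2 * (𝒯.elem T).numFaces + k - 1 ≤ r T ∧ r T ≤ R) →
          (∀ T, (𝒯.elem T).HasCoplanarFaces → s (𝒯.elem T).numFaces ≤ r T) →
          ∀ v : WG.WeakFunction 𝒯, v.MemVh k q →
            (∀ T, √(v.gradSq T) ≤ C * √(v.weakGradSq r T)) ∧
            C₁ * v.norm1h ≤ v.energyNorm r ∧ v.energyNorm r ≤ C₂ * v.norm1h := by
  obtain ⟨m, rfl⟩ : ∃ m, d = m + 1 := ⟨d - 1, by omega⟩
  choose s C hC H using fun N => WG.Element.exists_element_bounds m k N (σ := σ) hρv hρe hκ hτ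
  refine ⟨s, fun R => ?_⟩
  -- One constant for all face counts: `2 * N + k - 1 ≤ R` forces `N ≤ R`.
  set A : ℝ := ∑ N ∈ Finset.range (R + 1), C N R with hA
  have hCA : ∀ N ≤ R, C N R ≤ A := fun N hN =>
    Finset.single_le_sum (f := fun N => C N R) (fun N _ => (hC N R).le)
      (Finset.mem_range.2 (by omega))
  have hA0 : 0 < A := (hC 0 R).trans_le (hCA 0 (Nat.zero_le R))
  -- The factor `2` in the lower constant comes from adding the gradient and jump estimates.
  refine ⟨√A, (√(2 * A))⁻¹, √A, by positivity, by positivity, by positivity, ?_⟩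
  intro Ω 𝒯 hS r hr hs v hv
  have key : ∀ T, v.gradSq T ≤ A * v.weakGradSq r T ∧
      (𝒯.elem T).diam⁻¹ * v.jumpSq T ≤ A * v.weakGradSq r T ∧
      v.weakGradSq r T ≤ A * (v.gradSq T + (𝒯.elem T).diam⁻¹ * v.jumpSq T) ∧
      0 ≤ v.weakGradSq r T ∧ 0 ≤ v.gradSq T + (𝒯.elem T).diam⁻¹ * v.jumpSq T := by
    intro T
    obtain ⟨p, pb, hp, hpb, hg, e1, e2⟩ := WG.WeakFunction.exists_poly hqk r hv T
    have hrT := hr T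
    obtain ⟨h1, h2, h3⟩ := H (𝒯.elem T).numFaces R (𝒯.elem T) (hS T) rfl (r T) hrT.1 hrT.2 (hs T)
      p pb (v.weakGrad r T) hp hpb hg
    rw [← e1] at h1
    rw [← e2] at h2
    rw [← e1, ← e2] at h3
    have hW : 0 ≤ v.weakGradSq r T := (𝒯.elem T).normSq_nonneg _
    have hG : 0 ≤ v.gradSq T := (𝒯.elem T).normSq_nonneg _
    have hJ : 0 ≤ v.jumpSq T :=
      Finset.sum_nonneg fun i _ => MeasureTheory.integral_nonneg fun _ => sq_nonneg _
    have hJ' : 0 ≤ (𝒯.elem T).diam⁻¹ * v.jumpSq T :=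
      mul_nonneg (inv_nonneg.2 (𝒯.elem T).diam_pos.le) hJ
    have hle := hCA (𝒯.elem T).numFaces (by omega)
    exact ⟨h1.trans (mul_le_mul_of_nonneg_right hle hW),
      h2.trans (mul_le_mul_of_nonneg_right hle hW),
      h3.trans (mul_le_mul_of_nonneg_right hle (add_nonneg hG hJ')), hW, add_nonneg hG hJ'⟩
  refine ⟨fun T => ?_, ?_, ?_⟩
  · rw [← Real.sqrt_mul hA0.le]
    exact Real.sqrt_le_sqrt (key T).1
  · rw [inv_mul_le_iff₀ (by positivity), WG.WeakFunction.norm1h, WG.WeakFunction.energyNorm,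
      ← Real.sqrt_mul (by positivity), Finset.mul_sum]
    refine Real.sqrt_le_sqrt (Finset.sum_le_sum fun T _ => ?_)
    have := key T
    linarith [this.1, this.2.1]
  · rw [WG.WeakFunction.norm1h, WG.WeakFunction.energyNorm, ← Real.sqrt_mul hA0.le, Finset.mul_sum]
    exact Real.sqrt_le_sqrt (Finset.sum_le_sum fun T _ => (key T).2.2.1)
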